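/- Let $K$ be a complete non-archimedean field with non-trivial absolute value and let $H$ be a (unital, associative, not necessarily commutative) $K$-algebra. A $K$-Banach space is orthonormalizable if it has an orthonormal basis (it is isometric to some $c_0(I,K)$). A continuous linear map between Banach spaces is called compact if it is a limit, in operator norm, of continuous maps of finite rank. For a compact endomorphism $U$ of an orthonormalizable Banach space, $\det(1-TU)\in K[[T]]$ is its Fredholm series: the coefficient of $T^n$ is $(-1)^n$ times the sum of the principal $n\times n$ minors of the matrix of $U$ in an orthonormal basis. For a $K$-vector space $M$ with a representation of $H$ and an endomorphism $u$ commuting with $H$, and for a monic irreducible $Q\in K[X]$ with $Q\ne X$, put $M(Q)=\bigcup_{n}\ker Q(u)^n$, which is stable under $H$. Let $\mathcal X_u(M)$ be the collection of irreducible representations of $H$, counted with multiplicity in $\mathbb N\cup\{\infty\}$, that occur in the semisimplifications of the $M(Q)$, where $Q$ runs through all such polynomials. (1) Let $\rho_i$ ($i=1,2$) be representations of $H$ by continuous endomorphisms of orthonormalizable $K$-Banach spaces $V_i$, and let $U_i$ be a compact endomorphism of $V_i$ commuting with $\rho_i(H)$. If $\det(1-T\rho_1(h)U_1)=\det(1-T\rho_2(h)U_2)$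 for all $h\in H$, then $\mathcal X_{U_1}(V_1)=\mathcal X_{U_2}(V_2)$, with multiplicities. (2) A system of Banach spaces $E$ is a sequence of orthonormalizable $K$-Banach spaces $E_n$ ($n\in\mathbb N$) with compact linear maps $\iota_n:E_n\to E_{n+1}$; let $E^\dagger=\varinjlim E_n$. An endomorphism $U$ of $E$ is given by continuous endomorphisms $U_n$ of $E_n$ for all large $n$ with $\iota_nU_n=U_{n+1}\iota_n$, and two such are identified if they agree for all large $n$; they form a $K$-algebra $\mathrm{End}(E)$, which acts on $E^\dagger$. The endomorphism $U$ is compact if for all large $n$ there is a continuous $T_n:E_{n+1}\to E_n$ with $T_n\iota_n=U_n$ and $\iota_nT_n=U_{n+1}$; then $\det(1-TU)$ denotes the series $\det(1-TU_n)$, which does not depend on $n$ for $n$ large. Let $E^1,E^2$ be two systems of Banach spaces, $\rho_i:H\to\mathrm{End}(E^i)$ morphisms of $K$-algebras, and $U_i$ compact endomorphisms of $E^i$ commuting with $\rho_i(H)$. If $\det(1-T\rho_1(h)U_1)=\det(1-T\rho_2(h)U_2)$ for all $h\in H$, then $\mathcal X_{U_1}(E^{1,\dagger})=\mathcal X_{U_2}(E^{2,\dagger})$,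 with multiplicities. -/

import Mathlib

namespace PadicSpectral

universe u v w x

/-! Banach spaces over a complete non-archimedean field -/

/-- An orthonormal basis, indexed by `ι`, of a Banach space `V` over a complete non-archimedean
field `K`: every `v` is the sum of a family `a i • e i` with `a i → 0`, the coefficients `a i` are
uniquely determined by `v`, and `‖v‖ = sup ‖a i‖` (which is `0` if `ι` is empty). Equivalently, an
isometric isomorphism of `V` with the space `c₀(ι, K)`. -/
structure ONBasis (K : Type u) (V : Type v) [NontriviallyNormedField K] [NormedAddCommGroup V]
    [NormedSpace K V] (ι : Type w) where
  vec : ι → V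
  coord : ι → V →ₗ[K] K
  hasSum : ∀ v, HasSum (fun i => coord i v • vec i) v
  tendsto_coord : ∀ v, Filter.Tendsto (fun i => coord i v) Filter.cofinite (nhds 0)
  coord_vec_self : ∀ i, coord i (vec i) = 1
  coord_vec_ne : ∀ i j, i ≠ j → coord i (vec j) = 0
  norm_eq : ∀ v, ‖v‖ = ⨆ i, ‖coord i v‖

section Operators

variable {K : Type u} [NontriviallyNormedField K]

/-- Compact (completely continuous) operators between Banach spaces over a non-archimedean field:
limits, for the operator norm, of continuous operators of finite rank. (If `K` is not locally
compact this is not the property that bounded sets are relatively compact.) -/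
def IsCompletelyContinuous {V : Type v} {W : Type w} [NormedAddCommGroup V] [NormedSpace K V]
    [NormedAddCommGroup W] [NormedSpace K W] (f : V →L[K] W) : Prop :=
  f ∈ closure {g : V →L[K] W | FiniteDimensional K (LinearMap.range (g : V →ₗ[K] W))}

open Classical in
/-- The characteristic power series `det (1 - T U)` of a compact operator `U`. Its `n`-th
coefficient is `(-1) ^ n` times the sum of all principal `n × n` minors of the matrix of `U` in the
orthonormal basis `b`. -/
noncomputable def charSeries {V : Type v} [NormedAddCommGroup V] [NormedSpace K V] {ι : Type w}
    (b : ONBasis K V ι) (U : V →L[K] V) : PowerSeries K :=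
  PowerSeries.mk fun n => (-1) ^ n *
    ∑' s : {s : Finset ι // s.card = n},
      (Matrix.of fun i j : (s : Finset ι) => b.coord i (U (b.vec j))).det

/-- A continuous endomorphism seen as a linear endomorphism, as a morphism of `K`-algebras. -/
def forgetTopology (K : Type u) [NontriviallyNormedField K] (V : Type v) [NormedAddCommGroup V]
    [NormedSpace K V] : (V →L[K] V) →ₐ[K] Module.End K V where
  toFun f := f
  map_one' := rfl
  map_mul' _ _ := rfl
  map_zero' := rfl
  map_add' _ _ := rfl
  commutes' _ := rfl

end Operators

/-! Multiplicities of irreducible representations -/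

section Multiplicity

/-- The multiplicity of the simple module `S` in the semisimplification of the module `M`
(Jordan–Hölder multiplicity): the largest number of steps with quotient isomorphic to `S` in a
finite strictly increasing chain of submodules of `M`. -/
noncomputable def jhMultiplicity (A : Type u) [Ring A] (M : Type v) [AddCommGroup M] [Module A M]
    (S : Type w) [AddCommGroup S] [Module A S] : ℕ∞ :=
  ⨆ c : LTSeries (Submodule A M),
    Set.encard {j : Fin c.length |
      Nonempty (((c j.succ) ⧸ (c j.castSucc).submoduleOf (c j.succ)) ≃ₗ[A] S)}

variable {K : Type u} [Field K] {H : Type v} [Ring H] [Algebra K H]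
  {M : Type w} [AddCommGroup M] [Module K M]

/-- The space `M` of a representation `φ` of `H`, as an `H`-module. -/
def RepSpace (_φ : H →ₐ[K] Module.End K M) : Type w := M

instance (φ : H →ₐ[K] Module.End K M) : AddCommGroup (RepSpace φ) :=
  inferInstanceAs (AddCommGroup M)

instance (φ : H →ₐ[K] Module.End K M) : Module H (RepSpace φ) :=
  Module.compHom M (φ : H →+* Module.End K M)

/-- The generalized eigenspace of `u` attached to a polynomial `Q`: the union of the kernels of the
powers of `Q(u)`. -/
def genKer (u : Module.End K M) (Q : Polynomial K) : Submodule K M where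
  carrier := {m | ∃ n : ℕ, (Polynomial.aeval u Q ^ n) m = 0}
  zero_mem' := ⟨0, map_zero _⟩
  add_mem' := by
    rintro a b ⟨n, hn⟩ ⟨k, hk⟩
    refine ⟨n + k, ?_⟩
    have h1 : (Polynomial.aeval u Q ^ (n + k)) a = 0 := by
      rw [add_comm, pow_add, Module.End.mul_apply, hn, map_zero]
    have h2 : (Polynomial.aeval u Q ^ (n + k)) b = 0 := by
      rw [pow_add, Module.End.mul_apply, hk, map_zero]
    rw [map_add, h1, h2, add_zero]
  smul_mem' := by
    rintro c m ⟨n, hn⟩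
    exact ⟨n, by rw [map_smul, hn, smul_zero]⟩

theorem genKer_stable (u f : Module.End K M) (hf : Commute f u) (Q : Polynomial K) (m : M)
    (hm : m ∈ genKer u Q) : f m ∈ genKer u Q := by
  obtain ⟨n, hn⟩ := hm
  have hc : Commute f (Polynomial.aeval u Q ^ n) := by
    refine Commute.pow_right ?_ n
    clear hn
    induction Q using Polynomial.induction_on' with
    | add p q hp hq =>
      rw [map_add]
      exact hp.add_right hq
    | monomial k a =>
      rw [Polynomial.aeval_monomial]
      exact Commute.mul_right (Algebra.commutes a f).symm (hf.pow_right k)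
  refine ⟨n, ?_⟩
  have := LinearMap.congr_fun hc.eq m
  rw [Module.End.mul_apply, Module.End.mul_apply, hn, map_zero] at this
  exact this.symm

/-- The generalized eigenspace `genKer u Q` as an `H`-module, when `u` commutes with `H`. -/
def genEigen (φ : H →ₐ[K] Module.End K M) (u : Module.End K M) (hu : ∀ h, Commute (φ h) u)
    (Q : Polynomial K) : Submodule H (RepSpace φ) where
  carrier := (genKer u Q : Set M)
  zero_mem' := (genKer u Q).zero_mem
  add_mem' := (genKer u Q).add_mem
  smul_mem' h m hm := genKer_stable u (φ h) (hu h) Q m hm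

/-- The monic irreducible polynomials other than `X`: the reciprocal polynomials of the irreducible
polynomials with constant term `1`. -/
def NonzeroPrime (K : Type u) [Field K] : Type u :=
  {Q : Polynomial K // Q.Monic ∧ Irreducible Q ∧ Q ≠ Polynomial.X}

/-- The multiplicity of the simple `H`-module `S` in the union, over all monic irreducible `Q ≠ X`,
of the semisimplifications of the generalized eigenspaces of `u` attached to `Q` (the sum of the
multiplicities, as a supremum of finite partial sums). -/
noncomputable def finiteSlopeMultiplicity (φ : H →ₐ[K] Module.End K M) (u : Module.End K M)
    (hu : ∀ h, Commute (φ h) u) (S : Type x) [AddCommGroup S] [Module H S] : ℕ∞ :=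
  ⨆ F : Finset (NonzeroPrime K), ∑ Q ∈ F, jhMultiplicity H (genEigen φ u hu Q.1) S

end Multiplicity

/-! Systems of Banach spaces -/

/-- A system of Banach spaces: a sequence of orthonormalizable Banach spaces with compact
transition maps `space n → space (n + 1)`. -/
structure BanachSystem (K : Type u) [NontriviallyNormedField K] where
  space : ℕ → Type v
  [normedAddCommGroup : ∀ n, NormedAddCommGroup (space n)]
  [normedSpace : ∀ n, NormedSpace K (space n)]
  [completeSpace : ∀ n, CompleteSpace (space n)]
  index : ℕ → Type w
  basis : ∀ n, ONBasis K (space n) (index n)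
  map : ∀ n, space n →L[K] space (n + 1)
  map_compact : ∀ n, IsCompletelyContinuous (map n)

namespace BanachSystem

attribute [instance] normedAddCommGroup normedSpace completeSpace

variable {K : Type u} [NontriviallyNormedField K] (E : BanachSystem.{u, v, w} K)

/-- Sequences of continuous endomorphisms of the `E.space n` that commute with the transition maps
for all large `n`. (An endomorphism of `E` is given by its values for large `n` only; the other
terms are irrelevant and will be divided out.) -/
def compatSeq : Subalgebra K (∀ n, E.space n →L[K] E.space n) where
  carrier := {f | ∀ᶠ n in Filter.atTop, (E.map n).comp (f n) = (f (n + 1)).comp (E.map n)}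
  mul_mem' := by
    intro f g hf hg
    filter_upwards [hf, hg] with n h1 h2
    ext x
    have e1 := DFunLike.congr_fun h1 (g n x)
    have e2 := DFunLike.congr_fun h2 x
    exact e1.trans (congrArg (f (n + 1)) e2)
  add_mem' := by
    intro f g hf hg
    filter_upwards [hf, hg] with n h1 h2
    simp only [Pi.add_apply, ContinuousLinearMap.comp_add, ContinuousLinearMap.add_comp, h1, h2]
  algebraMap_mem' := by
    intro r
    refine Filter.Eventually.of_forall fun n => ?_
    ext x
    simp [Algebra.algebraMap_eq_smul_one]

/-- Two sequences define the same endomorphism of `E` if they agree for all large `n`. -/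
def tailCon : RingCon E.compatSeq where
  r f g := ∀ᶠ n in Filter.atTop, f.1 n = g.1 n
  iseqv :=
    { refl := fun _ => Filter.Eventually.of_forall fun _ => rfl
      symm := fun h => h.mono fun _ hn => hn.symm
      trans := fun h h' => by filter_upwards [h, h'] with n h1 h2 using h1.trans h2 }
  add' := by
    intro a b c d h h'
    filter_upwards [h, h'] with n h1 h2
    exact congrArg₂ (· + ·) h1 h2
  mul' := by
    intro a b c d h h'
    filter_upwards [h, h'] with n h1 h2
    exact congrArg₂ (· * ·) h1 h2

/-- The `K`-algebra of endomorphisms of the system `E`. -/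
abbrev Endo : Type _ := E.tailCon.Quotient

/-- `E.Represents f U`: the sequence `f n`, for `n` large, is the endomorphism `U` of `E`. -/
def Represents (f : E.compatSeq) (U : E.Endo) : Prop := (f : E.tailCon.Quotient) = U

/-- Compact endomorphisms of `E`: for all large `n` there is a continuous
`T : space (n + 1) → space n` with `T ∘ map n = U n` and `map n ∘ T = U (n + 1)`. -/
def IsCompact (U : E.Endo) : Prop :=
  ∃ f : E.compatSeq, E.Represents f U ∧ ∀ᶠ n in Filter.atTop,
    ∃ T : E.space (n + 1) →L[K] E.space n,
      T.comp (E.map n) = f.1 n ∧ (E.map n).comp T = f.1 (n + 1)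

/-- `P` is the characteristic power series of `U` on `E.space n` for all large `n`. -/
def IsCharSeries (U : E.Endo) (P : PowerSeries K) : Prop :=
  ∃ f : E.compatSeq, E.Represents f U ∧
    ∀ᶠ n in Filter.atTop, charSeries (E.basis n) (f.1 n) = P

open Classical in
/-- The Fredholm series `det (1 - T U)` of a compact endomorphism `U` of `E`: the common value, for
all large `n`, of the characteristic power series of `U` on `E.space n`. -/
noncomputable def fredholmSeries (U : E.Endo) : PowerSeries K :=
  if h : ∃ P, E.IsCharSeries U P then h.choose else 0

/-- The transition map `space n → space m` for `n ≤ m`. -/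
def transition (n m : ℕ) (h : n ≤ m) : E.space n →ₗ[K] E.space m :=
  Nat.leRec (motive := fun m _ => E.space n →ₗ[K] E.space m) LinearMap.id
    (fun k _ g => (E.map k : E.space k →ₗ[K] E.space (k + 1)).comp g) h

/-- The inductive limit of the system. -/
abbrev Dagger : Type _ := Module.DirectLimit E.space E.transition

/-- The canonical map from `space n` to the inductive limit. -/
noncomputable abbrev toDagger (n : ℕ) : E.space n →ₗ[K] E.Dagger :=
  Module.DirectLimit.of K ℕ E.space E.transition n

theorem transition_self (n : ℕ) : E.transition n n le_rfl = LinearMap.id :=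
  Nat.leRec_self _ _

theorem transition_succ (n m : ℕ) (h : n ≤ m) (h' : n ≤ m + 1) (x : E.space n) :
    E.transition n (m + 1) h' x = E.map m (E.transition n m h x) := by
  unfold transition
  rw [Nat.leRec_succ _ _ h]
  rfl

theorem transition_trans (n m k : ℕ) (h : n ≤ m) (h' : m ≤ k) (x : E.space n) :
    E.transition m k h' (E.transition n m h x) = E.transition n k (h.trans h') x := by
  induction k, h' using Nat.le_induction with
  | base => rw [transition_self]; rfl
  | succ k hk ih => rw [E.transition_succ m k hk, ih, ← E.transition_succ n k (h.trans hk)]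

theorem compat_transition {f : ∀ n, E.space n →L[K] E.space n} {N : ℕ}
    (hN : ∀ n, N ≤ n → (E.map n).comp (f n) = (f (n + 1)).comp (E.map n))
    (n m : ℕ) (hn : N ≤ n) (h : n ≤ m) (x : E.space n) :
    E.transition n m h (f n x) = f m (E.transition n m h x) := by
  induction m, h using Nat.le_induction with
  | base => simp [transition_self]
  | succ m hm ih =>
    rw [E.transition_succ n m hm, E.transition_succ n m hm, ih]
    exact DFunLike.congr_fun (hN m (hn.trans hm)) _

/-- A rank from which on `f` commutes with the transition maps. -/
noncomputable def rank (f : E.compatSeq) : ℕ := (Filter.eventually_atTop.1 f.2).choose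

theorem rank_spec (f : E.compatSeq) (n : ℕ) (h : E.rank f ≤ n) :
    (E.map n).comp (f.1 n) = (f.1 (n + 1)).comp (E.map n) :=
  (Filter.eventually_atTop.1 f.2).choose_spec n h

theorem dagger_aux (f : E.compatSeq) (n m m' : ℕ) (h : n ≤ m) (hm : E.rank f ≤ m) (hm' : m ≤ m')
    (x : E.space n) :
    E.toDagger m' (f.1 m' (E.transition n m' (h.trans hm') x)) =
      E.toDagger m (f.1 m (E.transition n m h x)) := by
  rw [← E.transition_trans n m m' h hm', ← E.compat_transition (E.rank_spec f) m m' hm hm']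
  exact Module.DirectLimit.of_f

/-- For `x : space n`, the class of `f m x` for a large `m`. -/
noncomputable def daggerStep (f : E.compatSeq) (n : ℕ) : E.space n →ₗ[K] E.Dagger :=
  (E.toDagger (max n (E.rank f))).comp
    ((f.1 (max n (E.rank f))).toLinearMap.comp (E.transition n _ (le_max_left _ _)))

theorem daggerStep_compat (f : E.compatSeq) (i j : ℕ) (hij : i ≤ j) (x : E.space i) :
    E.daggerStep f j (E.transition i j hij x) = E.daggerStep f i x := by
  have e := E.transition_trans i j (max j (E.rank f)) hij (le_max_left _ _) x
  refine (congrArg (fun y => E.toDagger (max j (E.rank f)) (f.1 _ y)) e).trans ?_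
  exact E.dagger_aux f i (max i (E.rank f)) (max j (E.rank f)) (le_max_left _ _)
    (le_max_right _ _) (max_le_max_right _ hij) x

/-- The action on the inductive limit of a sequence of endomorphisms: for large `m`, the class of
`x : space m` is sent to the class of `f m x`. -/
noncomputable def daggerMap (f : E.compatSeq) : E.Dagger →ₗ[K] E.Dagger :=
  Module.DirectLimit.lift K ℕ E.space E.transition (E.daggerStep f) (E.daggerStep_compat f)

theorem daggerMap_of (f : E.compatSeq) (n : ℕ) (hn : E.rank f ≤ n) (x : E.space n) :
    E.daggerMap f (E.toDagger n x) = E.toDagger n (f.1 n x) := by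
  unfold daggerMap
  rw [Module.DirectLimit.lift_of]
  have := E.dagger_aux f n n (max n (E.rank f)) le_rfl hn (le_max_left _ _) x
  rw [E.transition_self] at this
  exact this

theorem dagger_ext {g g' : E.Dagger →ₗ[K] E.Dagger} (N : ℕ)
    (h : ∀ n, N ≤ n → ∀ x, g (E.toDagger n x) = g' (E.toDagger n x)) : g = g' := by
  refine Module.DirectLimit.hom_ext (fun n => ?_)
  ext x
  have hx : E.toDagger n x = E.toDagger (max n N) (E.transition n _ (le_max_left _ _) x) :=
    Module.DirectLimit.of_f.symm
  simp only [LinearMap.comp_apply]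
  rw [hx]
  exact h _ (le_max_right _ _) _

/-- The action of compatible sequences on the inductive limit, as a morphism of algebras. -/
noncomputable def daggerHom : E.compatSeq →ₐ[K] Module.End K E.Dagger where
  toFun := E.daggerMap
  map_one' := E.dagger_ext (E.rank 1) fun n hn x => by rw [E.daggerMap_of _ n hn]; rfl
  map_mul' f g := E.dagger_ext (max (E.rank (f * g)) (max (E.rank f) (E.rank g))) fun n hn x => by
    simp only [max_le_iff] at hn
    rw [E.daggerMap_of _ n hn.1, Module.End.mul_apply, E.daggerMap_of _ n hn.2.2,
      E.daggerMap_of _ n hn.2.1]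
    rfl
  map_zero' := E.dagger_ext (E.rank 0) fun n hn x => by
    rw [E.daggerMap_of _ n hn]; exact map_zero (E.toDagger n)
  map_add' f g := E.dagger_ext (max (E.rank (f + g)) (max (E.rank f) (E.rank g))) fun n hn x => by
    simp only [max_le_iff] at hn
    rw [E.daggerMap_of _ n hn.1, LinearMap.add_apply, E.daggerMap_of _ n hn.2.2,
      E.daggerMap_of _ n hn.2.1]
    exact map_add (E.toDagger n) _ _
  commutes' r := E.dagger_ext (E.rank (algebraMap K _ r)) fun n hn x => by
    rw [E.daggerMap_of _ n hn]; exact map_smul (E.toDagger n) r x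

/-- The action of the algebra of endomorphisms of `E` on the inductive limit. -/
noncomputable def action : E.Endo →ₐ[K] Module.End K E.Dagger :=
  E.tailCon.liftₐ E.daggerHom (by
    intro f g hfg
    obtain ⟨N, hN⟩ := Filter.eventually_atTop.1 (show ∀ᶠ n in Filter.atTop, f.1 n = g.1 n from hfg)
    refine E.dagger_ext (max N (max (E.rank f) (E.rank g))) fun n hn x => ?_
    simp only [max_le_iff] at hn
    exact (E.daggerMap_of f n hn.2.1 x).trans
      ((congrArg (fun k => E.toDagger n (k x)) (hN n hn.1)).trans (E.daggerMap_of g n hn.2.2 x).symm))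

/-- The multiplicity of the simple `H`-module `S` in the finite slope part of the inductive limit of
a system `E` with an action `ρ` of `H` and a compact endomorphism `U` commuting with it. As `U` is
compact, the generalized eigenspaces of `U` in the limit for eigenvalues of absolute value `r > 0`
span the image of the slope `r` part of `space n` for all large `n`. -/
noncomputable def multiplicity {H : Type x} [Ring H] [Algebra K H] (ρ : H →ₐ[K] E.Endo)
    (U : E.Endo) (hU : ∀ h, Commute (ρ h) U) (S : Type*) [AddCommGroup S] [Module H S] : ℕ∞ :=
  finiteSlopeMultiplicity (E.action.comp ρ) (E.action U) (fun h => (hU h).map E.action) S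

end BanachSystem

/-- The multiplicity of the simple `H`-module `S` in the finite slope part of a Banach space `V`
with an action `ρ` of `H` and a compact endomorphism `U` commuting with it. -/
noncomputable def banachMultiplicity {K : Type u} [NontriviallyNormedField K] {H : Type x} [Ring H]
    [Algebra K H] {V : Type v} [NormedAddCommGroup V] [NormedSpace K V] (ρ : H →ₐ[K] (V →L[K] V))
    (U : V →L[K] V) (hU : ∀ h, Commute (ρ h) U) (S : Type*) [AddCommGroup S] [Module H S] : ℕ∞ :=
  finiteSlopeMultiplicity ((forgetTopology K V).comp ρ) (forgetTopology K V U)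
    (fun h => (hU h).map (forgetTopology K V)) S

end PadicSpectral

namespace PadicSpectral

open Filter Topology TensorProduct

set_option linter.unusedSectionVars false

section InfiniteDeterminants

variable {L : Type*} [NormedField L] [IsUltrametricDist L]

theorem norm_prod_sub_prod_le {n : Type*} (s : Finset n) (a b : n → L) (R : n → ℝ) {ε : ℝ}
    (hε : 0 ≤ ε) (ha : ∀ i, ‖a i‖ ≤ R i) (hb : ∀ i, ‖b i‖ ≤ R i)
    (hab : ∀ i, ‖a i - b i‖ ≤ ε * R i) :
    ‖∏ i ∈ s, a i - ∏ i ∈ s, b i‖ ≤ ε * ∏ i ∈ s, R i := by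
  classical
  have hR : ∀ i, 0 ≤ R i := fun i => (norm_nonneg _).trans (ha i)
  induction s using Finset.induction_on with
  | empty => simpa using hε
  | insert i s hi ih =>
    rw [Finset.prod_insert hi, Finset.prod_insert hi, Finset.prod_insert hi]
    have h1 : a i * ∏ i ∈ s, a i - b i * ∏ i ∈ s, b i =
        (a i - b i) * ∏ i ∈ s, a i + b i * (∏ i ∈ s, a i - ∏ i ∈ s, b i) := by ring
    rw [h1]
    refine (IsUltrametricDist.norm_add_le_max _ _).trans (max_le ?_ ?_)
    · rw [norm_mul, ← mul_assoc]
      refine mul_le_mul (hab i) ?_ (norm_nonneg _) (mul_nonneg hε (hR i))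
      rw [norm_prod]
      exact Finset.prod_le_prod (fun _ _ => norm_nonneg _) fun i _ => ha i
    · rw [norm_mul]
      calc ‖b i‖ * ‖∏ i ∈ s, a i - ∏ i ∈ s, b i‖ ≤ R i * (ε * ∏ i ∈ s, R i) :=
            mul_le_mul (hb i) ih (norm_nonneg _) (hR i)
        _ = _ := by ring

theorem norm_det_sub_det_le {n : Type*} [Fintype n] [DecidableEq n] (A B : Matrix n n L)
    (R : n → ℝ) {ε : ℝ} (hε : 0 ≤ ε) (ha : ∀ i j, ‖A i j‖ ≤ R i) (hb : ∀ i j, ‖B i j‖ ≤ R i)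
    (hab : ∀ i j, ‖A i j - B i j‖ ≤ ε * R i) :
    ‖A.det - B.det‖ ≤ ε * ∏ i, R i := by
  rw [← Matrix.det_transpose A, ← Matrix.det_transpose B, Matrix.det_apply, Matrix.det_apply,
    ← Finset.sum_sub_distrib]
  have hR : 0 ≤ ∏ i, R i := Finset.prod_nonneg fun i _ => (norm_nonneg _).trans (ha i i)
  refine IsUltrametricDist.norm_sum_le_of_forall_le_of_nonneg (mul_nonneg hε hR) fun σ _ => ?_
  rw [← smul_sub]
  have h1 : ∀ x : L, ‖Equiv.Perm.sign σ • x‖ = ‖x‖ := by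
    intro x
    rcases Int.units_eq_one_or (Equiv.Perm.sign σ) with h | h <;> simp [h]
  rw [h1]
  simpa [Matrix.transpose_apply] using norm_prod_sub_prod_le Finset.univ (fun i => A i (σ i))
    (fun i => B i (σ i)) R hε (fun i => ha _ _) (fun i => hb _ _) (fun i => hab _ _)

theorem norm_det_le {n : Type*} [Fintype n] [DecidableEq n] (A : Matrix n n L)
    (R : n → ℝ) (ha : ∀ i j, ‖A i j‖ ≤ R i) : ‖A.det‖ ≤ ∏ i, R i := by
  have hR : 0 ≤ ∏ i, R i := Finset.prod_nonneg fun i _ => (norm_nonneg _).trans (ha i i)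
  rw [← Matrix.det_transpose A, Matrix.det_apply]
  refine IsUltrametricDist.norm_sum_le_of_forall_le_of_nonneg hR fun σ _ => ?_
  have h1 : ∀ x : L, ‖Equiv.Perm.sign σ • x‖ = ‖x‖ := by
    intro x
    rcases Int.units_eq_one_or (Equiv.Perm.sign σ) with h | h <;> simp [h]
  rw [h1, norm_prod]
  exact Finset.prod_le_prod (fun _ _ => norm_nonneg _) fun i _ => ha _ _

theorem exists_prod_max_one_le {I : Type*} {r : I → ℝ} (hr : Tendsto r cofinite (𝓝 0)) :
    ∃ C : ℝ, 1 ≤ C ∧ ∀ S : Finset I, ∏ i ∈ S, max 1 (r i) ≤ C := by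
  classical
  have hF : {i | ¬ r i < 1}.Finite := by
    have := hr.eventually (gt_mem_nhds (zero_lt_one' ℝ))
    rwa [eventually_cofinite] at this
  have h1 : ∀ s : Finset I, 1 ≤ ∏ i ∈ s, max 1 (r i) := fun s =>
    Finset.prod_induction _ (1 ≤ ·) (fun _ _ => one_le_mul_of_one_le_of_one_le) le_rfl
      fun i _ => le_max_left _ _
  refine ⟨∏ i ∈ hF.toFinset, max 1 (r i), h1 _, fun S => ?_⟩
  have h2 : ∏ i ∈ S ∪ hF.toFinset, max 1 (r i) = ∏ i ∈ hF.toFinset, max 1 (r i) := by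
    refine (Finset.prod_subset Finset.subset_union_right fun i _ hi => ?_).symm
    have : r i < 1 := by simpa using hi
    exact max_eq_left this.le
  rw [← h2, ← Finset.prod_sdiff (Finset.subset_union_left (s₁ := S) (s₂ := hF.toFinset))]
  exact le_mul_of_one_le_left (zero_le_one.trans (h1 _)) (h1 _)

/-- The rows of the matrix `M` are bounded, and their bounds tend to `0`. -/
def RowNull {I J : Type*} (M : Matrix I J L) : Prop :=
  ∃ r : I → ℝ, (∀ i, 0 ≤ r i) ∧ (∀ i j, ‖M i j‖ ≤ r i) ∧ Tendsto r cofinite (𝓝 0)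

theorem RowNull.smul {I J : Type*} {M : Matrix I J L} (h : RowNull M) (c : L) :
    RowNull (c • M) := by
  obtain ⟨r, h0, h1, h2⟩ := h
  refine ⟨fun i => ‖c‖ * r i, fun i => mul_nonneg (norm_nonneg _) (h0 i), fun i j => ?_, ?_⟩
  · rw [Matrix.smul_apply, smul_eq_mul, norm_mul]
    exact mul_le_mul_of_nonneg_left (h1 i j) (norm_nonneg _)
  · simpa using h2.const_mul ‖c‖

theorem RowNull.add {I J : Type*} {M N : Matrix I J L} (h : RowNull M) (h' : RowNull N) :
    RowNull (M + N) := by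
  obtain ⟨r, h0, h1, h2⟩ := h
  obtain ⟨r', h0', h1', h2'⟩ := h'
  refine ⟨fun i => max (r i) (r' i), fun i => le_max_of_le_left (h0 i), fun i j => ?_, ?_⟩
  · exact (IsUltrametricDist.norm_add_le_max _ _).trans (max_le_max (h1 i j) (h1' i j))
  · simpa using h2.max h2'

theorem RowNull.bounded {I J : Type*} {M : Matrix I J L} (h : RowNull M) :
    ∃ C : ℝ, 0 ≤ C ∧ ∀ i j, ‖M i j‖ ≤ C := by
  obtain ⟨r, h0, h1, h2⟩ := h
  obtain ⟨C, hC, hS⟩ := exists_prod_max_one_le h2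
  refine ⟨C, zero_le_one.trans hC, fun i j => (h1 i j).trans ?_⟩
  simpa using (le_max_right 1 (r i)).trans (by simpa using hS {i})

theorem norm_le_of_hasSum {α : Type*} {f : α → L} {a : L} (h : HasSum f a) {C : ℝ} (hC : 0 ≤ C)
    (hf : ∀ i, ‖f i‖ ≤ C) : ‖a‖ ≤ C :=
  le_of_tendsto h.norm (Eventually.of_forall fun _ =>
    IsUltrametricDist.norm_sum_le_of_forall_le_of_nonneg hC fun i _ => hf i)

/-- The rows of a product are bounded by those of the first factor. -/
theorem RowNull.of_hasSum_left {I J J' : Type*} {M : Matrix I J L} {N : Matrix J J' L}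
    {P : Matrix I J' L} (hM : RowNull M) {C : ℝ} (hC : 0 ≤ C) (hN : ∀ i j, ‖N i j‖ ≤ C)
    (hP : ∀ i j, HasSum (fun k => M i k * N k j) (P i j)) : RowNull P := by
  obtain ⟨r, h0, h1, h2⟩ := hM
  refine ⟨fun i => r i * C, fun i => mul_nonneg (h0 i) hC, fun i j => ?_, ?_⟩
  · refine norm_le_of_hasSum (hP i j) (mul_nonneg (h0 i) hC) fun k => ?_
    rw [norm_mul]
    exact mul_le_mul (h1 i k) (hN k j) (norm_nonneg _) (h0 i)
  · simpa using h2.mul_const C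

open Classical in
/-- The principal minor of `M` on the rows and columns in `s`. -/
noncomputable def minor {I : Type*} (M : Matrix I I L) (s : Finset I) : L :=
  (Matrix.of fun i j : s => M i j).det

open Classical in
/-- The Fredholm determinant `det (1 + M)`: the sum of the principal minors of `M`. -/
noncomputable def fredDet {I : Type*} (M : Matrix I I L) : L := ∑' s : Finset I, minor M s

open Classical in
/-- The finite determinant approximating `fredDet M`. -/
noncomputable def truncDet {I : Type*} (M : Matrix I I L) (S : Finset I) : L :=
  (1 + Matrix.of fun i j : S => M i j).det

theorem truncDet_eq_sum {I : Type*} (M : Matrix I I L) (S : Finset I) :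
    truncDet M S = ∑ s ∈ S.powerset, minor M s := by
  classical
  let A : Matrix S S L := Matrix.of fun i j : S => M i j
  let D := (Matrix.detRowAlternating : (S → L) [⋀^S]→ₗ[L] L)
  have h1 : truncDet M S = D (A + (1 : Matrix S S L)) := by
    unfold truncDet
    rw [add_comm]
    change Matrix.det _ = Matrix.det _
    congr!
  rw [h1]
  change D ((fun i => A i) + fun i => (1 : Matrix S S L) i) = _
  rw [D.map_add_univ]
  have h2 : ∀ s : Finset S, D (s.piecewise (fun i => A i) fun i => (1 : Matrix S S L) i) =
      minor M (s.map (Function.Embedding.subtype _)) := by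
    intro s
    have h3 := Matrix.det_piecewise_one_eq_submatrix_det A s
    refine Eq.trans (by congr!) (h3.trans ?_)
    let e : s ≃ (s.map (Function.Embedding.subtype (· ∈ S)) : Finset I) :=
      Equiv.ofBijective
        (fun i => ⟨i.1.1, Finset.mem_map_of_mem (Function.Embedding.subtype (· ∈ S)) i.2⟩)
        ⟨fun i j h => Subtype.ext (Subtype.ext (Subtype.mk.inj h)), fun i => by
          obtain ⟨j, hj, hj'⟩ := Finset.mem_map.1 i.2
          exact ⟨⟨j, hj⟩, Subtype.ext hj'⟩⟩
    have h4 : (Matrix.of fun i j : (s.map (Function.Embedding.subtype (· ∈ S)) : Finset I) =>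
        M i j).submatrix e e = A.submatrix Subtype.val Subtype.val := rfl
    rw [← h4, Matrix.det_submatrix_equiv_self, minor]
  rw [Finset.sum_congr rfl fun s _ => h2 s]
  refine Finset.sum_bij (fun s _ => s.map (Function.Embedding.subtype _)) ?_ ?_ ?_ ?_
  · intro s _
    rw [Finset.mem_powerset]
    intro i hi
    obtain ⟨j, _, hj⟩ := Finset.mem_map.1 hi
    rw [← hj]; exact j.2
  · intro s _ t _ h
    exact Finset.map_injective _ h
  · intro s hs
    refine ⟨Finset.subtype (· ∈ S) s, Finset.mem_univ _, ?_⟩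
    exact Finset.subtype_map_of_mem fun x hx => Finset.mem_powerset.1 hs hx
  · intro _ _; rfl

theorem norm_minor_le {I : Type*} (M : Matrix I I L) (s : Finset I) (r : I → ℝ)
    (h : ∀ i j, ‖M i j‖ ≤ r i) : ‖minor M s‖ ≤ ∏ i ∈ s, r i := by
  classical
  rw [← Finset.prod_coe_sort s r]
  exact norm_det_le _ (fun i : s => r i) fun i j => h i j

theorem tendsto_minor {I : Type*} {M : Matrix I I L} (h : RowNull M) :
    Tendsto (minor M) cofinite (𝓝 0) := by
  classical
  obtain ⟨r, h0, h1, h2⟩ := h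
  obtain ⟨C, hC, hS⟩ := exists_prod_max_one_le h2
  have hC0 : 0 < C := zero_lt_one.trans_le hC
  rw [Metric.tendsto_nhds]
  intro ε hε
  have hF : {i | ¬ r i < ε / C}.Finite := by
    have := h2.eventually (gt_mem_nhds (div_pos hε hC0))
    rwa [eventually_cofinite] at this
  rw [eventually_cofinite]
  refine (hF.toFinset.powerset.finite_toSet).subset fun s hs => ?_
  simp only [Finset.mem_coe, Finset.mem_powerset]
  intro i hi
  rw [Set.Finite.mem_toFinset]
  intro hlt
  apply hs
  rw [dist_zero_right]
  refine (norm_minor_le M s r h1).trans_lt ?_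
  rw [← Finset.mul_prod_erase s r hi]
  calc r i * ∏ x ∈ s.erase i, r x ≤ r i * C := by
        refine mul_le_mul_of_nonneg_left ((Finset.prod_le_prod (fun j _ => h0 j) fun j _ =>
          le_max_right 1 (r j)).trans (hS _)) (h0 i)
    _ < ε := (lt_div_iff₀ hC0).1 hlt

variable [CompleteSpace L]

theorem hasSum_minor {I : Type*} {M : Matrix I I L} (h : RowNull M) :
    HasSum (minor M) (fredDet M) :=
  (NonarchimedeanAddGroup.summable_of_tendsto_cofinite_zero (tendsto_minor h)).hasSum

theorem tendsto_truncDet {I : Type*} {M : Matrix I I L} (h : RowNull M) :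
    Tendsto (truncDet M) atTop (𝓝 (fredDet M)) := by
  have := (hasSum_minor h).comp tendsto_finset_powerset_atTop_atTop
  exact this.congr fun S => (truncDet_eq_sum M S).symm

theorem fredDet_zero {I : Type*} : fredDet (0 : Matrix I I L) = 1 := by
  classical
  have h : RowNull (0 : Matrix I I L) := ⟨0, by simp, by simp, tendsto_const_nhds⟩
  refine tendsto_nhds_unique (tendsto_truncDet h) (tendsto_const_nhds.congr fun S => ?_)
  have : (Matrix.of fun i j : S => (0 : Matrix I I L) i j) = 0 := rfl
  rw [truncDet, this, add_zero, Matrix.det_one]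

/-- If the finite truncations of two families of matrices have common row bounds tending to `0` and
become close, then so do their determinants. -/
theorem norm_det_one_add_sub_le {n : Type*} [Fintype n] [DecidableEq n] (A B : Matrix n n L)
    (r : n → ℝ) {ε : ℝ} (hε : 0 ≤ ε) (ha : ∀ i j, ‖A i j‖ ≤ r i) (hb : ∀ i j, ‖B i j‖ ≤ r i)
    (hab : ∀ i j, ‖A i j - B i j‖ ≤ ε) :
    ‖(1 + A).det - (1 + B).det‖ ≤ ε * ∏ i, max 1 (r i) := by
  have h1 : ∀ i j, ‖(1 : Matrix n n L) i j‖ ≤ 1 := by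
    intro i j
    by_cases h : i = j <;> simp [Matrix.one_apply, h]
  refine norm_det_sub_det_le _ _ _ hε (fun i j => ?_) (fun i j => ?_) fun i j => ?_
  · exact (IsUltrametricDist.norm_add_le_max _ _).trans (max_le_max (h1 i j) (ha i j))
  · exact (IsUltrametricDist.norm_add_le_max _ _).trans (max_le_max (h1 i j) (hb i j))
  · rw [Matrix.add_apply, Matrix.add_apply, add_sub_add_left_eq_sub]
    exact (hab i j).trans (le_mul_of_one_le_right hε (le_max_left _ _))

end InfiniteDeterminants

section InfiniteDeterminants

variable {L : Type*} [NormedField L] [IsUltrametricDist L] [CompleteSpace L]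

theorem norm_sub_sum_le_of_hasSum {α : Type*} {f : α → L} {a : L} (h : HasSum f a) (S : Finset α)
    {δ : ℝ} (hδ : 0 ≤ δ) (hf : ∀ k ∉ S, ‖f k‖ ≤ δ) : ‖a - ∑ k ∈ S, f k‖ ≤ δ := by
  classical
  refine le_of_tendsto (h.sub_const (∑ k ∈ S, f k)).norm ?_
  filter_upwards [eventually_ge_atTop S] with T hT
  rw [← Finset.sum_sdiff hT, add_sub_cancel_right]
  exact IsUltrametricDist.norm_sum_le_of_forall_le_of_nonneg hδ fun i hi =>
    hf i (Finset.mem_sdiff.1 hi).2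

theorem eventually_forall_notMem_le {I : Type*} {r : I → ℝ} (h : Tendsto r cofinite (𝓝 0))
    {ε : ℝ} (hε : 0 < ε) : ∀ᶠ S : Finset I in atTop, ∀ i ∉ S, r i ≤ ε := by
  have h1 := h.eventually (gt_mem_nhds hε)
  rw [eventually_cofinite] at h1
  filter_upwards [eventually_ge_atTop h1.toFinset] with S hS i hi
  by_contra hlt
  exact hi (hS (h1.mem_toFinset.2 fun h => hlt h.le))

theorem norm_truncDet_sub_le {I : Type*} (M N : Matrix I I L) (r : I → ℝ) {ε C : ℝ} (hε : 0 ≤ ε)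
    (hM : ∀ i j, ‖M i j‖ ≤ r i) (hN : ∀ i j, ‖N i j‖ ≤ r i) (h : ∀ i j, ‖M i j - N i j‖ ≤ ε)
    (S : Finset I) (hC : ∏ i ∈ S, max 1 (r i) ≤ C) :
    ‖truncDet M S - truncDet N S‖ ≤ ε * C := by
  classical
  refine (norm_det_one_add_sub_le _ _ (fun i : S => r i) hε (fun i j => hM i j)
    (fun i j => hN i j) fun i j => h i j).trans (mul_le_mul_of_nonneg_left ?_ hε)
  rwa [Finset.prod_coe_sort S fun i => max 1 (r i)]

/-- Multiplicativity of the Fredholm determinant: `det (1 + M) * det (1 + N)` is the determinant of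
`(1 + M) * (1 + N)`. -/
theorem fredDet_mul {I : Type*} {M N P : Matrix I I L} (hM : RowNull M) (hN : RowNull N)
    (hP : ∀ i j, HasSum (fun k => M i k * N k j) (P i j)) :
    fredDet M * fredDet N = fredDet (M + N + P) := by
  classical
  obtain ⟨CN, hCN0, hCN⟩ := hN.bounded
  obtain ⟨CM, hCM0, hCM⟩ := hM.bounded
  have hPn : RowNull P := hM.of_hasSum_left hCN0 hCN hP
  have hlim := (tendsto_truncDet hM).mul (tendsto_truncDet hN)
  have hlim' := tendsto_truncDet ((hM.add hN).add hPn)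
  obtain ⟨rM, hM0, hM1, hM2⟩ := hM
  obtain ⟨rN, hN0, hN1, hN2⟩ := hN
  let r : I → ℝ := fun i => max (max (rM i) (rN i)) (rM i * CN)
  have hr : Tendsto r cofinite (𝓝 0) := by
    simpa using (hM2.max hN2).max (hM2.mul_const CN)
  obtain ⟨C, hC, hS⟩ := exists_prod_max_one_le hr
  have hC0 : 0 < C := zero_lt_one.trans_le hC
  have hMN : ∀ i k j, ‖M i k * N k j‖ ≤ rM i * CN := fun i k j => by
    rw [norm_mul]
    exact mul_le_mul (hM1 i k) (hCN k j) (norm_nonneg _) (hM0 i)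
  have hadd : ∀ (x : L) (i j : I), ‖x‖ ≤ rM i * CN → ‖M i j + N i j + x‖ ≤ r i :=
    fun x i j hx => (IsUltrametricDist.norm_add_le_max _ _).trans
      (max_le_max ((IsUltrametricDist.norm_add_le_max _ _).trans
        (max_le_max (hM1 i j) (hN1 i j))) hx)
  have hdiff : Tendsto (fun S => truncDet M S * truncDet N S - truncDet (M + N + P) S) atTop
      (𝓝 0) := by
    rw [Metric.tendsto_nhds]
    intro ε hε
    let δ : ℝ := ε / (2 * C * (CM + 1))
    have hδ : 0 < δ := by positivity
    filter_upwards [eventually_forall_notMem_le hN2 hδ] with S hSδ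
    rw [dist_zero_right]
    have h1 : truncDet M S * truncDet N S = (1 + ((Matrix.of fun i j : S => M i j) +
        (Matrix.of fun i j : S => N i j) + (Matrix.of fun i j : S => M i j) *
        (Matrix.of fun i j : S => N i j))).det := by
      unfold truncDet
      have : ∀ X Y : Matrix S S L, (1 + X).det * (1 + Y).det = (1 + (X + Y + X * Y)).det := by
        intro X Y
        rw [← Matrix.det_mul]
        congr 1
        noncomm_ring
      exact this _ _
    have h3 : ∀ i j : S, ((Matrix.of fun i j : S => M i j) * (Matrix.of fun i j : S => N i j)) i j
        = ∑ k ∈ S, M i k * N k j := by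
      intro i j
      rw [Matrix.mul_apply]
      exact Finset.sum_coe_sort S fun k => M i k * N k j
    have h2 := norm_det_one_add_sub_le ((Matrix.of fun i j : S => M i j) +
        (Matrix.of fun i j : S => N i j) + (Matrix.of fun i j : S => M i j) *
        (Matrix.of fun i j : S => N i j)) (Matrix.of fun i j : S => (M + N + P) i j)
        (fun i : S => r i) (ε := CM * δ) (mul_nonneg hCM0 hδ.le) (fun i j => by
          rw [Matrix.add_apply, h3]
          exact hadd _ i j (IsUltrametricDist.norm_sum_le_of_forall_le_of_nonneg
            (mul_nonneg (hM0 i) hCN0) fun k _ => hMN i k j)) (fun i j =>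
          hadd _ i j (norm_le_of_hasSum (hP i j) (mul_nonneg (hM0 i) hCN0) fun k => hMN i k j))
        (fun i j => by
          rw [Matrix.add_apply, h3, norm_sub_rev]
          have : (Matrix.of fun i j : S => (M + N + P) i j) i j - (((Matrix.of fun i j : S => M i j)
              + (Matrix.of fun i j : S => N i j)) i j + ∑ k ∈ S, M i k * N k j) =
              P i j - ∑ k ∈ S, M i k * N k j := add_sub_add_left_eq_sub _ _ _
          rw [this]
          refine norm_sub_sum_le_of_hasSum (hP i j) S (mul_nonneg hCM0 hδ.le) fun k hk => ?_
          rw [norm_mul]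
          exact mul_le_mul (hCM i k) ((hN1 k j).trans (hSδ k hk)) (norm_nonneg _) hCM0)
    rw [Finset.prod_coe_sort S fun i => max 1 (r i)] at h2
    rw [h1]
    unfold truncDet
    have h4 : CM * δ * C < ε := by
      have : δ * (2 * C * (CM + 1)) = ε := div_mul_cancel₀ _ (by positivity)
      have h5 : 0 ≤ CM * δ * C := by positivity
      have h6 : 0 < δ * C := by positivity
      nlinarith
    refine lt_of_le_of_lt ?_ ((mul_le_mul_of_nonneg_left (hS S) (mul_nonneg hCM0 hδ.le)).trans_lt h4)
    exact h2
  have := hlim.sub hlim'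
  exact sub_eq_zero.1 (tendsto_nhds_unique this hdiff)

theorem norm_fredDet_sub_le {I : Type*} {M N : Matrix I I L} {r : I → ℝ} {ε C : ℝ} (hε : 0 ≤ ε)
    (hr : Tendsto r cofinite (𝓝 0))
    (hM : ∀ i j, ‖M i j‖ ≤ r i) (hN : ∀ i j, ‖N i j‖ ≤ r i) (h : ∀ i j, ‖M i j - N i j‖ ≤ ε)
    (hC : ∀ S : Finset I, ∏ i ∈ S, max 1 (r i) ≤ C) :
    ‖fredDet M - fredDet N‖ ≤ ε * C := by
  have h0 : ∀ i, 0 ≤ r i := fun i => (norm_nonneg _).trans (hM i i)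
  refine le_of_tendsto ((tendsto_truncDet ⟨r, h0, hM, hr⟩).sub
    (tendsto_truncDet ⟨r, h0, hN, hr⟩)).norm (Eventually.of_forall fun S => ?_)
  exact norm_truncDet_sub_le M N r hε hM hN h S (hC S)

/-- `det (1 + A * B) = det (1 + B * A)`. -/
theorem fredDet_comm {I J : Type*} {A : Matrix J I L} {B : Matrix I J L} {P : Matrix J J L}
    {Q : Matrix I I L} (hA : RowNull A) {CB : ℝ} (hB : ∀ i k, ‖B i k‖ ≤ CB)
    (hB' : ∀ k, Tendsto (fun i => B i k) cofinite (𝓝 0))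
    (hP : ∀ k l, HasSum (fun i => A k i * B i l) (P k l))
    (hQ : ∀ i j, HasSum (fun k => B i k * A k j) (Q i j)) : fredDet P = fredDet Q := by
  classical
  rcases isEmpty_or_nonempty J with hJ | hJ
  · have h1 : Q = 0 := by
      ext i j
      refine (hQ i j).unique ?_
      rw [Subsingleton.elim (fun k => _) (fun _ => (0 : L))]
      exact hasSum_zero
    have h2 : P = 0 := by
      ext i
      exact isEmptyElim i
    rw [h1, h2, fredDet_zero, fredDet_zero]
  rcases isEmpty_or_nonempty I with hI | hI
  · have h1 : P = 0 := by
      ext i j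
      refine (hP i j).unique ?_
      rw [Subsingleton.elim (fun k => _) (fun _ => (0 : L))]
      exact hasSum_zero
    have h2 : Q = 0 := by
      ext i
      exact isEmptyElim i
    rw [h1, h2, fredDet_zero, fredDet_zero]
  obtain ⟨k₀⟩ := id hJ
  obtain ⟨i₀⟩ := id hI
  have hCB : 0 ≤ CB := (norm_nonneg _).trans (hB i₀ k₀)
  have hPn : RowNull P := hA.of_hasSum_left hCB hB hP
  obtain ⟨CA, hCA0, hCA⟩ := hA.bounded
  obtain ⟨r, h0, h1, h2⟩ := hA
  -- row bounds for the products `B * A`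
  let q : I → ℝ := fun i => ⨆ k, ‖B i k‖ * r k
  have hrb : ∃ D, ∀ k, r k ≤ D := by
    obtain ⟨D, hD, hDS⟩ := exists_prod_max_one_le h2
    exact ⟨D, fun k => (le_max_right 1 (r k)).trans (by simpa using hDS {k})⟩
  obtain ⟨D, hD⟩ := hrb
  have hbdd : ∀ i, BddAbove (Set.range fun k => ‖B i k‖ * r k) := fun i =>
    ⟨CB * D, by
      rintro _ ⟨k, rfl⟩
      exact mul_le_mul (hB i k) (hD k) (h0 k) hCB⟩
  have hq : ∀ i k j, ‖B i k * A k j‖ ≤ q i := fun i k j => by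
    rw [norm_mul]
    refine le_trans ?_ (le_ciSup (hbdd i) k)
    exact mul_le_mul_of_nonneg_left (h1 k j) (norm_nonneg _)
  have hq0 : ∀ i, 0 ≤ q i := fun i => (norm_nonneg _).trans (hq i k₀ i₀)
  have hqlim : Tendsto q cofinite (𝓝 0) := by
    rw [Metric.tendsto_nhds]
    intro ε hε
    have hF := (by simpa using h2.const_mul CB : Tendsto (fun k => CB * r k) cofinite (𝓝 0)).eventually
      (gt_mem_nhds (half_pos hε))
    rw [eventually_cofinite] at hF
    have h3 : ∀ k ∈ hF.toFinset, ∀ᶠ i in cofinite, ‖B i k‖ * r k < ε / 2 := fun k _ => by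
      have := ((hB' k).norm.mul_const (r k))
      rw [norm_zero, zero_mul] at this
      exact this.eventually (gt_mem_nhds (half_pos hε))
    filter_upwards [(Finset.eventually_all hF.toFinset).2 h3] with i hi
    rw [Real.dist_0_eq_abs, abs_of_nonneg (hq0 i)]
    refine lt_of_le_of_lt (ciSup_le fun k => ?_) (half_lt_self hε)
    by_cases hk : k ∈ hF.toFinset
    · exact (hi k hk).le
    · have : CB * r k < ε / 2 := by simpa using hk
      exact (mul_le_mul_of_nonneg_right (hB i k) (h0 k)).trans this.le
  obtain ⟨C, hC, hCS⟩ := exists_prod_max_one_le hqlim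
  have hC0 : 0 < C := zero_lt_one.trans_le hC
  let QT : Finset J → Matrix I I L := fun T => Matrix.of fun i j => ∑ k ∈ T, B i k * A k j
  have hQT : ∀ T i j, ‖QT T i j‖ ≤ q i := fun T i j =>
    IsUltrametricDist.norm_sum_le_of_forall_le_of_nonneg (hq0 i) fun k _ => hq i k j
  have hQb : ∀ i j, ‖Q i j‖ ≤ q i := fun i j => norm_le_of_hasSum (hQ i j) (hq0 i) fun k => hq i k j
  have hstep : ∀ T, truncDet P T = fredDet (QT T) := by
    intro T
    refine tendsto_nhds_unique ?_ (tendsto_truncDet ⟨q, hq0, hQT T, hqlim⟩)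
    have h3 : ∀ S, truncDet (QT T) S = (1 + Matrix.of fun k l : T => ∑ i ∈ S, A k i * B i l).det := by
      intro S
      have h4 : (Matrix.of fun i j : S => QT T i j) =
          (Matrix.of fun (i : S) (k : T) => B i k) * (Matrix.of fun (k : T) (i : S) => A k i) := by
        ext i j
        rw [Matrix.mul_apply]
        exact (Finset.sum_coe_sort T fun k => B i k * A k j).symm
      have h5 : (Matrix.of fun k l : T => ∑ i ∈ S, A k i * B i l) =
          (Matrix.of fun (k : T) (i : S) => A k i) * (Matrix.of fun (i : S) (k : T) => B i k) := by
        ext k l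
        rw [Matrix.mul_apply]
        exact (Finset.sum_coe_sort S fun i => A k i * B i l).symm
      rw [truncDet, h4, h5, Matrix.det_one_add_mul_comm]
    refine Tendsto.congr (fun S => (h3 S).symm) ?_
    have hcont : Continuous fun X : Matrix T T L => (1 + X).det :=
      (continuous_const.add continuous_id).matrix_det
    have h6 : Tendsto (fun S : Finset I => (Matrix.of fun k l : T => ∑ i ∈ S, A k i * B i l))
        atTop (𝓝 (Matrix.of fun k l : T => P k l)) := by
      refine tendsto_pi_nhds.2 fun k => tendsto_pi_nhds.2 fun l => ?_
      exact hP k l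
    have := (hcont.tendsto _).comp h6
    exact this
  have hlim : Tendsto (fun T => fredDet (QT T)) atTop (𝓝 (fredDet Q)) := by
    rw [Metric.tendsto_nhds]
    intro ε hε
    let δ : ℝ := ε / (2 * C * (CB + 1))
    have hδ : 0 < δ := by positivity
    filter_upwards [eventually_forall_notMem_le h2 hδ] with T hT
    rw [dist_comm, dist_eq_norm]
    have h4 : CB * δ * C < ε := by
      have : δ * (2 * C * (CB + 1)) = ε := div_mul_cancel₀ _ (by positivity)
      have h5 : 0 ≤ CB * δ * C := by positivity
      have h6 : 0 < δ * C := by positivity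
      nlinarith
    refine lt_of_le_of_lt (norm_fredDet_sub_le (mul_nonneg hCB hδ.le) hqlim hQb (hQT T)
      (fun i j => ?_) hCS) h4
    refine norm_sub_sum_le_of_hasSum (hQ i j) T (mul_nonneg hCB hδ.le) fun k hk => ?_
    rw [norm_mul]
    exact mul_le_mul (hB i k) ((h1 k j).trans (hT k hk)) (norm_nonneg _) hCB
  exact tendsto_nhds_unique (tendsto_truncDet hPn) (hlim.congr fun T => (hstep T).symm)

end InfiniteDeterminants

section EntireSeries

variable {K : Type*} [NontriviallyNormedField K]
variable {L : Type*} [NormedField L] [NormedAlgebra K L]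

/-- A power series that converges on all of `K`. -/
def IsEntire (p : PowerSeries K) : Prop :=
  ∀ t : K, Summable fun n => PowerSeries.coeff n p * t ^ n

/-- The value of an entire power series at a point of an extension of `K`. -/
noncomputable def evalSeries (p : PowerSeries K) (a : L) : L :=
  ∑' n, algebraMap K L (PowerSeries.coeff n p) * a ^ n

theorem IsEntire.summable_norm {p : PowerSeries K} (hp : IsEntire p) (r : ℝ) (hr : 0 ≤ r) :
    Summable fun n => ‖PowerSeries.coeff n p‖ * r ^ n := by
  obtain ⟨t, ht⟩ := NormedField.exists_lt_norm K r
  have ht0 : 0 < ‖t‖ := hr.trans_lt ht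
  have h1 : Tendsto (fun n => ‖PowerSeries.coeff n p * t ^ n‖) atTop (𝓝 0) := by
    simpa using (hp t).tendsto_atTop_zero.norm
  obtain ⟨C, hC⟩ := h1.bddAbove_range
  have hC' : ∀ n, ‖PowerSeries.coeff n p‖ * ‖t‖ ^ n ≤ C := fun n => by
    have := hC ⟨n, rfl⟩
    simpa using this
  have hgeo : Summable fun n => C * (r / ‖t‖) ^ n :=
    (summable_geometric_of_lt_one (by positivity) ((div_lt_one ht0).2 ht)).mul_left C
  refine hgeo.of_nonneg_of_le (fun n => by positivity) fun n => ?_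
  have : ‖PowerSeries.coeff n p‖ * r ^ n =
      ‖PowerSeries.coeff n p‖ * ‖t‖ ^ n * (r / ‖t‖) ^ n := by
    rw [mul_assoc, ← mul_pow, mul_div_cancel₀ _ ht0.ne']
  rw [this]
  exact mul_le_mul_of_nonneg_right (hC' n) (by positivity)

theorem IsEntire.summable_norm_eval {p : PowerSeries K} (hp : IsEntire p) (a : L) :
    Summable fun n => ‖algebraMap K L (PowerSeries.coeff n p) * a ^ n‖ := by
  refine (hp.summable_norm ‖a‖ (norm_nonneg _)).congr fun n => ?_
  rw [norm_mul, norm_pow, norm_algebraMap']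

theorem IsEntire.mul [CompleteSpace K] {p q : PowerSeries K} (hp : IsEntire p) (hq : IsEntire q) :
    IsEntire (p * q) := by
  intro t
  have h1 := hp.summable_norm_eval t
  have h2 := hq.summable_norm_eval t
  refine (summable_norm_sum_mul_antidiagonal_of_summable_norm h1 h2).of_norm.congr fun n => ?_
  rw [PowerSeries.coeff_mul, Finset.sum_mul]
  refine Finset.sum_congr rfl fun ij hij => ?_
  rw [← (Finset.HasAntidiagonal.mem_antidiagonal.1 hij : ij.1 + ij.2 = n), pow_add]
  simp only [Algebra.algebraMap_self, RingHom.id_apply]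
  ring

theorem evalSeries_mul [CompleteSpace L] {p q : PowerSeries K} (hp : IsEntire p) (hq : IsEntire q)
    (a : L) : evalSeries (p * q) a = evalSeries p a * evalSeries q a := by
  unfold evalSeries
  rw [tsum_mul_tsum_eq_tsum_sum_antidiagonal_of_summable_norm (hp.summable_norm_eval a)
    (hq.summable_norm_eval a)]
  refine tsum_congr fun n => ?_
  rw [PowerSeries.coeff_mul, map_sum, Finset.sum_mul]
  refine Finset.sum_congr rfl fun ij hij => ?_
  rw [← (Finset.HasAntidiagonal.mem_antidiagonal.1 hij : ij.1 + ij.2 = n), pow_add, map_mul]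
  ring

theorem hasSum_evalSeries_coe (p : Polynomial K) (a : L) :
    HasSum (fun n => algebraMap K L (PowerSeries.coeff n (p : PowerSeries K)) * a ^ n)
      (Polynomial.aeval a p) := by
  rw [Polynomial.aeval_eq_sum_range]
  simp only [Polynomial.coeff_coe, Algebra.smul_def]
  refine hasSum_sum_of_ne_finset_zero fun n hn => ?_
  rw [Polynomial.coeff_eq_zero_of_natDegree_lt (by simpa using hn), map_zero, zero_mul]

theorem evalSeries_coe (p : Polynomial K) (a : L) :
    evalSeries (p : PowerSeries K) a = Polynomial.aeval a p :=
  (hasSum_evalSeries_coe p a).tsum_eq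

theorem isEntire_coe (p : Polynomial K) : IsEntire (p : PowerSeries K) := fun t =>
  (hasSum_evalSeries_coe p t).summable

variable [CompleteSpace K]

theorem IsEntire.hasFPowerSeriesOnBall {p : PowerSeries K} (hp : IsEntire p) :
    HasFPowerSeriesOnBall (fun t : K => evalSeries p t)
      (FormalMultilinearSeries.ofScalars K fun n => PowerSeries.coeff n p) 0 ⊤ := by
  have hr : (FormalMultilinearSeries.ofScalars K fun n => PowerSeries.coeff n p).radius = ⊤ := by
    refine FormalMultilinearSeries.radius_eq_top_of_summable_norm _ fun r => ?_
    simpa only [FormalMultilinearSeries.ofScalars_norm] using hp.summable_norm r r.2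
  have := FormalMultilinearSeries.hasFPowerSeriesOnBall
    (FormalMultilinearSeries.ofScalars K fun n => PowerSeries.coeff n p) (by rw [hr]; simp)
  rw [hr] at this
  convert this using 1
  ext t
  exact (FormalMultilinearSeries.ofScalars_sum_eq (fun n => PowerSeries.coeff n p) t).symm

theorem IsEntire.ext {p q : PowerSeries K} (hp : IsEntire p) (hq : IsEntire q)
    (h : ∀ t : K, evalSeries p t = evalSeries q t) : p = q := by
  have h1 := hp.hasFPowerSeriesOnBall.hasFPowerSeriesAt
  rw [funext h] at h1
  have h2 := h1.eq_formalMultilinearSeries hq.hasFPowerSeriesOnBall.hasFPowerSeriesAt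
  ext n
  exact congrFun (FormalMultilinearSeries.ofScalars_series_injective K K h2) n

/-- An entire function with value `1` at `0` vanishes to a finite order at `1`. -/
theorem IsEntire.exists_order_le {p : PowerSeries K} (hp : IsEntire p)
    (h0 : evalSeries p (0 : K) = 1) :
    ∃ N : ℕ, ∀ (w : ℕ) (g : PowerSeries K), IsEntire g →
      (∀ t : K, evalSeries p t = (1 - t) ^ w * evalSeries g t) → w ≤ N := by
  have hpf := hp.hasFPowerSeriesOnBall
  have hp1 := hpf.changeOrigin (y := 1) (by simp)
  rw [zero_add, ENNReal.top_sub_coe] at hp1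
  have hne : analyticOrderAt (fun t : K => evalSeries p t) 1 ≠ ⊤ := by
    rw [Ne, analyticOrderAt_eq_top]
    intro hz
    have h1 := hp1.hasFPowerSeriesAt.locally_zero_iff.1 hz
    rw [h1] at hp1
    have h2 := hp1.hasSum (y := -1) (by simp)
    simp only [add_neg_cancel, h0] at h2
    have h3 : (1 : K) = 0 := h2.unique hasSum_zero
    exact one_ne_zero h3
  obtain ⟨N, hN⟩ := ENat.ne_top_iff_exists.1 hne
  refine ⟨N, fun w g hg h => ?_⟩
  have hgf := (hg.hasFPowerSeriesOnBall.changeOrigin (y := 1) (by simp))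
  rw [zero_add, ENNReal.top_sub_coe] at hgf
  have : (w : ℕ∞) ≤ analyticOrderAt (fun t : K => evalSeries p t) 1 := by
    rw [natCast_le_analyticOrderAt hp1.analyticAt]
    refine ⟨fun t => (-1) ^ w * evalSeries g t, analyticAt_const.mul hgf.analyticAt,
      Eventually.of_forall fun t => ?_⟩
    rw [h t, smul_eq_mul, ← mul_assoc, ← mul_pow]
    congr 2
    ring
  rw [← hN] at this
  exact_mod_cast this

end EntireSeries

section MatrixSeries

variable {K : Type*} [NontriviallyNormedField K] [IsUltrametricDist K]
variable {L : Type*} [NormedField L] [NormedAlgebra K L] [IsUltrametricDist L]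

/-- The power series `det (1 - T M)`. -/
noncomputable def matCharSeries {I : Type*} (M : Matrix I I K) : PowerSeries K :=
  PowerSeries.mk fun n => (-1) ^ n * ∑' s : {s : Finset I // s.card = n}, minor M s.1

theorem minor_smul {I : Type*} (a : L) (M : Matrix I I L) (s : Finset I) :
    minor (a • M) s = a ^ s.card * minor M s := by
  classical
  unfold minor
  have : (Matrix.of fun i j : s => (a • M) i j) = a • Matrix.of fun i j : s => M i j := rfl
  rw [this, Matrix.det_smul, Fintype.card_coe]

theorem minor_map {I : Type*} (M : Matrix I I K) (s : Finset I) :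
    minor (M.map (algebraMap K L)) s = algebraMap K L (minor M s) := by
  classical
  unfold minor
  rw [RingHom.map_det]
  rfl

theorem RowNull.map {I J : Type*} {M : Matrix I J K} (h : RowNull M) :
    RowNull (M.map (algebraMap K L)) := by
  obtain ⟨r, h0, h1, h2⟩ := h
  exact ⟨r, h0, fun i j => by rw [Matrix.map_apply, norm_algebraMap']; exact h1 i j, h2⟩

variable [CompleteSpace L] [CompleteSpace K]

theorem hasSum_matCharSeries {I : Type*} {M : Matrix I I K} (h : RowNull M) (a : L) :
    HasSum (fun n => algebraMap K L (PowerSeries.coeff n (matCharSeries M)) * a ^ n)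
      (fredDet ((-a) • M.map (algebraMap K L))) := by
  have h1 := hasSum_minor ((h.map (L := L)).smul (-a))
  rw [← (Equiv.sigmaFiberEquiv (Finset.card : Finset I → ℕ)).hasSum_iff] at h1
  refine h1.sigma fun n => ?_
  have hs : HasSum (fun s : {s : Finset I // s.card = n} => minor M s.1)
      (∑' s : {s : Finset I // s.card = n}, minor M s.1) :=
    ((hasSum_minor h).summable.subtype _).hasSum
  have h2 := (hs.map (algebraMap K L) (algebraMapCLM K L).continuous).mul_left ((-a) ^ n)
  have h3 : algebraMap K L (PowerSeries.coeff n (matCharSeries M)) * a ^ n = (-a) ^ n *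
      algebraMap K L (∑' s : {s : Finset I // s.card = n}, minor M s.1) := by
    rw [matCharSeries, PowerSeries.coeff_mk, map_mul, neg_pow a]
    simp only [map_pow, map_neg, map_one]
    ring
  rw [h3]
  refine Eq.mp (congrArg (HasSum · _) (funext fun s => ?_)) h2
  change _ = minor _ s.1
  rw [minor_smul, minor_map, s.2]
  rfl

theorem isEntire_matCharSeries {I : Type*} {M : Matrix I I K} (h : RowNull M) :
    IsEntire (matCharSeries M) := fun t => by
  simpa using (hasSum_matCharSeries (L := K) h t).summable

theorem evalSeries_matCharSeries {I : Type*} {M : Matrix I I K} (h : RowNull M) (a : L) :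
    evalSeries (matCharSeries M) a = fredDet ((-a) • M.map (algebraMap K L)) :=
  (hasSum_matCharSeries h a).tsum_eq

end MatrixSeries

theorem _root_.HasSum.of_eq {α β : Type*} [AddCommMonoid α] [TopologicalSpace α] {f g : β → α}
    {a b : α} (h : HasSum f a) (hf : ∀ k, g k = f k) (ha : b = a) : HasSum g b := by
  rw [ha, funext hf]
  exact h

section Compact

variable {K : Type*} [NontriviallyNormedField K]
variable {V W X : Type*} [NormedAddCommGroup V] [NormedSpace K V] [NormedAddCommGroup W]
  [NormedSpace K W] [NormedAddCommGroup X] [NormedSpace K X]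

theorem isCompletelyContinuous_iff {f : V →L[K] W} : IsCompletelyContinuous f ↔
    ∀ ε > 0, ∃ g : V →L[K] W,
      FiniteDimensional K (LinearMap.range (g : V →ₗ[K] W)) ∧ ‖f - g‖ < ε := by
  unfold IsCompletelyContinuous
  rw [Metric.mem_closure_iff]
  simp only [dist_eq_norm]
  exact Iff.rfl

theorem finiteDimensional_range_add {f g : V →ₗ[K] W}
    (hf : FiniteDimensional K (LinearMap.range f)) (hg : FiniteDimensional K (LinearMap.range g)) :
    FiniteDimensional K (LinearMap.range (f + g)) := by
  refine Submodule.finiteDimensional_of_le (S₂ := LinearMap.range f ⊔ LinearMap.range g) ?_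
  rintro _ ⟨v, rfl⟩
  exact Submodule.add_mem_sup ⟨v, rfl⟩ ⟨v, rfl⟩

theorem IsCompletelyContinuous.of_finiteDimensional_range {f : V →L[K] W}
    (hf : FiniteDimensional K (LinearMap.range (f : V →ₗ[K] W))) : IsCompletelyContinuous f :=
  subset_closure hf

theorem IsCompletelyContinuous.add {f g : V →L[K] W} (hf : IsCompletelyContinuous f)
    (hg : IsCompletelyContinuous g) : IsCompletelyContinuous (f + g) := by
  rw [isCompletelyContinuous_iff] at *
  intro ε hε
  obtain ⟨f', hf', hf1⟩ := hf (ε / 2) (half_pos hε)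
  obtain ⟨g', hg', hg1⟩ := hg (ε / 2) (half_pos hε)
  refine ⟨f' + g', finiteDimensional_range_add hf' hg', ?_⟩
  calc ‖f + g - (f' + g')‖ = ‖(f - f') + (g - g')‖ := by congr 1; abel
    _ ≤ ‖f - f'‖ + ‖g - g'‖ := norm_add_le _ _
    _ < ε := by linarith

theorem IsCompletelyContinuous.comp_left {f : V →L[K] W} (hf : IsCompletelyContinuous f)
    (g : W →L[K] X) : IsCompletelyContinuous (g.comp f) := by
  have hc : Continuous fun f : V →L[K] W => g.comp f :=
    (ContinuousLinearMap.compL K V W X g).continuous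
  refine map_mem_closure hc hf fun f' hf' => ?_
  have : LinearMap.range ((g.comp f' : V →L[K] X) : V →ₗ[K] X) =
      (LinearMap.range (f' : V →ₗ[K] W)).map (g : W →ₗ[K] X) := by
    rw [← LinearMap.range_comp]; rfl
  simp only [Set.mem_ofPred_eq] at hf' ⊢
  rw [this]
  infer_instance

theorem IsCompletelyContinuous.comp_right {f : W →L[K] X} (hf : IsCompletelyContinuous f)
    (g : V →L[K] W) : IsCompletelyContinuous (f.comp g) := by
  have hc : Continuous fun f : W →L[K] X => f.comp g :=
    ((ContinuousLinearMap.compL K V W X).flip g).continuous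
  refine map_mem_closure (f := fun f : W →L[K] X => f.comp g) hc hf fun f' hf' => ?_
  simp only [Set.mem_ofPred_eq] at hf' ⊢
  refine Submodule.finiteDimensional_of_le (S₂ := LinearMap.range (f' : W →ₗ[K] X)) ?_
  rintro _ ⟨v, rfl⟩
  exact ⟨g v, rfl⟩

theorem IsCompletelyContinuous.smul {f : V →L[K] W} (hf : IsCompletelyContinuous f) (c : K) :
    IsCompletelyContinuous (c • f) := by
  have := hf.comp_left (c • ContinuousLinearMap.id K W)
  have h : (c • ContinuousLinearMap.id K W).comp f = c • f := by ext; simp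
  rwa [h] at this

/-- A continuous operator of finite rank is a finite sum of operators of rank one. -/
theorem exists_eq_sum_smul [CompleteSpace K] (f : V →L[K] W)
    (hf : FiniteDimensional K (LinearMap.range (f : V →ₗ[K] W))) :
    ∃ (n : ℕ) (φ : Fin n → V →L[K] K) (w : Fin n → W), ∀ v, f v = ∑ k, φ k v • w k := by
  let R := LinearMap.range (f : V →ₗ[K] W)
  let B := Module.finBasis K R
  let f' : V →L[K] R := f.codRestrict R fun v => ⟨v, rfl⟩
  refine ⟨Module.finrank K R, fun k => (LinearMap.toContinuousLinearMap (B.coord k)).comp f',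
    fun k => (B k : W), fun v => ?_⟩
  have := congrArg Subtype.val (B.sum_repr (f' v))
  rw [AddSubmonoidClass.coe_finsetSum] at this
  exact this.symm

end Compact

namespace ONBasis

variable {K : Type*} [NontriviallyNormedField K]
variable {V W X : Type*} [NormedAddCommGroup V] [NormedSpace K V] [NormedAddCommGroup W]
  [NormedSpace K W] [NormedAddCommGroup X] [NormedSpace K X]
  {I J J' : Type*} (b : ONBasis K V I) (b' : ONBasis K W J) (b'' : ONBasis K X J')

theorem norm_coord_le (i : I) (v : V) : ‖b.coord i v‖ ≤ ‖v‖ := by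
  classical
  rw [b.norm_eq v]
  have h := (b.tendsto_coord v).norm
  rw [norm_zero] at h
  refine le_ciSup (f := fun i => ‖b.coord i v‖) ?_ i
  have hF : {i | ¬ ‖b.coord i v‖ < 1}.Finite := by
    have := h.eventually (gt_mem_nhds one_pos)
    rwa [eventually_cofinite] at this
  obtain ⟨C, hC⟩ := (hF.image fun i => ‖b.coord i v‖).bddAbove
  refine ⟨max 1 C, ?_⟩
  rintro _ ⟨i, rfl⟩
  by_cases hi : ‖b.coord i v‖ < 1
  · exact le_max_of_le_left hi.le
  · exact le_max_of_le_right (hC ⟨i, hi, rfl⟩)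

/-- The coordinate functionals are continuous. -/
noncomputable def coordL (i : I) : V →L[K] K :=
  (b.coord i).mkContinuous 1 fun v => by simpa using b.norm_coord_le i v

@[simp] theorem coordL_apply (i : I) (v : V) : b.coordL i v = b.coord i v := rfl

theorem norm_vec_le (j : I) : ‖b.vec j‖ ≤ 1 := by
  rw [b.norm_eq]
  refine Real.iSup_le (fun i => ?_) zero_le_one
  by_cases h : i = j
  · rw [h, b.coord_vec_self, norm_one]
  · rw [b.coord_vec_ne i j h, norm_zero]
    exact zero_le_one

theorem separatingDual (b : ONBasis K V I) : SeparatingDual K V := by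
  refine ⟨fun v hv => ?_⟩
  by_contra! h
  apply hv
  have h1 := b.hasSum v
  have h2 : (fun i => b.coord i v • b.vec i) = fun _ => 0 := by
    ext i
    rw [← b.coordL_apply, h, zero_smul]
  rw [h2] at h1
  exact h1.unique hasSum_zero

/-- The matrix of a continuous operator. -/
noncomputable def matrix (U : V →L[K] W) : Matrix J I K := fun i j => b'.coord i (U (b.vec j))

theorem norm_matrix_le (U : V →L[K] W) (i : J) (j : I) : ‖b.matrix b' U i j‖ ≤ ‖U‖ :=
  (b'.norm_coord_le i _).trans ((U.le_opNorm _).trans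
    (mul_le_of_le_one_right (norm_nonneg _) (b.norm_vec_le j)))

theorem tendsto_matrix (U : V →L[K] W) (j : I) :
    Tendsto (fun i => b.matrix b' U i j) cofinite (𝓝 0) := b'.tendsto_coord _

theorem hasSum_apply (φ : V →L[K] W) (v : V) : HasSum (fun k => b.coord k v • φ (b.vec k)) (φ v) := by
  simpa using φ.hasSum (b.hasSum v)

theorem hasSum_matrix_comp (A : W →L[K] X) (B : V →L[K] W) (i : J') (j : I) :
    HasSum (fun k => b'.matrix b'' A i k * b.matrix b' B k j) (b.matrix b'' (A.comp B) i j) := by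
  have := b'.hasSum_apply ((b''.coordL i).comp A) (B (b.vec j))
  exact this.of_eq (fun k => mul_comm _ _) rfl

theorem charSeries_eq (U : V →L[K] V) : charSeries b U = matCharSeries (b.matrix b U) := rfl

variable [IsUltrametricDist K] [CompleteSpace K]

theorem rowNull_matrix {U : V →L[K] W} (hU : IsCompletelyContinuous U) :
    RowNull (b.matrix b' U) := by
  have hbdd : ∀ i, BddAbove (Set.range fun j => ‖b.matrix b' U i j‖) := fun i =>
    ⟨‖U‖, by rintro _ ⟨j, rfl⟩; exact b.norm_matrix_le b' U i j⟩
  refine ⟨fun i => ⨆ j, ‖b.matrix b' U i j‖, fun i => Real.iSup_nonneg fun j => norm_nonneg _,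
    fun i j => le_ciSup (hbdd i) j, ?_⟩
  rw [Metric.tendsto_nhds]
  intro ε hε
  obtain ⟨g, hg, hgU⟩ := isCompletelyContinuous_iff.1 hU (ε / 2) (half_pos hε)
  obtain ⟨n, φ, w, hφ⟩ := exists_eq_sum_smul g hg
  have h1 : ∀ k, ∀ᶠ i in cofinite, ‖φ k‖ * ‖b'.coord i (w k)‖ < ε / 2 := fun k => by
    have := ((b'.tendsto_coord (w k)).norm.const_mul ‖φ k‖)
    rw [norm_zero, mul_zero] at this
    exact this.eventually (gt_mem_nhds (half_pos hε))
  filter_upwards [eventually_all.2 h1] with i hi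
  rw [Real.dist_0_eq_abs, abs_of_nonneg (Real.iSup_nonneg fun j => norm_nonneg _)]
  refine lt_of_le_of_lt (Real.iSup_le (fun j => ?_) (half_pos hε).le) (half_lt_self hε)
  have h2 : b.matrix b' U i j = b'.coord i ((U - g) (b.vec j)) + b'.coord i (g (b.vec j)) := by
    rw [← map_add]
    simp [matrix]
  rw [h2]
  refine (IsUltrametricDist.norm_add_le_max _ _).trans (max_le ?_ ?_)
  · exact (b.norm_matrix_le b' (U - g) i j).trans hgU.le
  · rw [hφ, map_sum]
    refine IsUltrametricDist.norm_sum_le_of_forall_le_of_nonneg (half_pos hε).le fun k _ => ?_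
    rw [map_smul, smul_eq_mul, norm_mul]
    refine le_trans (mul_le_mul_of_nonneg_right ?_ (norm_nonneg _)) (hi k).le
    exact ((φ k).le_opNorm _).trans (mul_le_of_le_one_right (norm_nonneg _) (b.norm_vec_le j))

theorem isEntire_charSeries {U : V →L[K] V} (hU : IsCompletelyContinuous U) :
    IsEntire (charSeries b U) := by
  rw [charSeries_eq]
  exact isEntire_matCharSeries (b.rowNull_matrix b hU)

theorem evalSeries_charSeries {L : Type*} [NormedField L] [NormedAlgebra K L]
    [IsUltrametricDist L] [CompleteSpace L] {U : V →L[K] V} (hU : IsCompletelyContinuous U)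
    (a : L) : evalSeries (charSeries b U) a =
      fredDet ((-a) • (b.matrix b U).map (algebraMap K L)) := by
  rw [charSeries_eq]
  exact evalSeries_matCharSeries (b.rowNull_matrix b hU) a

theorem evalSeries_charSeries_self {U : V →L[K] V} (hU : IsCompletelyContinuous U) (t : K) :
    evalSeries (charSeries b U) t = fredDet ((-t) • b.matrix b U) := by
  rw [b.evalSeries_charSeries hU t]
  congr 1

theorem charSeries_mul {A B : V →L[K] V} (hA : IsCompletelyContinuous A)
    (hB : IsCompletelyContinuous B) (h : B.comp A = 0) :
    charSeries b (A + B) = charSeries b B * charSeries b A := by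
  refine (b.isEntire_charSeries (hA.add hB)).ext
    ((b.isEntire_charSeries hB).mul (b.isEntire_charSeries hA)) fun t => ?_
  rw [evalSeries_mul (b.isEntire_charSeries hB) (b.isEntire_charSeries hA),
    b.evalSeries_charSeries_self hA, b.evalSeries_charSeries_self hB,
    b.evalSeries_charSeries_self (hA.add hB),
    fredDet_mul (P := 0) ((b.rowNull_matrix b hB).smul (-t)) ((b.rowNull_matrix b hA).smul (-t))]
  · congr 1
    ext i j
    simp only [matrix, Matrix.smul_apply, Matrix.add_apply, Matrix.zero_apply, smul_eq_mul,
      _root_.add_apply, map_add]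
    ring
  · intro i j
    have h1 := (b.hasSum_matrix_comp b b B A i j).mul_left ((-t) * (-t))
    rw [h] at h1
    refine h1.of_eq (fun k => ?_) (by simp [matrix])
    simp only [Matrix.smul_apply, smul_eq_mul]
    ring

/-- `det (1 - T A B) = det (1 - T B A)`. -/
theorem charSeries_comm {A : V →L[K] W} (hA : IsCompletelyContinuous A) (B : W →L[K] V) :
    charSeries b' (A.comp B) = charSeries b (B.comp A) := by
  refine (b'.isEntire_charSeries (hA.comp_right B)).ext
    (b.isEntire_charSeries (hA.comp_left B)) fun t => ?_
  rw [b'.evalSeries_charSeries_self (hA.comp_right B),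
    b.evalSeries_charSeries_self (hA.comp_left B)]
  refine fredDet_comm (A := (-t) • b.matrix b' A) (B := b'.matrix b B)
    ((b.rowNull_matrix b' hA).smul (-t)) (b'.norm_matrix_le b B) (b'.tendsto_matrix b B)
    (fun k l => ?_) fun i j => ?_
  · refine ((b'.hasSum_matrix_comp b b' A B k l).mul_left (-t)).of_eq (fun k => ?_) rfl
    simp only [Matrix.smul_apply, smul_eq_mul]
    ring
  · refine ((b.hasSum_matrix_comp b' b B A i j).mul_left (-t)).of_eq (fun k => ?_) rfl
    simp only [Matrix.smul_apply, smul_eq_mul]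
    ring

theorem fredDet_of_fintype {n : Type*} [Fintype n] [DecidableEq n] (M : Matrix n n K) :
    fredDet M = (1 + M).det := by
  have hM : RowNull M := by
    refine ⟨fun i => ⨆ j, ‖M i j‖, fun i => Real.iSup_nonneg fun j => norm_nonneg _,
      fun i j => le_ciSup (f := fun j => ‖M i j‖) (Set.finite_range _).bddAbove j, ?_⟩
    rw [cofinite_eq_bot]
    exact tendsto_bot
  refine tendsto_nhds_unique (tendsto_truncDet hM) (tendsto_const_nhds.congr' ?_)
  filter_upwards [eventually_ge_atTop Finset.univ] with S hS
  have hS' : ∀ i, i ∈ S := fun i => hS (Finset.mem_univ i)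
  let e : S ≃ n := Equiv.subtypeUnivEquiv hS'
  rw [← Matrix.det_submatrix_equiv_self e, truncDet]
  congr 1
  ext i j
  simp [Matrix.one_apply, e]

/-- The characteristic series of an operator of finite rank. -/
theorem charSeries_of_eq_sum {n : Type*} [Fintype n] [DecidableEq n] (f : V →L[K] V)
    (φ : n → V →L[K] K) (w : n → V) (hf : ∀ v, f v = ∑ k, φ k v • w k) :
    charSeries b f = ((Matrix.of fun k l => φ k (w l)).charpolyRev : PowerSeries K) := by
  have : FiniteDimensional K (Submodule.span K (Set.range w)) :=
    FiniteDimensional.span_of_finite K (Set.finite_range w)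
  have hfc : IsCompletelyContinuous f := by
    refine .of_finiteDimensional_range
      (Submodule.finiteDimensional_of_le (S₂ := Submodule.span K (Set.range w)) ?_)
    rintro _ ⟨v, rfl⟩
    change f v ∈ _
    rw [hf]
    exact Submodule.sum_mem _ fun k _ => Submodule.smul_mem _ _ (Submodule.subset_span ⟨k, rfl⟩)
  refine (b.isEntire_charSeries hfc).ext (isEntire_coe _) fun t => ?_
  rw [b.evalSeries_charSeries_self hfc, evalSeries_coe]
  have h1 : fredDet ((-t) • Matrix.of fun k l => φ k (w l)) = fredDet ((-t) • b.matrix b f) := by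
    refine fredDet_comm (A := (-t) • Matrix.of fun k j => φ k (b.vec j))
      (B := Matrix.of fun i k => b.coord i (w k)) (CB := ∑ k, ‖w k‖) ?_ (fun i k => ?_)
      (fun k => b.tendsto_coord _) (fun k l => ?_) fun i j => ?_
    · refine RowNull.smul ⟨fun k => ‖φ k‖, fun k => norm_nonneg _, fun k j => ?_, ?_⟩ _
      · exact ((φ k).le_opNorm _).trans (mul_le_of_le_one_right (norm_nonneg _) (b.norm_vec_le j))
      · rw [cofinite_eq_bot]
        exact tendsto_bot
    · exact (b.norm_coord_le i _).trans
        (Finset.single_le_sum (f := fun k => ‖w k‖) (fun k _ => norm_nonneg _) (Finset.mem_univ k))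
    · refine ((b.hasSum_apply (φ k) (w l)).mul_left (-t)).of_eq (fun i => ?_) rfl
      simp only [Matrix.smul_apply, Matrix.of_apply, smul_eq_mul]
      ring
    · refine (hasSum_fintype _).of_eq (fun _ => rfl) ?_
      simp only [Matrix.smul_apply, Matrix.of_apply, smul_eq_mul, matrix, hf, map_sum, map_smul,
        Finset.mul_sum]
      refine Finset.sum_congr rfl fun k _ => ?_
      ring
  rw [← h1, fredDet_of_fintype, Matrix.charpolyRev, Polynomial.coe_aeval_eq_eval,
    ← Polynomial.coe_evalRingHom, RingHom.map_det]
  congr 1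
  ext k l
  by_cases h : k = l
  · simp [h, mul_comm t]; ring
  · simp [h, mul_comm t]

end ONBasis

theorem exists_sub_mul_eq_aeval_sub {K R : Type*} [Field K] [Ring R] [Algebra K R] {x y : R}
    (h : Commute x y) (Q : Polynomial K) :
    ∃ z, (x - y) * z = Polynomial.aeval x Q - Polynomial.aeval y Q := by
  induction Q using Polynomial.induction_on' with
  | add p q hp hq =>
    obtain ⟨z, hz⟩ := hp
    obtain ⟨z', hz'⟩ := hq
    refine ⟨z + z', ?_⟩
    rw [mul_add, hz, hz', map_add, map_add]
    abel
  | monomial n a =>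
    refine ⟨a • ∑ i ∈ Finset.range n, x ^ i * y ^ (n - 1 - i), ?_⟩
    rw [mul_smul_comm, h.mul_geom_sum₂, Polynomial.aeval_monomial, Polynomial.aeval_monomial,
      ← mul_sub, Algebra.smul_def]

theorem exists_quasi_inverse {R : Type*} [Ring R] {a u y z w m : R} (hay : a * y = 1)
    (hz : (u - y) * z * w = 1) (hm : m + a * u = 0) :
    ∃ G x, G = m * x ∧ m + G + m * G = 0 := by
  have hm' : m = -(a * u) := eq_neg_of_add_eq_zero_left hm
  let q := z * w * -y
  have h1 : (1 + m) * q = 1 := by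
    have e1 : 1 + m = -(a * (u - y)) := by rw [mul_sub, hay, hm']; abel
    have e2 : -(a * (u - y)) * q = a * ((u - y) * z * w) * y := by
      simp only [q, neg_mul, mul_neg, neg_neg, mul_assoc]
    rw [e1, e2, hz, mul_one, hay]
  refine ⟨q - 1, -q, ?_, ?_⟩
  · rw [mul_neg, eq_neg_iff_add_eq_zero, ← h1]
    noncomm_ring
  · have : m + (q - 1) + m * (q - 1) = (1 + m) * q - 1 := by noncomm_ring
    rw [this, h1, sub_self]

namespace ONBasis

section Splitting

variable {K : Type*} [NontriviallyNormedField K] [IsUltrametricDist K] [CompleteSpace K]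
variable {V : Type*} [NormedAddCommGroup V] [NormedSpace K V] {I : Type*} (b : ONBasis K V I)

theorem exists_projector (b : ONBasis K V I) (W : Submodule K V) [FiniteDimensional K W] :
    ∃ p : V →L[K] V, (∀ v, p v ∈ W) ∧ ∀ w ∈ W, p w = w := by
  have := b.separatingDual
  let B := Module.finBasis K W
  have hs := (SeparatingDual.dualMap_surjective_iff (R := K) (f := W.subtype)).2
    W.injective_subtype
  choose φ hφ using fun k => hs (B.coord k)
  have hφ' : ∀ k (w : W), φ k w = B.repr w k := fun k w => LinearMap.congr_fun (hφ k) w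
  refine ⟨∑ k, (φ k).smulRight (B k : V), fun v => ?_, fun w hw => ?_⟩
  · simp only [_root_.sum_apply, ContinuousLinearMap.smulRight_apply]
    exact W.sum_mem fun k _ => W.smul_mem _ (B k).2
  · simp only [_root_.sum_apply, ContinuousLinearMap.smulRight_apply]
    have h1 := congrArg Subtype.val (B.sum_repr ⟨w, hw⟩)
    rw [AddSubmonoidClass.coe_finsetSum] at h1
    refine Eq.trans (Finset.sum_congr rfl fun k _ => ?_) h1
    rw [show φ k w = _ from hφ' k ⟨w, hw⟩]
    rfl

/-- The characteristic series splits off the characteristic polynomial of a stable subspace of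
finite dimension. -/
theorem charSeries_eq_charpoly_mul {U : V →L[K] V} (hU : IsCompletelyContinuous U)
    (W : Submodule K V) [FiniteDimensional K W] (hW : ∀ w ∈ W, (U : V →ₗ[K] V) w ∈ W)
    {p : V →L[K] V} (hp : ∀ v, p v ∈ W) (hp' : ∀ w ∈ W, p w = w) :
    charSeries b U = (((U : V →ₗ[K] V).restrict hW).charpoly.reverse : PowerSeries K) *
      charSeries b (U.comp (1 - p)) := by
  have h1 : U = U.comp p + U.comp (1 - p) := by
    ext v
    simp
  have h2 : (U.comp (1 - p)).comp (U.comp p) = 0 := by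
    ext v
    have := hp' _ (hW _ (hp v))
    simp only [ContinuousLinearMap.coe_coe] at this
    simp [this]
  conv_lhs => rw [h1]
  rw [b.charSeries_mul (hU.comp_right p) (hU.comp_right _) h2, mul_comm]
  congr 1
  let B := Module.finBasis K W
  let f : V →L[K] W := (U.comp p).codRestrict W fun v => hW _ (hp v)
  rw [b.charSeries_of_eq_sum (U.comp p)
    (fun k => (LinearMap.toContinuousLinearMap (B.coord k)).comp f) (fun k => (B k : V)),
    ← Matrix.reverse_charpoly, ← LinearMap.charpoly_toMatrix _ B]
  · congr 3
    ext k l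
    simp only [Matrix.of_apply, LinearMap.toMatrix_apply]
    change B.repr (f (B l)) k = _
    congr 2
    refine Subtype.ext ?_
    change U (p (B l)) = U (B l)
    rw [hp' _ (B l).2]
  · intro v
    have h3 := congrArg Subtype.val (B.sum_repr (f v))
    rw [AddSubmonoidClass.coe_finsetSum] at h3
    exact h3.symm

variable {L : Type*} [NormedField L] [NormedAlgebra K L] [IsUltrametricDist L] [CompleteSpace L]

variable (L) in
/-- The matrix over `L` of an operator in `L ⊗ (V →L[K] V)`. -/
noncomputable def extMatrix : L ⊗[K] (V →L[K] V) →ₗ[K] Matrix I I L :=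
  TensorProduct.lift (LinearMap.mk₂ K (fun (l : L) (A : V →L[K] V) =>
    l • (b.matrix b A).map (algebraMap K L))
    (fun l l' A => add_smul _ _ _) (fun c l A => smul_assoc _ _ _)
    (fun l A A' => by
      ext i j
      simp [matrix, mul_add])
    (fun c l A => by
      ext i j
      simp only [matrix, Matrix.smul_apply, Matrix.map_apply, _root_.smul_apply,
        map_smul, smul_eq_mul, map_mul]
      rw [Algebra.smul_def]
      ring))

theorem extMatrix_tmul (l : L) (A : V →L[K] V) (i j : I) :
    b.extMatrix L (l ⊗ₜ A) i j = l * algebraMap K L (b.matrix b A i j) := rfl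

theorem hasSum_extMatrix_mul (x y : L ⊗[K] (V →L[K] V)) (i j : I) :
    HasSum (fun k => b.extMatrix L x i k * b.extMatrix L y k j) (b.extMatrix L (x * y) i j) := by
  induction x using TensorProduct.induction_on with
  | zero =>
    rw [zero_mul]
    exact hasSum_zero.of_eq (fun k => by simp) (by simp)
  | add x x' hx hx' =>
    refine (hx.add hx').of_eq (fun k => ?_) ?_
    · rw [map_add, Matrix.add_apply, add_mul]
    · rw [add_mul, map_add, Matrix.add_apply]
  | tmul l A =>
    induction y using TensorProduct.induction_on with
    | zero =>
      rw [mul_zero]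
      exact hasSum_zero.of_eq (fun k => by simp) (by simp)
    | add x x' hx hx' =>
      refine (hx.add hx').of_eq (fun k => ?_) ?_
      · rw [map_add, Matrix.add_apply, mul_add]
      · rw [mul_add, map_add, Matrix.add_apply]
    | tmul m B =>
      have := ((b.hasSum_matrix_comp b b A B i j).map (algebraMap K L)
        (algebraMapCLM K L).continuous).mul_left (l * m)
      refine this.of_eq (fun k => ?_) ?_
      · rw [extMatrix_tmul, extMatrix_tmul, Function.comp, map_mul]
        ring
      · rw [Algebra.TensorProduct.tmul_mul_tmul, extMatrix_tmul]
        rfl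

theorem exists_norm_extMatrix_le (x : L ⊗[K] (V →L[K] V)) :
    ∃ C, 0 ≤ C ∧ ∀ i j, ‖b.extMatrix L x i j‖ ≤ C := by
  induction x using TensorProduct.induction_on with
  | zero => exact ⟨0, le_rfl, fun i j => by simp⟩
  | add x y hx hy =>
    obtain ⟨C, hC, hx⟩ := hx
    obtain ⟨D, hD, hy⟩ := hy
    refine ⟨C + D, add_nonneg hC hD, fun i j => ?_⟩
    rw [map_add, Matrix.add_apply]
    exact (norm_add_le _ _).trans (add_le_add (hx i j) (hy i j))
  | tmul l A =>
    refine ⟨‖l‖ * ‖A‖, by positivity, fun i j => ?_⟩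
    rw [extMatrix_tmul, norm_mul, norm_algebraMap']
    exact mul_le_mul_of_nonneg_left (b.norm_matrix_le b A i j) (norm_nonneg _)

/-- If `Q(U)` is invertible, the characteristic series of `U` does not vanish at the inverses of the
roots of `Q`. -/
theorem evalSeries_charSeries_ne_zero {U : V →L[K] V} (hU : IsCompletelyContinuous U)
    {Q : Polynomial K} (hQ : IsUnit (Polynomial.aeval U Q)) {β : L} (hβ0 : β ≠ 0)
    (hβ : Polynomial.aeval β Q = 0) : evalSeries (charSeries b U) β⁻¹ ≠ 0 := by
  let u : L ⊗[K] (V →L[K] V) := 1 ⊗ₜ U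
  let y : L ⊗[K] (V →L[K] V) := β ⊗ₜ 1
  let a : L ⊗[K] (V →L[K] V) := β⁻¹ ⊗ₜ 1
  have hay : a * y = 1 := by
    simp only [a, y, Algebra.TensorProduct.tmul_mul_tmul, inv_mul_cancel₀ hβ0, mul_one,
      Algebra.TensorProduct.one_def]
  have hcomm : Commute u y := by
    simp [u, y, Commute, SemiconjBy, Algebra.TensorProduct.tmul_mul_tmul]
  have h1 : Polynomial.aeval y Q = 0 := by
    have : y = (Algebra.TensorProduct.includeLeft : L →ₐ[K] L ⊗[K] (V →L[K] V)) β := rfl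
    rw [this, Polynomial.aeval_algHom_apply, hβ, map_zero]
  have h2 : IsUnit (Polynomial.aeval u Q) := by
    have : u = (Algebra.TensorProduct.includeRight : (V →L[K] V) →ₐ[K] L ⊗[K] (V →L[K] V)) U := rfl
    rw [this, Polynomial.aeval_algHom_apply]
    exact hQ.map _
  obtain ⟨z₀, hz₀⟩ := exists_sub_mul_eq_aeval_sub hcomm Q
  rw [h1, sub_zero] at hz₀
  obtain ⟨w, hw⟩ := h2.exists_right_inv
  have hm : (-β⁻¹) ⊗ₜ[K] U + a * u = 0 := by
    rw [show a * u = β⁻¹ ⊗ₜ[K] U by simp [a, u, Algebra.TensorProduct.tmul_mul_tmul],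
      ← TensorProduct.add_tmul, neg_add_cancel, TensorProduct.zero_tmul]
  obtain ⟨G, x, hG, h0⟩ := exists_quasi_inverse hay (z := z₀) (w := w) (by rw [hz₀, hw]) hm
  rw [b.evalSeries_charSeries hU]
  have hM : (-β⁻¹) • (b.matrix b U).map (algebraMap K L) = b.extMatrix L ((-β⁻¹) ⊗ₜ[K] U) := rfl
  have hMn : RowNull (b.extMatrix L ((-β⁻¹) ⊗ₜ[K] U)) := (b.rowNull_matrix b hU).map.smul _
  have hGn : RowNull (b.extMatrix L G) := by
    obtain ⟨C, hC, hCb⟩ := b.exists_norm_extMatrix_le x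
    rw [hG]
    exact hMn.of_hasSum_left hC hCb (b.hasSum_extMatrix_mul _ _)
  have := fredDet_mul hMn hGn (b.hasSum_extMatrix_mul _ _)
  rw [← map_add, ← map_add, h0, map_zero, fredDet_zero] at this
  rw [hM]
  exact left_ne_zero_of_mul_eq_one this

end Splitting

end ONBasis

theorem reverse_pow {K : Type*} [Field K] (p : Polynomial K) (n : ℕ) :
    (p ^ n).reverse = p.reverse ^ n := by
  induction n with
  | zero => simpa using Polynomial.reverse_C (1 : K)
  | succ n ih => rw [pow_succ, pow_succ, Polynomial.reverse_mul_of_domain, ih]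

theorem charpoly_eq_of_isNilpotent_sub_one {K N : Type*} [Field K] [AddCommGroup N] [Module K N]
    [FiniteDimensional K N] {f : Module.End K N} (hf : IsNilpotent (f - 1)) :
    f.charpoly = (Polynomial.X - 1) ^ Module.finrank K N := by
  have h1 := hf.charpoly_eq_X_pow_finrank
  have h2 := LinearMap.charpoly_sub_smul f 1
  rw [one_smul, h1, map_one] at h2
  have h3 := congrArg (Polynomial.comp · (Polynomial.X - 1)) h2
  simp only [Polynomial.comp_assoc, Polynomial.pow_comp, Polynomial.X_comp, Polynomial.add_comp,
    Polynomial.one_comp, sub_add_cancel, Polynomial.comp_X] at h3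
  exact h3.symm

/-- If `Q(f)` is nilpotent for an irreducible `Q`, the characteristic polynomial of `f` is a power
of `Q`. -/
theorem exists_charpoly_eq_pow {K N : Type*} [Field K] [AddCommGroup N] [Module K N]
    [FiniteDimensional K N] {f : Module.End K N} {Q : Polynomial K} (hQm : Q.Monic)
    (hQ : Irreducible Q) (hf : IsNilpotent (Polynomial.aeval f Q)) :
    ∃ m : ℕ, f.charpoly = Q ^ m ∧ m * Q.natDegree = Module.finrank K N := by
  obtain ⟨k, hk⟩ := hf
  have hfin : FiniteMultiplicity Q f.charpoly :=
    FiniteMultiplicity.of_not_isUnit hQ.not_isUnit f.charpoly_monic.ne_zero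
  obtain ⟨g, hg, hQg⟩ := hfin.exists_eq_pow_mul_and_not_dvd
  set m := multiplicity Q f.charpoly
  have hgm : g.Monic := (hQm.pow m).of_mul_monic_left (hg ▸ f.charpoly_monic)
  have hg1 : g = 1 := by
    by_contra hne
    have hgu : ¬ IsUnit g := fun h => hne (hgm.eq_one_of_isUnit h)
    obtain ⟨P, hP, hPg⟩ := WfDvdMonoid.exists_irreducible_factor hgu hgm.ne_zero
    have := Fact.mk hP
    let E := AdjoinRoot P
    let γ : E := AdjoinRoot.root P
    have hroot : (f.baseChange E).charpoly.IsRoot γ := by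
      rw [LinearMap.charpoly_baseChange, Polynomial.IsRoot.def, Polynomial.eval_map,
        ← Polynomial.aeval_def, hg, map_mul]
      obtain ⟨c, hc⟩ := hPg
      have h0 : Polynomial.aeval γ P = 0 := by
        rw [AdjoinRoot.aeval_eq, AdjoinRoot.mk_self]
      rw [hc, map_mul, h0, zero_mul, mul_zero]
    rw [← Module.End.hasEigenvalue_iff_isRoot_charpoly] at hroot
    obtain ⟨v, hv⟩ := hroot.exists_hasEigenvector
    have h1 : Polynomial.aeval (f.baseChange E) ((Q.map (algebraMap K E)) ^ k) = 0 := by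
      rw [map_pow, Polynomial.aeval_map_algebraMap]
      have : (f.baseChange E) = Module.End.baseChangeHom K E N f := rfl
      rw [this, Polynomial.aeval_algHom_apply, ← map_pow, hk, map_zero]
    have h2 := Module.End.aeval_apply_of_hasEigenvector (p := (Q.map (algebraMap K E)) ^ k) hv
    rw [h1, LinearMap.zero_apply] at h2
    have h3 := (smul_eq_zero.1 h2.symm).resolve_right hv.2
    rw [Polynomial.eval_pow, Polynomial.eval_map, ← Polynomial.aeval_def] at h3
    have h4 : Polynomial.aeval γ Q = 0 := eq_zero_of_pow_eq_zero h3
    rw [AdjoinRoot.aeval_eq, AdjoinRoot.mk_eq_zero] at h4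
    have h5 : Associated P Q := hP.associated_of_dvd hQ h4
    exact hQg (h5.symm.dvd.trans hPg)
  rw [hg1, mul_one] at hg
  refine ⟨m, hg, ?_⟩
  rw [← LinearMap.charpoly_natDegree f, hg, hQm.natDegree_pow]

section Riesz

variable {K : Type*} [NontriviallyNormedField K]
variable {V : Type*} [NormedAddCommGroup V] [NormedSpace K V]

theorem finiteDimensional_range_mul {C : V →L[K] V} (E : V →L[K] V)
    (hC : FiniteDimensional K (LinearMap.range (C : V →ₗ[K] V))) :
    FiniteDimensional K (LinearMap.range ((E * C : V →L[K] V) : V →ₗ[K] V)) := by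
  have : LinearMap.range ((E * C : V →L[K] V) : V →ₗ[K] V) =
      (LinearMap.range (C : V →ₗ[K] V)).map (E : V →ₗ[K] V) := by
    rw [← LinearMap.range_comp]; rfl
  rw [this]
  infer_instance

/-- A compact perturbation of the identity is the product of an invertible operator and of a
perturbation of the identity of finite rank. -/
theorem IsCompletelyContinuous.exists_factorization [CompleteSpace V] {C : V →L[K] V}
    (hC : IsCompletelyContinuous C) : ∃ (E : (V →L[K] V)ˣ) (G : V →L[K] V),
      FiniteDimensional K (LinearMap.range (G : V →ₗ[K] V)) ∧ 1 - C = E * (1 - G) := by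
  obtain ⟨C₀, hC₀, hn⟩ := isCompletelyContinuous_iff.1 hC 1 one_pos
  obtain ⟨E, hE⟩ := isUnit_one_sub_of_norm_lt_one hn
  refine ⟨E, (↑E⁻¹ : V →L[K] V) * C₀, finiteDimensional_range_mul _ hC₀, ?_⟩
  rw [mul_sub, mul_one, ← mul_assoc, Units.mul_inv, one_mul, hE]
  abel

theorem IsCompletelyContinuous.finiteDimensional_ker [CompleteSpace V] {C : V →L[K] V}
    (hC : IsCompletelyContinuous C) :
    FiniteDimensional K (LinearMap.ker ((1 - C : V →L[K] V) : V →ₗ[K] V)) := by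
  obtain ⟨E, G, hG, h⟩ := hC.exists_factorization
  refine Submodule.finiteDimensional_of_le (S₂ := LinearMap.range (G : V →ₗ[K] V)) fun x hx => ?_
  have h1 : (1 - C) x = 0 := hx
  rw [h] at h1
  have h2 : (↑E⁻¹ * (↑E * (1 - G)) : V →L[K] V) x = 0 := by
    rw [mul_apply_eq_comp, h1, map_zero]
  rw [← mul_assoc, Units.inv_mul, one_mul] at h2
  refine ⟨x, ?_⟩
  have h3 : x - G x = 0 := h2
  exact (sub_eq_zero.1 h3).symm

/-- The Fredholm alternative. -/
theorem IsCompletelyContinuous.isUnit_of_injective [CompleteSpace V] {C : V →L[K] V}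
    (hC : IsCompletelyContinuous C) (hinj : Function.Injective (1 - C : V →L[K] V)) : IsUnit (1 - C) := by
  obtain ⟨E, G, hG, h⟩ := hC.exists_factorization
  rw [h] at hinj ⊢
  refine E.isUnit.mul ?_
  have hinj' : Function.Injective (1 - G : V →L[K] V) := fun x y hxy => hinj (by
    rw [mul_apply_eq_comp, mul_apply_eq_comp, hxy])
  rw [ContinuousLinearMap.isUnit_iff_bijective]
  refine ⟨hinj', fun v => ?_⟩
  let R := LinearMap.range (G : V →ₗ[K] V)
  have hR : ∀ r ∈ R, ((1 - G : V →L[K] V) : V →ₗ[K] V) r ∈ R := fun r hr =>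
    R.sub_mem hr ⟨r, rfl⟩
  have hs : Function.Surjective (((1 - G : V →L[K] V) : V →ₗ[K] V).restrict hR) := by
    rw [← LinearMap.injective_iff_surjective]
    intro x y hxy
    exact Subtype.ext (hinj' (congrArg Subtype.val hxy))
  obtain ⟨r, hr⟩ := hs ⟨G v, v, rfl⟩
  have hr' : (r : V) - G r = G v := congrArg Subtype.val hr
  refine ⟨v + r, ?_⟩
  change v + r - G (v + r) = v
  rw [map_add, add_sub_add_comm, hr', sub_add_cancel]

theorem exists_aeval_eq_smul_one_sub {U : V →L[K] V} (hU : IsCompletelyContinuous U)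
    {Q : Polynomial K} (hQ : Q.coeff 0 ≠ 0) : ∃ C : V →L[K] V, IsCompletelyContinuous C ∧
      Polynomial.aeval U Q = Q.coeff 0 • (1 - C) ∧ C = 1 - (Q.coeff 0)⁻¹ • Polynomial.aeval U Q := by
  refine ⟨1 - (Q.coeff 0)⁻¹ • Polynomial.aeval U Q, ?_, ?_, rfl⟩
  · have h1 := congrArg (Polynomial.aeval U) (Polynomial.divX_mul_X_add Q)
    rw [map_add, map_mul, Polynomial.aeval_X, Polynomial.aeval_C,
      Algebra.algebraMap_eq_smul_one] at h1
    have h2 : 1 - (Q.coeff 0)⁻¹ • Polynomial.aeval U Q =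
        (-(Q.coeff 0)⁻¹) • (Polynomial.aeval U Q.divX * U) := by
      rw [← h1, smul_add, smul_smul, inv_mul_cancel₀ hQ, one_smul, neg_smul]
      abel
    rw [h2]
    exact (hU.comp_left _).smul _
  · rw [sub_sub_cancel, smul_smul, mul_inv_cancel₀ hQ, one_smul]

theorem isUnit_aeval_of_injective [CompleteSpace V] {U : V →L[K] V}
    (hU : IsCompletelyContinuous U) {Q : Polynomial K} (hQ : Q.coeff 0 ≠ 0)
    (hinj : Function.Injective (Polynomial.aeval U Q)) : IsUnit (Polynomial.aeval U Q) := by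
  obtain ⟨C, hC, h, -⟩ := exists_aeval_eq_smul_one_sub hU hQ
  rw [h] at hinj ⊢
  have : IsUnit (1 - C) := hC.isUnit_of_injective fun x y hxy => hinj (by
    rw [_root_.smul_apply, _root_.smul_apply, hxy])
  exact this.smul (Units.mk0 _ hQ)

theorem aeval_forgetTopology (U : V →L[K] V) (Q : Polynomial K) :
    Polynomial.aeval (forgetTopology K V U) Q = forgetTopology K V (Polynomial.aeval U Q) :=
  Polynomial.aeval_algHom_apply _ _ _

theorem mem_genKer_of_aeval_mem {M : Type*} [AddCommGroup M] [Module K M] {u : Module.End K M}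
    {Q : Polynomial K} {m : M} (h : Polynomial.aeval u Q m ∈ genKer u Q) : m ∈ genKer u Q := by
  obtain ⟨n, hn⟩ := h
  exact ⟨n + 1, by rw [pow_succ, Module.End.mul_apply, hn]⟩

variable [IsUltrametricDist K] [CompleteSpace K] [CompleteSpace V] {I : Type*} (b : ONBasis K V I)

theorem finiteDimensional_ker_aeval_pow {U : V →L[K] V} (hU : IsCompletelyContinuous U)
    {Q : Polynomial K} (hQ : Q.coeff 0 ≠ 0) (n : ℕ) :
    FiniteDimensional K (LinearMap.ker (Polynomial.aeval (forgetTopology K V U) Q ^ n)) := by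
  have hQn : (Q ^ n).coeff 0 ≠ 0 := by
    rw [Polynomial.coeff_zero_eq_eval_zero, Polynomial.eval_pow,
      ← Polynomial.coeff_zero_eq_eval_zero]
    exact pow_ne_zero _ hQ
  obtain ⟨C, hC, h, -⟩ := exists_aeval_eq_smul_one_sub hU hQn
  have := hC.finiteDimensional_ker
  refine Submodule.finiteDimensional_of_le
    (S₂ := LinearMap.ker ((1 - C : V →L[K] V) : V →ₗ[K] V)) fun x hx => ?_
  rw [LinearMap.mem_ker, ← map_pow, aeval_forgetTopology, h] at hx
  exact (smul_eq_zero.1 (show (Q ^ n).coeff 0 • (1 - C) x = 0 from hx)).resolve_left hQn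

theorem exists_finrank_ker_le (b : ONBasis K V I) {U : V →L[K] V} (hU : IsCompletelyContinuous U)
    {Q : Polynomial K} (hQ : Q.coeff 0 ≠ 0) :
    ∃ N, ∀ n, Module.finrank K
      (LinearMap.ker (Polynomial.aeval (forgetTopology K V U) Q ^ n)) ≤ N := by
  obtain ⟨C, hC, h, hC'⟩ := exists_aeval_eq_smul_one_sub hU hQ
  have h0 : evalSeries (charSeries b C) (0 : K) = 1 := by
    rw [b.evalSeries_charSeries_self hC, neg_zero, zero_smul, fredDet_zero]
  obtain ⟨N, hN⟩ := (b.isEntire_charSeries hC).exists_order_le h0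
  refine ⟨N, fun n => ?_⟩
  let W := LinearMap.ker (Polynomial.aeval (forgetTopology K V U) Q ^ n)
  have hfd : FiniteDimensional K W := finiteDimensional_ker_aeval_pow hU hQ n
  have hA : ∀ w, forgetTopology K V C w =
      w - (Q.coeff 0)⁻¹ • Polynomial.aeval (forgetTopology K V U) Q w := by
    intro w
    rw [aeval_forgetTopology, hC']
    rfl
  have hAW : ∀ w ∈ W, Polynomial.aeval (forgetTopology K V U) Q w ∈ W := by
    intro w hw
    rw [LinearMap.mem_ker] at hw ⊢
    rw [← Module.End.mul_apply, ← pow_succ, pow_succ', Module.End.mul_apply, hw, map_zero]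
  have hW : ∀ w ∈ W, (C : V →ₗ[K] V) w ∈ W := by
    intro w hw
    change forgetTopology K V C w ∈ W
    rw [hA]
    exact W.sub_mem hw (W.smul_mem _ (hAW w hw))
  obtain ⟨p, hp, hp'⟩ := b.exists_projector W
  have h1 := b.charSeries_eq_charpoly_mul hC W hW hp hp'
  have h2 : IsNilpotent ((C : V →ₗ[K] V).restrict hW - 1) := by
    have e : (C : V →ₗ[K] V).restrict hW - 1 =
        (-(Q.coeff 0)⁻¹) • (Polynomial.aeval (forgetTopology K V U) Q).restrict hAW := by
      ext w
      change forgetTopology K V C w - w =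
        (-(Q.coeff 0)⁻¹) • Polynomial.aeval (forgetTopology K V U) Q w
      rw [hA, neg_smul]
      abel
    rw [e]
    refine ⟨n, ?_⟩
    rw [smul_pow]
    have : (Polynomial.aeval (forgetTopology K V U) Q).restrict hAW ^ n = 0 := by
      rw [Module.End.pow_restrict]
      ext w
      exact w.2
    rw [this, smul_zero]
  refine hN (Module.finrank K W) _ (b.isEntire_charSeries (hC.comp_right (1 - p))) fun t => ?_
  rw [h1, evalSeries_mul (isEntire_coe _) (b.isEntire_charSeries (hC.comp_right _)),
    evalSeries_coe, charpoly_eq_of_isNilpotent_sub_one h2, reverse_pow, map_pow]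
  congr 2
  have : (Polynomial.X - 1 : Polynomial K).reverse = 1 - Polynomial.X := by
    have hd : (Polynomial.X - 1 : Polynomial K).natDegree = 1 := by
      simpa using Polynomial.natDegree_X_sub_C (1 : K)
    ext (_ | _ | n)
    · simp [Polynomial.coeff_reverse, hd, Polynomial.coeff_one]
    · simp [Polynomial.coeff_reverse, hd, Polynomial.coeff_one]
    · rw [Polynomial.coeff_reverse, hd, Polynomial.revAt_eq_self_of_lt (by omega)]
      simp [Polynomial.coeff_one, Polynomial.coeff_X]
  rw [this]
  simp

theorem exists_genKer_eq_ker (b : ONBasis K V I) {U : V →L[K] V} (hU : IsCompletelyContinuous U)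
    {Q : Polynomial K} (hQ : Q.coeff 0 ≠ 0) : ∃ n, genKer (forgetTopology K V U) Q =
      LinearMap.ker (Polynomial.aeval (forgetTopology K V U) Q ^ n) := by
  let W := fun n => LinearMap.ker (Polynomial.aeval (forgetTopology K V U) Q ^ n)
  obtain ⟨N, hN⟩ := exists_finrank_ker_le b hU hQ
  have hfd : ∀ n, FiniteDimensional K (W n) := finiteDimensional_ker_aeval_pow hU hQ
  have hmono : Monotone W := by
    refine monotone_nat_of_le_succ fun n x hx => ?_
    rw [LinearMap.mem_ker] at hx ⊢
    rw [pow_succ', Module.End.mul_apply, hx, map_zero]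
  have hfin : (Set.range fun n => Module.finrank K (W n)).Finite :=
    (Set.finite_Iic N).subset (by rintro _ ⟨n, rfl⟩; exact hN n)
  obtain ⟨_, ⟨n, rfl⟩, hmax⟩ := hfin.exists_maximal (Set.range_nonempty _)
  refine ⟨n, le_antisymm ?_ fun x hx => ⟨n, hx⟩⟩
  rintro x ⟨k, hk⟩
  have h1 : W n ≤ W (max n k) := hmono (le_max_left _ _)
  have h2 : W n = W (max n k) := Submodule.eq_of_le_of_finrank_le h1
    (hmax ⟨max n k, rfl⟩ (Submodule.finrank_mono h1))
  change x ∈ W n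
  rw [h2]
  exact hmono (le_max_right n k) hk

theorem finiteDimensional_genKer (b : ONBasis K V I) {U : V →L[K] V}
    (hU : IsCompletelyContinuous U) {Q : Polynomial K} (hQ : Q.coeff 0 ≠ 0) :
    FiniteDimensional K (genKer (forgetTopology K V U) Q) := by
  obtain ⟨n, hn⟩ := exists_genKer_eq_ker b hU hQ
  rw [hn]
  exact finiteDimensional_ker_aeval_pow hU hQ n

end Riesz

theorem NonzeroPrime.coeff_zero_ne_zero {K : Type*} [Field K] (Q : NonzeroPrime K) :
    Q.1.coeff 0 ≠ 0 := by
  intro h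
  have h1 : Polynomial.X ∣ Q.1 := Polynomial.X_dvd_iff.2 h
  have h2 := Polynomial.irreducible_X.associated_of_dvd Q.2.2.1 h1
  exact Q.2.2.2 (Polynomial.eq_of_monic_of_associated Q.2.1 Polynomial.monic_X h2.symm)

universe u in
theorem exists_extension_root {K : Type u} [NontriviallyNormedField K] [IsUltrametricDist K]
    [CompleteSpace K] {Q : Polynomial K} (hQ : Irreducible Q) :
    ∃ (L : Type u) (_ : NormedField L) (_ : NormedAlgebra K L) (_ : IsUltrametricDist L)
      (_ : CompleteSpace L) (β : L), Polynomial.aeval β Q = 0 := by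
  have := Fact.mk hQ
  have hfd : FiniteDimensional K (AdjoinRoot Q) := (AdjoinRoot.powerBasis hQ.ne_zero).finite
  let _ := spectralNorm.normedField K (AdjoinRoot Q)
  refine ⟨AdjoinRoot Q, spectralNorm.normedField K (AdjoinRoot Q),
    spectralNorm.normedAlgebra K (AdjoinRoot Q), ?_,
    spectralNorm.completeSpace K (AdjoinRoot Q), AdjoinRoot.root Q, ?_⟩
  · exact IsUltrametricDist.isUltrametricDist_of_isNonarchimedean_norm
      (isNonarchimedean_spectralNorm (K := K) (L := AdjoinRoot Q))
  · have := AdjoinRoot.aeval_eq (f := Q) Q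
    rw [AdjoinRoot.mk_self] at this
    exact this

theorem coe_aeval_restrict_apply {K M : Type*} [Field K] [AddCommGroup M] [Module K M]
    {f : Module.End K M} {N : Submodule K M} (hf : ∀ x ∈ N, f x ∈ N) (R : Polynomial K) (w : N) :
    (Polynomial.aeval (f.restrict hf) R w : M) = Polynomial.aeval f R (w : M) := by
  induction R using Polynomial.induction_on' with
  | add p q hp hq => simp [hp, hq]
  | monomial n a =>
    rw [Polynomial.aeval_monomial, Polynomial.aeval_monomial, ← Algebra.smul_def,
      ← Algebra.smul_def, LinearMap.smul_apply, LinearMap.smul_apply, Submodule.coe_smul,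
      Module.End.pow_restrict n]
    rfl

section Projector

variable {K : Type*} [NontriviallyNormedField K]
variable {V : Type*} [NormedAddCommGroup V] [NormedSpace K V]

theorem aeval_comp_one_sub_apply {T p : V →L[K] V} {N : Submodule K V}
    (hp' : ∀ w ∈ N, p w = w) (Q : Polynomial K) {n : V} (hn : n ∈ N) :
    Polynomial.aeval (T.comp (1 - p)) Q n = Q.coeff 0 • n := by
  have h1 := congrArg (Polynomial.aeval (T.comp (1 - p))) (Polynomial.divX_mul_X_add Q)
  rw [map_add, map_mul, Polynomial.aeval_X, Polynomial.aeval_C,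
    Algebra.algebraMap_eq_smul_one] at h1
  have h2 : (T.comp (1 - p)) n = 0 := by
    change T (n - p n) = 0
    rw [hp' n hn, sub_self, map_zero]
  rw [← h1]
  change Polynomial.aeval (T.comp (1 - p)) Q.divX ((T.comp (1 - p)) n) + Q.coeff 0 • n = _
  rw [h2, map_zero, zero_add]

theorem aeval_comp_one_sub_sub_mem {T p : V →L[K] V} {N : Submodule K V}
    (hT : ∀ w ∈ N, T w ∈ N) (hp : ∀ v, p v ∈ N) (Q : Polynomial K) (v : V) :
    Polynomial.aeval (T.comp (1 - p)) Q v - Polynomial.aeval T Q v ∈ N := by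
  induction Q using Polynomial.induction_on' with
  | add f g hf hg =>
    rw [map_add, map_add, _root_.add_apply, _root_.add_apply, add_sub_add_comm]
    exact N.add_mem hf hg
  | monomial n a =>
    rw [Polynomial.aeval_monomial, Polynomial.aeval_monomial, ← Algebra.smul_def,
      ← Algebra.smul_def, _root_.smul_apply, _root_.smul_apply, ← smul_sub]
    refine N.smul_mem _ ?_
    induction n with
    | zero => simp
    | succ n ih =>
      rw [pow_succ', pow_succ']
      change T ((T.comp (1 - p) ^ n) v - p ((T.comp (1 - p) ^ n) v)) - T ((T ^ n) v) ∈ N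
      rw [← map_sub, sub_right_comm]
      rw [map_sub]
      exact N.sub_mem (hT _ ih) (hT _ (hp _))

variable [IsUltrametricDist K] [CompleteSpace K] [CompleteSpace V] {I : Type*}

theorem genKer_map_mem (U : V →L[K] V) (Q : Polynomial K) {T : V →L[K] V} (h : Commute T U) {w : V}
    (hw : w ∈ genKer (forgetTopology K V U) Q) : T w ∈ genKer (forgetTopology K V U) Q :=
  genKer_stable (forgetTopology K V U) (forgetTopology K V T) (h.map (forgetTopology K V)) Q w hw

/-- On the complement of the generalized eigenspace, `Q(U)` is invertible. -/
theorem isUnit_aeval_comp_one_sub {U : V →L[K] V} (hU : IsCompletelyContinuous U)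
    {Q : Polynomial K} (hQ : Q.coeff 0 ≠ 0) {p : V →L[K] V}
    (hp : ∀ v, p v ∈ genKer (forgetTopology K V U) Q)
    (hp' : ∀ w ∈ genKer (forgetTopology K V U) Q, p w = w) :
    IsUnit (Polynomial.aeval (U.comp (1 - p)) Q) := by
  refine isUnit_aeval_of_injective (hU.comp_right _) hQ ?_
  rw [injective_iff_map_eq_zero]
  intro x hx
  have h1 := aeval_comp_one_sub_sub_mem (T := U)
    (fun w hw => genKer_map_mem U Q (Commute.refl U) hw) hp Q x
  rw [hx, zero_sub, neg_mem_iff] at h1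
  have h2 : x ∈ genKer (forgetTopology K V U) Q := by
    refine mem_genKer_of_aeval_mem ?_
    rw [aeval_forgetTopology]
    exact h1
  rw [aeval_comp_one_sub_apply hp' Q h2] at hx
  exact (smul_eq_zero.1 hx).resolve_left hQ

theorem exists_charSeries_eq_reverse_pow_mul (b : ONBasis K V I) {U : V →L[K] V}
    (hU : IsCompletelyContinuous U) (Q : NonzeroPrime K) :
    ∃ (m : ℕ) (U' : V →L[K] V), IsCompletelyContinuous U' ∧ IsUnit (Polynomial.aeval U' Q.1) ∧
      charSeries b U = ((Q.1.reverse ^ m : Polynomial K) : PowerSeries K) * charSeries b U' ∧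
      m * Q.1.natDegree = Module.finrank K (genKer (forgetTopology K V U) Q.1) := by
  have hQ := Q.coeff_zero_ne_zero
  have hfd := finiteDimensional_genKer b hU hQ
  obtain ⟨p, hp, hp'⟩ := b.exists_projector (genKer (forgetTopology K V U) Q.1)
  have hW : ∀ w ∈ genKer (forgetTopology K V U) Q.1,
      (U : V →ₗ[K] V) w ∈ genKer (forgetTopology K V U) Q.1 :=
    fun w hw => genKer_map_mem U Q.1 (Commute.refl U) hw
  have hnil : IsNilpotent (Polynomial.aeval ((U : V →ₗ[K] V).restrict hW) Q.1) := by
    obtain ⟨n, hn⟩ := exists_genKer_eq_ker b hU hQ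
    refine ⟨n, ?_⟩
    ext w
    rw [← map_pow, coe_aeval_restrict_apply, map_pow]
    exact hn.le w.2
  obtain ⟨m, hm, hdeg⟩ := exists_charpoly_eq_pow Q.2.1 Q.2.2.1 hnil
  refine ⟨m, U.comp (1 - p), hU.comp_right _, isUnit_aeval_comp_one_sub hU hQ hp hp', ?_, hdeg⟩
  rw [b.charSeries_eq_charpoly_mul hU _ hW hp hp', hm, reverse_pow]

/-- The characteristic series determines the dimensions of the generalized eigenspaces. -/
theorem finrank_genKer_eq_of_charSeries_eq {V' : Type*} [NormedAddCommGroup V']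
    [NormedSpace K V'] [CompleteSpace V'] {I' : Type*} (b : ONBasis K V I) (b' : ONBasis K V' I')
    {U : V →L[K] V} {U' : V' →L[K] V'} (hU : IsCompletelyContinuous U)
    (hU' : IsCompletelyContinuous U') (h : charSeries b U = charSeries b' U')
    (Q : NonzeroPrime K) :
    Module.finrank K (genKer (forgetTopology K V U) Q.1) =
      Module.finrank K (genKer (forgetTopology K V' U') Q.1) := by
  obtain ⟨m, T, hT, hTu, hTc, hTd⟩ := exists_charSeries_eq_reverse_pow_mul b hU Q
  obtain ⟨m', T', hT', hTu', hTc', hTd'⟩ := exists_charSeries_eq_reverse_pow_mul b' hU' Q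
  obtain ⟨L, _, _, _, _, β, hβ⟩ := exists_extension_root Q.2.2.1
  have hβ0 : β ≠ 0 := by
    rintro rfl
    rw [← Polynomial.coeff_zero_eq_aeval_zero'] at hβ
    exact Q.coeff_zero_ne_zero ((map_eq_zero _).1 hβ)
  have hrev : Polynomial.aeval β⁻¹ Q.1.reverse = 0 := by
    let _ := invertibleOfNonzero hβ0
    rw [← invOf_eq_inv, Polynomial.aeval_def, Polynomial.eval₂_reverse_eq_zero_iff,
      ← Polynomial.aeval_def, hβ]
  have hr0 : ((Q.1.reverse : Polynomial K) : PowerSeries K) ≠ 0 := by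
    rw [Ne, Polynomial.coe_eq_zero_iff, Polynomial.reverse_eq_zero]
    exact Q.2.2.1.ne_zero
  have hne := b.evalSeries_charSeries_ne_zero hT hTu hβ0 hβ
  have hne' := b'.evalSeries_charSeries_ne_zero hT' hTu' hβ0 hβ
  have key : ∀ (f g : PowerSeries K) (m m' : ℕ), IsEntire g → evalSeries f β⁻¹ ≠ 0 →
      ((Q.1.reverse ^ m : Polynomial K) : PowerSeries K) * f =
        ((Q.1.reverse ^ m' : Polynomial K) : PowerSeries K) * g → m' ≤ m := by
    intro f g m m' hg hf hfg
    by_contra! hlt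
    obtain ⟨k, rfl⟩ := Nat.exists_eq_add_of_lt hlt
    rw [add_assoc, pow_add, Polynomial.coe_mul, mul_assoc] at hfg
    have h1 := mul_left_cancel₀ (by rw [Polynomial.coe_pow]; exact pow_ne_zero _ hr0) hfg
    apply hf
    rw [h1, evalSeries_mul (isEntire_coe _) hg, evalSeries_coe, map_pow, hrev,
      zero_pow (Nat.succ_ne_zero k), zero_mul]
  have hc := hTc.symm.trans (h.trans hTc')
  have := key _ _ _ _ (b'.isEntire_charSeries hT') hne hc
  have h' := key _ _ _ _ (b.isEntire_charSeries hT) hne' hc.symm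
  rw [← hTd, ← hTd', le_antisymm h' this]

/-- Under a small perturbation commuting with `U`, the generalized eigenspace can only shrink. -/
theorem eventually_genKer_le (b : ONBasis K V I) {U : V →L[K] V} (hU : IsCompletelyContinuous U)
    {Q : Polynomial K} (hQ : Q.coeff 0 ≠ 0) {T : K → V →L[K] V} (hT : ContinuousAt T 0)
    (hT0 : T 0 = U) (hTU : ∀ c, Commute (T c) U) :
    ∀ᶠ c in 𝓝 (0 : K), genKer (forgetTopology K V (T c)) Q ≤ genKer (forgetTopology K V U) Q := by
  have hfd := finiteDimensional_genKer b hU hQ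
  obtain ⟨p, hp, hp'⟩ := b.exists_projector (genKer (forgetTopology K V U) Q)
  have hu := isUnit_aeval_comp_one_sub hU hQ hp hp'
  have hcont : ContinuousAt (fun c => Polynomial.aeval ((T c).comp (1 - p)) Q) 0 := by
    have h1 : Continuous fun A : V →L[K] V => Polynomial.aeval (A.comp (1 - p)) Q :=
      Q.continuous_aeval.comp (continuous_id.mul continuous_const)
    exact h1.continuousAt.comp hT
  have hev := hcont.eventually (Units.isOpen.mem_nhds (by rw [← hT0] at hu; exact hu))
  filter_upwards [hev] with c hc
  have hinj : Function.Injective (Polynomial.aeval ((T c).comp (1 - p)) Q) :=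
    (ContinuousLinearMap.isUnit_iff_bijective.1 hc).1
  have hstep : ∀ y, Polynomial.aeval (T c) Q y ∈ genKer (forgetTopology K V U) Q →
      y ∈ genKer (forgetTopology K V U) Q := by
    intro y hy
    have h1 := aeval_comp_one_sub_sub_mem (T := T c) (p := p)
      (fun w hw => genKer_map_mem U Q (hTU c) hw) hp Q y
    have h2 := (Submodule.sub_mem_iff_left _ hy).1 h1
    have h3 : y = (Q.coeff 0)⁻¹ • Polynomial.aeval ((T c).comp (1 - p)) Q y := by
      apply hinj
      rw [map_smul, aeval_comp_one_sub_apply hp' Q h2, smul_smul, inv_mul_cancel₀ hQ, one_smul]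
    rw [h3]
    exact Submodule.smul_mem _ _ h2
  rintro x ⟨n, hn⟩
  rw [aeval_forgetTopology] at hn
  induction n generalizing x with
  | zero =>
    rw [pow_zero, Module.End.one_apply] at hn
    rw [hn]
    exact Submodule.zero_mem _
  | succ n ih =>
    refine hstep x (ih (x := Polynomial.aeval (T c) Q x) ?_)
    rw [pow_succ] at hn
    exact hn

end Projector

section Algebra

variable {K : Type*} [Field K] {H : Type*} [Ring H] [Algebra K H]

/-- Two non-isomorphic simple modules of finite dimension are separated by an element of the
algebra. -/
theorem exists_smul_eq_self_and_smul_eq_zero {S : Type*} [AddCommGroup S] [Module H S]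
    [IsSimpleModule H S] [Module K S] [IsScalarTower K H S] [FiniteDimensional K S]
    {X : Type*} [AddCommGroup X] [Module H X] [IsSimpleModule H X] [Module K X]
    [IsScalarTower K H X] [FiniteDimensional K X] (hSX : ¬ Nonempty (X ≃ₗ[H] S)) :
    ∃ a : H, (∀ s : S, a • s = s) ∧ ∀ x : X, a • x = 0 := by
  have h1 : ∀ g : S →ₗ[H] X, g = 0 := fun g =>
    (g.bijective_or_eq_zero).resolve_left fun hg =>
      hSX ⟨(LinearEquiv.ofBijective g hg).symm⟩
  have h2 : ∀ g : X →ₗ[H] S, g = 0 := fun g =>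
    (g.bijective_or_eq_zero).resolve_left fun hg => hSX ⟨LinearEquiv.ofBijective g hg⟩
  let f : Module.End (Module.End H (S × X)) (S × X) :=
    { toFun := fun v => (v.1, 0)
      map_add' := fun v w => by simp
      map_smul' := fun g v => by
        have e1 : (g (v.1, 0)).2 = 0 :=
          LinearMap.congr_fun (h1 ((LinearMap.snd H S X).comp (g.comp (LinearMap.inl H S X)))) v.1
        have e2 : (g (0, v.2)).1 = 0 :=
          LinearMap.congr_fun (h2 ((LinearMap.fst H S X).comp (g.comp (LinearMap.inr H S X)))) v.2
        have e3 : g v = g (v.1, 0) + g (0, v.2) := by rw [← map_add]; simp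
        change ((g v).1, (0 : X)) = g (v.1, 0)
        rw [e3, Prod.fst_add, e2, add_zero]
        exact Prod.ext rfl e1.symm }
  have hss : IsSemisimpleModule H (S × X) := by
    have h3 := IsSemisimpleModule.sup (IsSemisimpleModule.range (LinearMap.inl H S X))
      (IsSemisimpleModule.range (LinearMap.inr H S X))
    rw [LinearMap.sup_range_inl_inr] at h3
    exact IsSemisimpleModule.congr Submodule.topEquiv.symm
  obtain ⟨t, ht⟩ := (Module.Finite.fg_top : (⊤ : Submodule K (S × X)).FG)
  obtain ⟨a, ha⟩ := jacobson_density f t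
  have hall : ∀ v : S × X, (v.1, (0 : X)) = a • v := by
    intro v
    have hv : v ∈ Submodule.span K (t : Set (S × X)) := by rw [ht]; trivial
    induction hv using Submodule.span_induction with
    | mem v hv => exact ha v hv
    | zero => simp
    | add v w _ _ h h' =>
      rw [smul_add, ← h, ← h']
      simp
    | smul k v _ h =>
      rw [smul_comm, ← h]
      simp
  refine ⟨a, fun s => ?_, fun x => ?_⟩
  · exact (congrArg Prod.fst (hall (s, 0))).symm
  · exact (congrArg Prod.snd (hall (0, x))).symm

theorem Fin.add_sum_le_last {n : ℕ} (d : Fin (n + 1) → ℕ) (t : Fin n → ℕ)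
    (h : ∀ j, d j.castSucc + t j ≤ d j.succ) : d 0 + ∑ j, t j ≤ d (Fin.last n) := by
  induction n with
  | zero => simp
  | succ n ih =>
    have h1 := ih (fun j => d j.castSucc) (fun j => t j.castSucc) fun j => by
      simpa using h j.castSucc
    rw [Fin.sum_univ_castSucc, ← add_assoc]
    exact (Nat.add_le_add_right h1 _).trans (h (Fin.last n))

theorem Fin.add_sum_eq_last {n : ℕ} (d : Fin (n + 1) → ℕ) (t : Fin n → ℕ)
    (h : ∀ j, d j.castSucc + t j = d j.succ) : d 0 + ∑ j, t j = d (Fin.last n) := by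
  induction n with
  | zero => simp
  | succ n ih =>
    have h1 := ih (fun j => d j.castSucc) (fun j => t j.castSucc) fun j => by
      simpa using h j.castSucc
    rw [Fin.sum_univ_castSucc, ← add_assoc]
    exact (congrArg (· + t (Fin.last n)) h1).trans (h (Fin.last n))

theorem exists_ltSeries_covBy (N : Type*) [AddCommGroup N] [Module H N] [IsNoetherian H N]
    [IsArtinian H N] :
    ∃ c : LTSeries (Submodule H N), c 0 = ⊥ ∧ c (Fin.last _) = ⊤ ∧
      ∀ j : Fin c.length, c j.castSucc ⋖ c j.succ := by
  obtain ⟨f, f0, n, hn⟩ := exists_covBy_seq_of_wellFoundedLT_wellFoundedGT (Submodule H N)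
  exact ⟨⟨n, fun i => f i, fun i => (hn.2 i i.2).lt⟩, f0.eq_bot, hn.1.eq_top, fun j => hn.2 j j.2⟩

section Module

variable {N : Type*} [AddCommGroup N] [Module H N] [Module K N] [IsScalarTower K H N]

/-- The image of a submodule under the action of `a`, as a `K`-subspace. -/
def smulImage (K : Type*) [Field K] {H : Type*} [Ring H] [Algebra K H] {N : Type*}
    [AddCommGroup N] [Module H N] [Module K N] [IsScalarTower K H N] (a : H)
    (A : Submodule H N) : Submodule K N :=
  (A.restrictScalars K).map (Algebra.lsmul K K N a : N →ₗ[K] N)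

theorem finiteDimensional_quotient [FiniteDimensional K N] (A B : Submodule H N) :
    FiniteDimensional K (B ⧸ A.submoduleOf B) := by
  have : FiniteDimensional K B :=
    inferInstanceAs (FiniteDimensional K (B.restrictScalars K))
  exact Module.Finite.of_surjective ((A.submoduleOf B).mkQ.restrictScalars K)
    (A.submoduleOf B).mkQ_surjective

theorem smulImage_le (a : H) (A : Submodule H N) : smulImage K a A ≤ A.restrictScalars K := by
  rintro _ ⟨x, hx, rfl⟩
  exact A.smul_mem a hx

theorem smulImage_mono (a : H) {A B : Submodule H N} (h : A ≤ B) :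
    smulImage K a A ≤ smulImage K a B := by
  rintro _ ⟨x, hx, rfl⟩
  exact ⟨x, h hx, rfl⟩

variable {S : Type*} [AddCommGroup S] [Module H S] [Module K S] [IsScalarTower K H S]

theorem smul_sub_mem_of_equiv {A B : Submodule H N}
    (e : (B ⧸ A.submoduleOf B) ≃ₗ[H] S) {a : H} (ha : ∀ s : S, a • s = s) {x : N} (hx : x ∈ B) :
    a • x - x ∈ A := by
  have h1 : (A.submoduleOf B).mkQ (a • ⟨x, hx⟩ - ⟨x, hx⟩) = 0 := by
    apply e.injective
    rw [map_sub, map_smul, map_sub, map_smul, ha, sub_self, map_zero]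
  exact (Submodule.Quotient.mk_eq_zero (A.submoduleOf B)).1 h1

/-- A step isomorphic to `S` contributes the dimension of `S` to the image of an element that acts
trivially on `S`. -/
theorem finrank_smulImage_add_le [FiniteDimensional K N] {A B : Submodule H N} (hAB : A ≤ B)
    (e : (B ⧸ A.submoduleOf B) ≃ₗ[H] S) {a : H} (ha : ∀ s : S, a • s = s) :
    Module.finrank K (smulImage K a A) + Module.finrank K S ≤
      Module.finrank K (smulImage K a B) := by
  let f : smulImage K a B →ₗ[K] (B ⧸ A.submoduleOf B) :=
    ((A.submoduleOf B).mkQ.restrictScalars K).comp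
      (Submodule.inclusion (smulImage_le (K := K) a B))
  have hsurj : LinearMap.range f = ⊤ := by
    rw [LinearMap.range_eq_top]
    intro q
    obtain ⟨x, rfl⟩ := (A.submoduleOf B).mkQ_surjective q
    refine ⟨⟨a • (x : N), x, x.2, rfl⟩, ?_⟩
    change (A.submoduleOf B).mkQ (a • x) = _
    apply e.injective
    rw [map_smul, map_smul, ha]
  have h1 := LinearMap.finrank_range_add_finrank_ker f
  rw [hsurj, finrank_top, (e.restrictScalars K).finrank_eq] at h1
  have h2 : Module.finrank K (smulImage K a A) ≤ Module.finrank K (LinearMap.ker f) := by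
    refine LinearMap.finrank_le_finrank_of_injective
      (f := (Submodule.inclusion (smulImage_mono (K := K) a hAB)).codRestrict _ ?_) ?_
    · rintro ⟨y, hy⟩
      rw [LinearMap.mem_ker]
      exact (Submodule.Quotient.mk_eq_zero _).2 (smulImage_le (K := K) a A hy)
    · intro x y hxy
      exact Submodule.inclusion_injective _ (congrArg Subtype.val hxy)
  omega

theorem finrank_smulImage_add_eq [FiniteDimensional K N] {A B : Submodule H N} (hAB : A ≤ B)
    (e : (B ⧸ A.submoduleOf B) ≃ₗ[H] S) {a : H} (ha : ∀ s : S, a • s = s)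
    (hi : ∀ x : N, a • a • x = a • x) :
    Module.finrank K (smulImage K a A) + Module.finrank K S =
      Module.finrank K (smulImage K a B) := by
  refine (finrank_smulImage_add_le hAB e ha).antisymm ?_
  let f : smulImage K a B →ₗ[K] (B ⧸ A.submoduleOf B) :=
    ((A.submoduleOf B).mkQ.restrictScalars K).comp
      (Submodule.inclusion (smulImage_le (K := K) a B))
  have h1 := LinearMap.finrank_range_add_finrank_ker f
  have hfd : FiniteDimensional K (B ⧸ A.submoduleOf B) := finiteDimensional_quotient A B
  have h3 := Submodule.finrank_le (LinearMap.range f)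
  rw [(e.restrictScalars K).finrank_eq] at h3
  have h2 : Module.finrank K (LinearMap.ker f) ≤ Module.finrank K (smulImage K a A) := by
    refine LinearMap.finrank_le_finrank_of_injective
      (f := ((smulImage K a B).subtype.comp (LinearMap.ker f).subtype).codRestrict _ ?_) ?_
    · rintro ⟨⟨y, x, hx, rfl⟩, hy⟩
      have hy' : a • x ∈ A := 
        (Submodule.Quotient.mk_eq_zero (A.submoduleOf B)).1 (LinearMap.mem_ker.1 hy)
      exact ⟨a • x, hy', hi x⟩
    · intro x y hxy
      exact Subtype.ext (Subtype.ext (congrArg (fun z : smulImage K a A => (z : N)) hxy))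
  omega

theorem smulImage_eq_of_smul_mem {A B : Submodule H N} (hAB : A ≤ B) {a : H}
    (ha : ∀ x ∈ B, a • x ∈ A) (hi : ∀ x : N, a • a • x = a • x) :
    smulImage K a A = smulImage K a B := by
  refine le_antisymm (smulImage_mono a hAB) ?_
  rintro _ ⟨x, hx, rfl⟩
  exact ⟨a • x, ha x hx, hi x⟩

open Classical in
theorem sum_ite_eq_encard {n : ℕ} (p : Fin n → Prop) (k : ℕ) :
    ∃ m : ℕ, Set.encard {j | p j} = m ∧ ∑ j, (if p j then k else 0) = m * k := by
  refine ⟨(Finset.univ.filter p).card, ?_, ?_⟩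
  · rw [← Set.encard_coe_eq_coe_finsetCard]
    simp
  · rw [← Finset.sum_filter, Finset.sum_const, smul_eq_mul]

open Classical in
/-- If `a` acts as an idempotent on `N`, trivially on `S` and by zero on the other factors of a
composition series, the rank of `a` counts the multiplicity of `S`. -/
theorem jhMultiplicity_mul_finrank [FiniteDimensional K N] [Nontrivial S] [FiniteDimensional K S]
    {a : H} (ha : ∀ s : S, a • s = s) (hi : ∀ x : N, a • a • x = a • x)
    (c : LTSeries (Submodule H N)) (h0 : c 0 = ⊥) (h1 : c (Fin.last _) = ⊤)
    (hc : ∀ j : Fin c.length, ¬ Nonempty ((c j.succ ⧸ (c j.castSucc).submoduleOf (c j.succ)) ≃ₗ[H] S) →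
      ∀ x ∈ c j.succ, a • x ∈ c j.castSucc) :
    ∃ m : ℕ, jhMultiplicity H N S = m ∧
      m * Module.finrank K S = Module.finrank K (smulImage K a (⊤ : Submodule H N)) := by
  have hS : 0 < Module.finrank K S := Module.finrank_pos
  obtain ⟨m, hm, hm'⟩ := sum_ite_eq_encard (fun j : Fin c.length =>
    Nonempty ((c j.succ ⧸ (c j.castSucc).submoduleOf (c j.succ)) ≃ₗ[H] S)) (Module.finrank K S)
  have hmain : m * Module.finrank K S = Module.finrank K (smulImage K a (⊤ : Submodule H N)) := by
    have h2 := Fin.add_sum_eq_last (fun j => Module.finrank K (smulImage K a (c j)))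
      (fun j => if Nonempty ((c j.succ ⧸ (c j.castSucc).submoduleOf (c j.succ)) ≃ₗ[H] S)
        then Module.finrank K S else 0) (fun j => by
        have hlt : c j.castSucc ≤ c j.succ := (c.step j).le
        split_ifs with hj
        · exact finrank_smulImage_add_eq hlt hj.some ha hi
        · rw [add_zero, smulImage_eq_of_smul_mem hlt (hc j hj) hi])
    rw [hm', h1, h0] at h2
    have h3 : smulImage K a (⊥ : Submodule H N) = ⊥ := by
      rw [eq_bot_iff]; exact smulImage_le a ⊥
    rw [h3, finrank_bot, zero_add] at h2
    exact h2
  refine ⟨m, le_antisymm (iSup_le fun c' => ?_) (hm ▸ le_iSup (fun c' : LTSeries (Submodule H N) =>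
    Set.encard {j : Fin c'.length |
      Nonempty (((c' j.succ) ⧸ (c' j.castSucc).submoduleOf (c' j.succ)) ≃ₗ[H] S)}) c), hmain⟩
  obtain ⟨m', hm1, hm2⟩ := sum_ite_eq_encard (fun j : Fin c'.length =>
    Nonempty ((c' j.succ ⧸ (c' j.castSucc).submoduleOf (c' j.succ)) ≃ₗ[H] S)) (Module.finrank K S)
  rw [hm1, Nat.cast_le]
  have h2 := Fin.add_sum_le_last (fun j => Module.finrank K (smulImage K a (c' j)))
      (fun j => if Nonempty ((c' j.succ ⧸ (c' j.castSucc).submoduleOf (c' j.succ)) ≃ₗ[H] S)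
        then Module.finrank K S else 0) (fun j => by
        have hlt : c' j.castSucc ≤ c' j.succ := (c'.step j).le
        split_ifs with hj
        · exact finrank_smulImage_add_le hlt hj.some ha
        · exact Submodule.finrank_mono (smulImage_mono a hlt))
  rw [hm2] at h2
  have h3 : Module.finrank K (smulImage K a (c' (Fin.last _))) ≤
      Module.finrank K (smulImage K a (⊤ : Submodule H N)) :=
    Submodule.finrank_mono (smulImage_mono a le_top)
  exact Nat.le_of_mul_le_mul_right (by omega : m' * _ ≤ m * _) hS

/-- The multiplicity in a finite dimensional module of a simple module of infinite dimension. -/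
theorem jhMultiplicity_eq_zero [FiniteDimensional K N] (hS : ¬ FiniteDimensional K S) :
    jhMultiplicity H N S = 0 := by
  refine iSup_eq_bot.2 fun c => Set.encard_eq_zero.2 (Set.eq_empty_of_forall_notMem ?_)
  rintro j ⟨e⟩
  have := finiteDimensional_quotient (K := K) (c j.castSucc) (c j.succ)
  exact hS (Module.Finite.equiv (e.restrictScalars K))

/-- An element acting trivially on `S` and by zero on the other factors of a composition series. -/
theorem exists_smul_mem_of_not_equiv [IsSimpleModule H S] [FiniteDimensional K S]
    [FiniteDimensional K N] (c : LTSeries (Submodule H N))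
    (hc : ∀ j : Fin c.length, c j.castSucc ⋖ c j.succ) :
    ∃ a : H, (∀ s : S, a • s = s) ∧ ∀ j : Fin c.length,
      ¬ Nonempty ((c j.succ ⧸ (c j.castSucc).submoduleOf (c j.succ)) ≃ₗ[H] S) →
        ∀ x ∈ c j.succ, a • x ∈ c j.castSucc := by
  suffices h : ∀ F : Finset (Fin c.length), ∃ a : H, (∀ s : S, a • s = s) ∧ ∀ j ∈ F,
      ¬ Nonempty ((c j.succ ⧸ (c j.castSucc).submoduleOf (c j.succ)) ≃ₗ[H] S) →
        ∀ x ∈ c j.succ, a • x ∈ c j.castSucc by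
    obtain ⟨a, h1, h2⟩ := h Finset.univ
    exact ⟨a, h1, fun j => h2 j (Finset.mem_univ j)⟩
  classical
  intro F
  induction F using Finset.induction_on with
  | empty => exact ⟨1, fun s => one_smul _ s, by simp⟩
  | insert j F _ ih =>
    obtain ⟨a, h1, h2⟩ := ih
    by_cases hj : Nonempty ((c j.succ ⧸ (c j.castSucc).submoduleOf (c j.succ)) ≃ₗ[H] S)
    · refine ⟨a, h1, fun i hi hi' => ?_⟩
      rcases Finset.mem_insert.1 hi with rfl | hi
      · exact absurd hj hi'
      · exact h2 i hi hi'
    · have : IsSimpleModule H (c j.succ ⧸ (c j.castSucc).submoduleOf (c j.succ)) :=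
        (covBy_iff_quot_is_simple (hc j).le).1 (hc j)
      have := finiteDimensional_quotient (K := K) (c j.castSucc) (c j.succ)
      obtain ⟨a', h1', h2'⟩ := exists_smul_eq_self_and_smul_eq_zero (K := K) hj
      refine ⟨a' * a, fun s => by rw [mul_smul, h1, h1'], fun i hi hi' x hx => ?_⟩
      rcases Finset.mem_insert.1 hi with rfl | hi
      · have h3 := h2' ((Submodule.mkQ _) (⟨a • x, Submodule.smul_mem _ a hx⟩ : c i.succ))
        rw [← map_smul] at h3
        rw [mul_smul]
        exact (Submodule.Quotient.mk_eq_zero ((c i.castSucc).submoduleOf (c i.succ))).1 h3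
      · rw [mul_smul]
        exact Submodule.smul_mem _ a' (h2 i hi hi' x hx)

theorem pow_smul_eq_zero_of_ltSeries (c : LTSeries (Submodule H N)) (h0 : c 0 = ⊥)
    (h1 : c (Fin.last _) = ⊤) {a : H} (ha : ∀ j : Fin c.length, ∀ x ∈ c j.succ, a • x ∈ c j.castSucc)
    (x : N) : a ^ c.length • x = 0 := by
  have h : ∀ (k : ℕ) (hk : k < c.length + 1) (x : N), x ∈ c ⟨k, hk⟩ → a ^ k • x = 0 := by
    intro k
    induction k with
    | zero =>
      intro hk x hx
      have hx' : x ∈ c 0 := hx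
      rw [h0, Submodule.mem_bot] at hx'
      rw [hx', smul_zero]
    | succ k ih =>
      intro hk x hx
      rw [pow_succ, mul_smul]
      exact ih (by omega) _ (ha ⟨k, by omega⟩ x hx)
  refine h c.length (by omega) x ?_
  have h2 : x ∈ c (Fin.last _) := by rw [h1]; trivial
  exact h2

theorem Polynomial.idempotent_dvd {R : Type*} [CommRing R] (x : R) (k : ℕ) :
    (x ^ 2 - x) ^ k ∣ (1 - (1 - x ^ k) ^ k) ^ 2 - (1 - (1 - x ^ k) ^ k) := by
  have h1 : (1 - x) ^ k ∣ (1 - x ^ k) ^ k := pow_dvd_pow_of_dvd (by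
    simpa using sub_dvd_pow_sub_pow 1 x k) k
  have h2 : x ^ k ∣ 1 - (1 - x ^ k) ^ k := by
    have := sub_dvd_pow_sub_pow 1 (1 - x ^ k) k
    simpa using this
  have h3 : (x ^ 2 - x) ^ k = (-1) ^ k * ((1 - x) ^ k * x ^ k) := by
    rw [← mul_pow, ← mul_pow]; ring
  rw [h3, show (1 - (1 - x ^ k) ^ k) ^ 2 - (1 - (1 - x ^ k) ^ k) =
    (-1) * ((1 - x ^ k) ^ k * (1 - (1 - x ^ k) ^ k)) by ring]
  obtain ⟨y, hy⟩ := mul_dvd_mul h1 h2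
  have h4 : ((-1 : R) ^ k) * (-1) ^ k = 1 := by rw [← mul_pow]; simp
  exact ⟨(-1) * ((-1) ^ k * y), by
    rw [hy]
    linear_combination ((1 - x) ^ k * x ^ k * y) * h4⟩

/-- `a` acts trivially on `S` and by zero on the steps of `c` that are not isomorphic to `S`. -/
def IsAdapted (S : Type*) [AddCommGroup S] [Module H S] {N : Type*} [AddCommGroup N] [Module H N]
    (c : LTSeries (Submodule H N)) (a : H) : Prop :=
  (∀ s : S, a • s = s) ∧ ∀ j : Fin c.length,
    ¬ Nonempty ((c j.succ ⧸ (c j.castSucc).submoduleOf (c j.succ)) ≃ₗ[H] S) →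
      ∀ x ∈ c j.succ, a • x ∈ c j.castSucc

theorem IsAdapted.mul_left {c : LTSeries (Submodule H N)} {a b : H} (ha : IsAdapted S c a)
    (hb : ∀ s : S, b • s = s) : IsAdapted S c (b * a) :=
  ⟨fun s => by rw [mul_smul, ha.1, hb], fun j hj x hx => by
    rw [mul_smul]
    exact Submodule.smul_mem _ b (ha.2 j hj x hx)⟩

theorem IsAdapted.mul_right {c : LTSeries (Submodule H N)} {a b : H} (ha : IsAdapted S c a)
    (hb : ∀ s : S, b • s = s) : IsAdapted S c (a * b) :=
  ⟨fun s => by rw [mul_smul, hb, ha.1], fun j hj x hx => by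
    rw [mul_smul]
    exact ha.2 j hj _ (Submodule.smul_mem _ b hx)⟩

theorem IsAdapted.idempotent {c : LTSeries (Submodule H N)} {a : H} (ha : IsAdapted S c a)
    {k : ℕ} (hk : k ≠ 0) : IsAdapted S c (1 - (1 - a ^ k) ^ k) := by
  have h1 : ∀ s : S, a ^ k • s = s := fun s => by
    clear hk
    induction k with
    | zero => simp
    | succ k ih => rw [pow_succ, mul_smul, ha.1, ih]
  refine ⟨fun s => ?_, fun j hj x hx => ?_⟩
  · obtain ⟨k, rfl⟩ := Nat.exists_eq_succ_of_ne_zero hk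
    rw [sub_smul, one_smul, pow_succ _ k, mul_smul, sub_smul, one_smul, h1, sub_self, smul_zero,
      sub_zero]
  · have h2 : (Polynomial.X : Polynomial ℤ) ∣ 1 - (1 - Polynomial.X ^ k) ^ k := by
      refine (dvd_pow_self _ hk).trans ?_
      simpa using sub_dvd_pow_sub_pow 1 (1 - (Polynomial.X : Polynomial ℤ) ^ k) k
    obtain ⟨q, hq⟩ := h2
    have h3 := congrArg (Polynomial.aeval a) (hq.trans (mul_comm _ _))
    simp only [map_sub, map_mul, map_pow, Polynomial.aeval_X, map_one] at h3
    rw [h3, mul_smul]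
    exact Submodule.smul_mem _ _ (ha.2 j hj x hx)

theorem IsAdapted.pow_smul_eq_zero {c : LTSeries (Submodule H N)} {a : H} (ha : IsAdapted S c a)
    (h0 : c 0 = ⊥) (h1 : c (Fin.last _) = ⊤) (x : N) : (a ^ 2 - a) ^ c.length • x = 0 := by
  refine pow_smul_eq_zero_of_ltSeries c h0 h1 (fun j x hx => ?_) x
  rw [sub_smul, pow_two, mul_smul]
  by_cases hj : Nonempty ((c j.succ ⧸ (c j.castSucc).submoduleOf (c j.succ)) ≃ₗ[H] S)
  · exact smul_sub_mem_of_equiv hj.some ha.1 (Submodule.smul_mem _ a hx)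
  · have h2 := ha.2 j hj x hx
    exact Submodule.sub_mem _ (Submodule.smul_mem _ a h2) h2

theorem exists_isAdapted (S : Type*) [AddCommGroup S] [Module H S] [Module K S]
    [IsScalarTower K H S] (N : Type*) [AddCommGroup N] [Module H N] [Module K N]
    [IsScalarTower K H N] [FiniteDimensional K N] [IsSimpleModule H S] [FiniteDimensional K S] :
    ∃ (c : LTSeries (Submodule H N)) (a : H), c 0 = ⊥ ∧ c (Fin.last _) = ⊤ ∧ IsAdapted S c a := by
  have : IsNoetherian H N := isNoetherian_of_tower K inferInstance
  have : IsArtinian H N := isArtinian_of_tower K inferInstance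
  obtain ⟨c, h0, h1, hc⟩ := exists_ltSeries_covBy (H := H) N
  obtain ⟨a, ha⟩ := exists_smul_mem_of_not_equiv (K := K) (S := S) c hc
  exact ⟨c, a, h0, h1, ha⟩

theorem smul_smul_eq_of_dvd {a : H} {n k : ℕ} (hnk : n ≤ k) (x : N)
    (h : ∀ x : N, (a ^ 2 - a) ^ n • x = 0) :
    (1 - (1 - a ^ k) ^ k) • (1 - (1 - a ^ k) ^ k) • x = (1 - (1 - a ^ k) ^ k) • x := by
  obtain ⟨q, hq⟩ := (pow_dvd_pow _ hnk).trans
    (Polynomial.idempotent_dvd (Polynomial.X : Polynomial ℤ) k)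
  have h1 := congrArg (Polynomial.aeval a) ((mul_comm _ _).trans hq.symm).symm
  simp only [map_sub, map_mul, map_pow, Polynomial.aeval_X, map_one] at h1
  rw [← sub_eq_zero, smul_smul, ← sub_smul, ← pow_two, h1, mul_smul, h, smul_zero]

end Module

/-- If the idempotents have the same rank on two modules, all multiplicities agree. -/
theorem jhMultiplicity_eq_of_finrank_smulImage_eq {N₁ : Type*} [AddCommGroup N₁] [Module H N₁]
    [Module K N₁] [IsScalarTower K H N₁] [FiniteDimensional K N₁] {N₂ : Type*} [AddCommGroup N₂]
    [Module H N₂] [Module K N₂] [IsScalarTower K H N₂] [FiniteDimensional K N₂]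
    {S : Type*} [AddCommGroup S] [Module H S] [IsSimpleModule H S]
    (h : ∀ a : H, (∀ x : N₁, a • a • x = a • x) → (∀ x : N₂, a • a • x = a • x) →
      Module.finrank K (smulImage K a (⊤ : Submodule H N₁)) =
        Module.finrank K (smulImage K a (⊤ : Submodule H N₂))) :
    jhMultiplicity H N₁ S = jhMultiplicity H N₂ S := by
  let _ : Module K S := Module.compHom S (algebraMap K H)
  have : IsScalarTower K H S := ⟨fun k a s => by
    rw [Algebra.smul_def, mul_smul]
    rfl⟩
  by_cases hS : FiniteDimensional K S
  · obtain ⟨c₁, a₁, h01, h11, ha1⟩ := exists_isAdapted (K := K) (H := H) S N₁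
    obtain ⟨c₂, a₂, h02, h12, ha2⟩ := exists_isAdapted (K := K) (H := H) S N₂
    have h1 := ha1.mul_right ha2.1
    have h2 := ha2.mul_left ha1.1
    set k := c₁.length + c₂.length + 1
    have hi1 := fun x => smul_smul_eq_of_dvd (show c₁.length ≤ k by omega) x
      (h1.pow_smul_eq_zero h01 h11)
    have hi2 := fun x => smul_smul_eq_of_dvd (show c₂.length ≤ k by omega) x
      (h2.pow_smul_eq_zero h02 h12)
    have h1' := h1.idempotent (Nat.succ_ne_zero _ : k ≠ 0)
    have h2' := h2.idempotent (Nat.succ_ne_zero _ : k ≠ 0)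
    have : Nontrivial S := IsSimpleModule.nontrivial H S
    obtain ⟨m₁, hm1, hd1⟩ := jhMultiplicity_mul_finrank (K := K) h1'.1 hi1 c₁ h01 h11 h1'.2
    obtain ⟨m₂, hm2, hd2⟩ := jhMultiplicity_mul_finrank (K := K) h2'.1 hi2 c₂ h02 h12 h2'.2
    rw [hm1, hm2, Nat.eq_of_mul_eq_mul_right Module.finrank_pos
      (hd1.trans ((h _ hi1 hi2).trans hd2.symm))]
  · rw [jhMultiplicity_eq_zero hS, jhMultiplicity_eq_zero hS]

end Algebra

section GenEigen

variable {K : Type*} [Field K] {H : Type*} [Ring H] [Algebra K H]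
  {M : Type*} [AddCommGroup M] [Module K M]

instance (φ : H →ₐ[K] Module.End K M) : Module K (RepSpace φ) :=
  inferInstanceAs (Module K M)

instance (φ : H →ₐ[K] Module.End K M) : IsScalarTower K H (RepSpace φ) where
  smul_assoc k h m := by
    change φ (k • h) (show M from m) = k • φ h (show M from m)
    rw [map_smul, LinearMap.smul_apply]

/-- The inclusion of a generalized eigenspace, as a `K`-linear map. -/
def genEigenEquiv (φ : H →ₐ[K] Module.End K M) (u : Module.End K M) (hu : ∀ h, Commute (φ h) u)
    (Q : Polynomial K) : genEigen φ u hu Q ≃ₗ[K] genKer u Q where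
  toFun m := ⟨m.1, m.2⟩
  invFun m := ⟨m.1, m.2⟩
  map_add' _ _ := rfl
  map_smul' _ _ := rfl

theorem finrank_smulImage_genEigen (φ : H →ₐ[K] Module.End K M) (u : Module.End K M)
    (hu : ∀ h, Commute (φ h) u) (Q : Polynomial K) (a : H) :
    Module.finrank K (smulImage K a (⊤ : Submodule H (genEigen φ u hu Q))) =
      Module.finrank K ((genKer u Q).map (φ a)) := by
  let f : genEigen φ u hu Q →ₗ[K] M := (genKer u Q).subtype.comp (genEigenEquiv φ u hu Q).toLinearMap
  have hf : Function.Injective f :=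
    Subtype.val_injective.comp (genEigenEquiv φ u hu Q).injective
  rw [(Submodule.equivMapOfInjective f hf (smulImage K a ⊤)).finrank_eq]
  have h : (smulImage K a (⊤ : Submodule H (genEigen φ u hu Q))).map f =
      (genKer u Q).map (φ a) := by
    ext y
    constructor
    · rintro ⟨_, ⟨x, _, rfl⟩, rfl⟩
      exact ⟨x.1, x.2, rfl⟩
    · rintro ⟨x, hx, rfl⟩
      exact ⟨_, ⟨⟨x, hx⟩, trivial, rfl⟩, rfl⟩
  rw [h]

/-- Multiplicities are determined by the ranks, on generalized eigenspaces, of the elements that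
act there as idempotents. -/
theorem finiteSlopeMultiplicity_eq {M₁ : Type*} [AddCommGroup M₁] [Module K M₁] {M₂ : Type*}
    [AddCommGroup M₂] [Module K M₂] (φ₁ : H →ₐ[K] Module.End K M₁) (u₁ : Module.End K M₁)
    (hu₁ : ∀ h, Commute (φ₁ h) u₁) (φ₂ : H →ₐ[K] Module.End K M₂) (u₂ : Module.End K M₂)
    (hu₂ : ∀ h, Commute (φ₂ h) u₂)
    (hf₁ : ∀ Q : NonzeroPrime K, FiniteDimensional K (genKer u₁ Q.1))
    (hf₂ : ∀ Q : NonzeroPrime K, FiniteDimensional K (genKer u₂ Q.1))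
    (h : ∀ (Q : NonzeroPrime K) (a : H), (∀ x ∈ genKer u₁ Q.1, φ₁ a (φ₁ a x) = φ₁ a x) →
      (∀ x ∈ genKer u₂ Q.1, φ₂ a (φ₂ a x) = φ₂ a x) →
        Module.finrank K ((genKer u₁ Q.1).map (φ₁ a)) =
          Module.finrank K ((genKer u₂ Q.1).map (φ₂ a)))
    (S : Type*) [AddCommGroup S] [Module H S] [IsSimpleModule H S] :
    finiteSlopeMultiplicity φ₁ u₁ hu₁ S = finiteSlopeMultiplicity φ₂ u₂ hu₂ S := by
  refine iSup_congr fun F => Finset.sum_congr rfl fun Q _ => ?_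
  have := hf₁ Q
  have := hf₂ Q
  have := Module.Finite.equiv (genEigenEquiv φ₁ u₁ hu₁ Q.1).symm
  have := Module.Finite.equiv (genEigenEquiv φ₂ u₂ hu₂ Q.1).symm
  refine jhMultiplicity_eq_of_finrank_smulImage_eq (K := K) fun a h₁ h₂ => ?_
  rw [finrank_smulImage_genEigen, finrank_smulImage_genEigen]
  exact h Q a (fun x hx => congrArg Subtype.val (h₁ ⟨x, hx⟩))
    (fun x hx => congrArg Subtype.val (h₂ ⟨x, hx⟩))

end GenEigen

section Perturbation

variable {K : Type*} [Field K] {M : Type*} [AddCommGroup M] [Module K M]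

theorem aeval_apply_eq_of_mem {u t : Module.End K M} {W : Submodule K M}
    (hW : ∀ w ∈ W, u w ∈ W) (ht : ∀ w ∈ W, t w = u w) (R : Polynomial K) {w : M} (hw : w ∈ W) :
    Polynomial.aeval t R w = Polynomial.aeval u R w := by
  induction R using Polynomial.induction_on' with
  | add p q hp hq => simp [hp, hq]
  | monomial n a =>
    rw [Polynomial.aeval_monomial, Polynomial.aeval_monomial, ← Algebra.smul_def,
      ← Algebra.smul_def, LinearMap.smul_apply, LinearMap.smul_apply]
    congr 1
    have h : ∀ n, (u ^ n) w ∈ W ∧ (t ^ n) w = (u ^ n) w := by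
      intro n
      induction n with
      | zero => exact ⟨hw, rfl⟩
      | succ n ih =>
        rw [pow_succ', pow_succ', Module.End.mul_apply, Module.End.mul_apply, ih.2, ht _ ih.1]
        exact ⟨hW _ ih.1, rfl⟩
    exact (h n).2

theorem isCoprime_comp_C_mul_X (Q : NonzeroPrime K) {γ : K} (h0 : γ ≠ 0)
    (hγ : γ ^ Q.1.natDegree ≠ 1) : IsCoprime Q.1 (Q.1.comp (Polynomial.C γ * Polynomial.X)) := by
  rw [Q.2.2.1.coprime_iff_not_dvd]
  intro hdvd
  have h1 := Polynomial.eq_leadingCoeff_mul_of_monic_of_dvd_of_natDegree_le Q.2.1 hdvd (by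
    rw [Polynomial.natDegree_comp, Polynomial.natDegree_C_mul_X _ h0, mul_one])
  set t := (Q.1.comp (Polynomial.C γ * Polynomial.X)).leadingCoeff
  have h2 := congrArg (fun P => Polynomial.coeff P 0) h1
  have h3 := congrArg (fun P => Polynomial.coeff P Q.1.natDegree) h1
  simp only [Polynomial.comp_C_mul_X_coeff, Polynomial.coeff_C_mul, pow_zero, mul_one] at h2 h3
  rw [Polynomial.Monic.coeff_natDegree Q.2.1, one_mul, mul_one] at h3
  apply hγ
  rw [h3]
  exact mul_right_cancel₀ Q.coeff_zero_ne_zero (h2.symm.trans (one_mul _).symm)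

theorem genKer_eq_map_of_le {u e : Module.End K M} (heu : Commute e u) (Q : NonzeroPrime K)
    (hi : ∀ x ∈ genKer u Q.1, e (e x) = e x) {γ : K} (h0 : γ ≠ 0) (hγ : γ ^ Q.1.natDegree ≠ 1)
    (hle : genKer ((γ • 1 + (1 - γ) • e) * u) Q.1 ≤ genKer u Q.1) :
    genKer ((γ • 1 + (1 - γ) • e) * u) Q.1 = (genKer u Q.1).map e := by
  have hNu : ∀ x ∈ genKer u Q.1, u x ∈ genKer u Q.1 :=
    fun x hx => genKer_stable u u (Commute.refl u) Q.1 x hx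
  have hNe : ∀ x ∈ genKer u Q.1, e x ∈ genKer u Q.1 :=
    fun x hx => genKer_stable u e heu Q.1 x hx
  have hcomm : ∀ x, e (u x) = u (e x) := fun x => LinearMap.congr_fun heu.eq x
  have het : Commute e ((γ • 1 + (1 - γ) • e) * u) := by
    refine Commute.mul_right (Commute.add_right ?_ ?_) heu
    · exact (Commute.one_right e).smul_right γ
    · exact (Commute.refl e).smul_right _
  apply le_antisymm
  · intro x hx
    have hxN := hle hx
    let W : Submodule K M := genKer u Q.1 ⊓ LinearMap.ker e
    have hWu : ∀ w ∈ W, (γ • u) w ∈ W := fun w hw => W.smul_mem γ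
      ⟨hNu w hw.1, by
      change e (u w) = 0
      rw [hcomm, LinearMap.mem_ker.1 hw.2, map_zero]⟩
    have hWt : ∀ w ∈ W, ((γ • 1 + (1 - γ) • e) * u) w = (γ • u) w := fun w hw => by
      have : e (u w) = 0 := by rw [hcomm, LinearMap.mem_ker.1 hw.2, map_zero]
      simp [this]
    have hy : x - e x ∈ W := ⟨Submodule.sub_mem _ hxN (hNe x hxN), by
      change e (x - e x) = 0
      rw [map_sub, hi x hxN, sub_self]⟩
    have hyt : x - e x ∈ genKer ((γ • 1 + (1 - γ) • e) * u) Q.1 :=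
      Submodule.sub_mem _ hx (genKer_stable _ e het Q.1 x hx)
    obtain ⟨n, hn⟩ := hyt
    obtain ⟨m, hm⟩ := hy.1
    rw [← map_pow, aeval_apply_eq_of_mem hWu hWt _ hy] at hn
    have hcomp : Polynomial.aeval (γ • u) (Q.1 ^ n) =
        Polynomial.aeval u ((Q.1.comp (Polynomial.C γ * Polynomial.X)) ^ n) := by
      rw [map_pow, map_pow, Polynomial.aeval_comp, map_mul, Polynomial.aeval_C, Polynomial.aeval_X,
        ← Algebra.smul_def]
    rw [hcomp] at hn
    rw [← map_pow] at hm
    obtain ⟨r, s, hrs⟩ := (isCoprime_comp_C_mul_X Q h0 hγ).pow (m := m) (n := n)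
    have h1 := LinearMap.congr_fun (congrArg (Polynomial.aeval u) hrs) (x - e x)
    rw [map_add, map_mul, map_mul, LinearMap.add_apply, Module.End.mul_apply, Module.End.mul_apply,
      hm, hn, map_zero, map_zero, map_one, add_zero, Module.End.one_apply] at h1
    exact ⟨x, hxN, (sub_eq_zero.1 h1.symm).symm⟩
  · rintro _ ⟨x, hx, rfl⟩
    let W : Submodule K M := LinearMap.ker (e - 1)
    have hWmem : ∀ {w}, w ∈ W ↔ e w = w := fun {w} => by
      rw [LinearMap.mem_ker, LinearMap.sub_apply, sub_eq_zero, Module.End.one_apply]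
    have hWu : ∀ w ∈ W, u w ∈ W := fun w hw => by
      rw [hWmem] at hw ⊢
      rw [hcomm, hw]
    have hWt : ∀ w ∈ W, ((γ • 1 + (1 - γ) • e) * u) w = u w := fun w hw => by
      have := hWmem.1 (hWu w hw)
      simp [this, sub_smul]
    have hex : e x ∈ W := hWmem.2 (hi x hx)
    obtain ⟨n, hn⟩ := hNe x hx
    refine ⟨n, ?_⟩
    rw [← map_pow] at hn ⊢
    rw [aeval_apply_eq_of_mem hWu hWt _ hex, hn]

end Perturbation

section Banach

variable {K : Type*} [NontriviallyNormedField K] [IsUltrametricDist K] [CompleteSpace K]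

theorem exists_mem_pow_ne_one {s : Set K} (hs : s ∈ 𝓝 (1 : K)) {d : ℕ} (hd : 0 < d) :
    ∃ γ ∈ s, γ ≠ 0 ∧ γ ^ d ≠ 1 := by
  have h1 : (insert 0 (Polynomial.nthRootsFinset d (1 : K)) : Set K).Finite :=
    (Finset.finite_toSet _).insert 0
  obtain ⟨γ, hγ, hγ'⟩ := ((infinite_of_mem_nhds (1 : K) hs).sdiff h1).nonempty
  refine ⟨γ, hγ, fun h => hγ' (Or.inl h), fun h => hγ' (Or.inr ?_)⟩
  exact (Polynomial.mem_nthRootsFinset hd 1).2 h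

theorem eventually_genKer_eq_map {V : Type*} [NormedAddCommGroup V] [NormedSpace K V]
    [CompleteSpace V] {I : Type*} (b : ONBasis K V I) {U e : V →L[K] V}
    (hU : IsCompletelyContinuous U) (heU : Commute e U) (Q : NonzeroPrime K)
    (hi : ∀ x ∈ genKer (forgetTopology K V U) Q.1, e (e x) = e x) :
    ∀ᶠ γ in 𝓝 (1 : K), γ ≠ 0 → γ ^ Q.1.natDegree ≠ 1 →
      genKer (forgetTopology K V ((γ • 1 + (1 - γ) • e) * U)) Q.1 =
        (genKer (forgetTopology K V U) Q.1).map (forgetTopology K V e) := by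
  have h1 : ContinuousAt (fun c : K => (((1 + c) • 1 + (1 - (1 + c)) • e) * U : V →L[K] V)) 0 := by
    fun_prop
  have h2 := eventually_genKer_le b hU Q.coeff_zero_ne_zero h1 (by simp) (fun c => by
    refine Commute.mul_left (Commute.add_left ?_ (heU.smul_left _)) (Commute.refl U)
    exact (Commute.one_left U).smul_left _)
  have h3 : Tendsto (fun γ : K => γ - 1) (𝓝 1) (𝓝 0) := by
    have : ContinuousAt (fun γ : K => γ - 1) 1 := by fun_prop
    simpa [ContinuousAt] using this
  filter_upwards [h3.eventually h2] with γ hγ h0 hd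
  rw [add_sub_cancel] at hγ
  have h4 : forgetTopology K V ((γ • 1 + (1 - γ) • e) * U) =
      (γ • 1 + (1 - γ) • forgetTopology K V e) * forgetTopology K V U := by
    rw [map_mul, map_add, map_smul, map_smul, map_one]
  rw [h4] at hγ ⊢
  exact genKer_eq_map_of_le (heU.map (forgetTopology K V)) Q hi h0 hd hγ

/-- The characteristic series of the `(a + c e) U` determine the rank of an idempotent `e` on a
generalized eigenspace of `U`. -/
theorem finrank_map_genKer_eq {V₁ : Type*} [NormedAddCommGroup V₁] [NormedSpace K V₁]
    [CompleteSpace V₁] {V₂ : Type*} [NormedAddCommGroup V₂] [NormedSpace K V₂] [CompleteSpace V₂]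
    {I₁ : Type*} (b₁ : ONBasis K V₁ I₁) {I₂ : Type*} (b₂ : ONBasis K V₂ I₂)
    {U₁ e₁ : V₁ →L[K] V₁} {U₂ e₂ : V₂ →L[K] V₂} (hU₁ : IsCompletelyContinuous U₁)
    (hU₂ : IsCompletelyContinuous U₂) (heU₁ : Commute e₁ U₁) (heU₂ : Commute e₂ U₂)
    (Q : NonzeroPrime K)
    (hi₁ : ∀ x ∈ genKer (forgetTopology K V₁ U₁) Q.1, e₁ (e₁ x) = e₁ x)
    (hi₂ : ∀ x ∈ genKer (forgetTopology K V₂ U₂) Q.1, e₂ (e₂ x) = e₂ x)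
    (h : ∀ a c : K, charSeries b₁ ((a • 1 + c • e₁) * U₁) =
      charSeries b₂ ((a • 1 + c • e₂) * U₂)) :
    Module.finrank K ((genKer (forgetTopology K V₁ U₁) Q.1).map (forgetTopology K V₁ e₁)) =
      Module.finrank K ((genKer (forgetTopology K V₂ U₂) Q.1).map (forgetTopology K V₂ e₂)) := by
  obtain ⟨γ, ⟨h1, h2⟩, h0, hd⟩ := exists_mem_pow_ne_one
    ((eventually_genKer_eq_map b₁ hU₁ heU₁ Q hi₁).and
      (eventually_genKer_eq_map b₂ hU₂ heU₂ Q hi₂)) Q.2.2.1.natDegree_pos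
  rw [← h1 h0 hd, ← h2 h0 hd]
  exact finrank_genKer_eq_of_charSeries_eq b₁ b₂ (hU₁.comp_left _) (hU₂.comp_left _) (h _ _) Q

theorem banachMultiplicity_eq {H : Type*} [Ring H] [Algebra K H] {V₁ : Type*}
    [NormedAddCommGroup V₁] [NormedSpace K V₁] [CompleteSpace V₁] {V₂ : Type*}
    [NormedAddCommGroup V₂] [NormedSpace K V₂] [CompleteSpace V₂]
    {I₁ : Type*} (b₁ : ONBasis K V₁ I₁) {I₂ : Type*} (b₂ : ONBasis K V₂ I₂)
    (ρ₁ : H →ₐ[K] (V₁ →L[K] V₁)) (ρ₂ : H →ₐ[K] (V₂ →L[K] V₂)) {U₁ : V₁ →L[K] V₁}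
    {U₂ : V₂ →L[K] V₂} (hc₁ : IsCompletelyContinuous U₁) (hc₂ : IsCompletelyContinuous U₂)
    (hU₁ : ∀ h, Commute (ρ₁ h) U₁) (hU₂ : ∀ h, Commute (ρ₂ h) U₂)
    (h : ∀ h, charSeries b₁ (ρ₁ h * U₁) = charSeries b₂ (ρ₂ h * U₂))
    (S : Type*) [AddCommGroup S] [Module H S] [IsSimpleModule H S] :
    banachMultiplicity ρ₁ U₁ hU₁ S = banachMultiplicity ρ₂ U₂ hU₂ S := by
  refine finiteSlopeMultiplicity_eq _ _ _ _ _ _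
    (fun Q => finiteDimensional_genKer b₁ hc₁ Q.coeff_zero_ne_zero)
    (fun Q => finiteDimensional_genKer b₂ hc₂ Q.coeff_zero_ne_zero) (fun Q a h₁ h₂ => ?_) S
  refine finrank_map_genKer_eq b₁ b₂ hc₁ hc₂ (hU₁ a) (hU₂ a) Q h₁ h₂ fun r c => ?_
  have := h (r • 1 + c • a)
  simpa only [map_add, map_smul, map_one] using this

end Banach

section Intertwining

variable {K : Type*} [Field K] {M : Type*} [AddCommGroup M] [Module K M] {M' : Type*}
  [AddCommGroup M'] [Module K M']

theorem aeval_apply_of_intertwining {u : Module.End K M} {u' : Module.End K M'} {f : M →ₗ[K] M'}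
    (hf : ∀ x, f (u x) = u' (f x)) (R : Polynomial K) (x : M) :
    f (Polynomial.aeval u R x) = Polynomial.aeval u' R (f x) := by
  induction R using Polynomial.induction_on' with
  | add p q hp hq => simp [hp, hq]
  | monomial n a =>
    rw [Polynomial.aeval_monomial, Polynomial.aeval_monomial, ← Algebra.smul_def,
      ← Algebra.smul_def, LinearMap.smul_apply, LinearMap.smul_apply, map_smul]
    congr 1
    induction n with
    | zero => rfl
    | succ n ih =>
      rw [pow_succ', pow_succ', Module.End.mul_apply, Module.End.mul_apply, hf, ih]

theorem map_mem_genKer {u : Module.End K M} {u' : Module.End K M'} {f : M →ₗ[K] M'}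
    (hf : ∀ x, f (u x) = u' (f x)) {Q : Polynomial K} {x : M} (hx : x ∈ genKer u Q) :
    f x ∈ genKer u' Q := by
  obtain ⟨n, hn⟩ := hx
  refine ⟨n, ?_⟩
  rw [← map_pow] at hn ⊢
  rw [← aeval_apply_of_intertwining hf, hn, map_zero]

theorem eq_zero_of_mem_genKer {u : Module.End K M} {Q : Polynomial K} (hQ : Q.coeff 0 ≠ 0) {x : M}
    (hx : x ∈ genKer u Q) (hux : u x = 0) : x = 0 := by
  obtain ⟨n, hn⟩ := hx
  rw [← map_pow, ← Polynomial.divX_mul_X_add (Q ^ n), map_add, map_mul, Polynomial.aeval_X,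
    Polynomial.aeval_C, LinearMap.add_apply, Module.End.mul_apply, hux, map_zero, zero_add,
    Module.algebraMap_end_apply] at hn
  refine (smul_eq_zero.1 hn).resolve_left ?_
  rw [Polynomial.coeff_zero_eq_eval_zero, Polynomial.eval_pow, ← Polynomial.coeff_zero_eq_eval_zero]
  exact pow_ne_zero n hQ

theorem exists_apply_eq_of_mem_genKer {u : Module.End K M} {Q : Polynomial K}
    (hQ : Q.coeff 0 ≠ 0) {x : M} (hx : x ∈ genKer u Q) : ∃ z ∈ genKer u Q, u z = x := by
  have hx' := hx
  obtain ⟨n, hn⟩ := hx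
  rw [← map_pow, ← Polynomial.divX_mul_X_add (Q ^ n), mul_comm, map_add, map_mul,
    Polynomial.aeval_X, Polynomial.aeval_C, LinearMap.add_apply, Module.End.mul_apply,
    Module.algebraMap_end_apply, Polynomial.coeff_zero_eq_eval_zero, Polynomial.eval_pow,
    ← Polynomial.coeff_zero_eq_eval_zero] at hn
  have h0 : Q.coeff 0 ^ n ≠ 0 := pow_ne_zero n hQ
  refine ⟨-(Q.coeff 0 ^ n)⁻¹ • Polynomial.aeval u (Q ^ n).divX x, Submodule.smul_mem _ _ ?_, ?_⟩
  · refine genKer_stable u _ ?_ Q x hx'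
    have := (Commute.all (Polynomial.X : Polynomial K) (Q ^ n).divX).map (Polynomial.aeval u)
    rw [Polynomial.aeval_X] at this
    exact this.symm
  · rw [map_smul, eq_neg_of_add_eq_zero_left hn, smul_neg, neg_smul, neg_neg, smul_smul,
      inv_mul_cancel₀ h0, one_smul]

theorem finrank_map_eq_of_injOn {N : Submodule K M} {f : M →ₗ[K] M'}
    (hf : ∀ x ∈ N, f x = 0 → x = 0) : Module.finrank K (N.map f) = Module.finrank K N := by
  have hinj : Function.Injective (f.domRestrict N) := by
    rw [injective_iff_map_eq_zero]
    exact fun x hx => Subtype.ext (hf x x.2 hx)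
  rw [← LinearMap.range_domRestrict, LinearMap.finrank_range_of_inj hinj]

end Intertwining

namespace BanachSystem

variable {K : Type*} [NontriviallyNormedField K] (E : BanachSystem K)

instance : DirectedSystem E.space fun i j h => E.transition i j h where
  map_self i x := by rw [transition_self]; rfl
  map_map _ _ _ _ _ x := E.transition_trans _ _ _ _ _ x

theorem toDagger_map (n : ℕ) (x : E.space n) :
    E.toDagger (n + 1) (E.map n x) = E.toDagger n x := by
  have h := E.transition_succ n n le_rfl n.le_succ x
  rw [transition_self] at h
  exact (congrArg (E.toDagger (n + 1)) h).symm.trans Module.DirectLimit.of_f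

theorem action_toDagger (f : E.compatSeq) {n : ℕ} (hn : E.rank f ≤ n) (x : E.space n) :
    E.action (f : E.tailCon.Quotient) (E.toDagger n x) = E.toDagger n (f.1 n x) :=
  E.daggerMap_of f n hn x

/-- From rank `N` on, the sequence `f` factors through the transition maps. -/
def FactorsFrom (f : E.compatSeq) (N : ℕ) : Prop :=
  E.rank f ≤ N ∧ ∀ n, N ≤ n → ∃ T : E.space (n + 1) →L[K] E.space n,
    T.comp (E.map n) = f.1 n ∧ (E.map n).comp T = f.1 (n + 1)

variable {E} {f : E.compatSeq} {N : ℕ}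

variable {Q : Polynomial K}

theorem FactorsFrom.eq_zero_of_map_eq_zero (hf : E.FactorsFrom f N) (hQ : Q.coeff 0 ≠ 0) {n : ℕ}
    (hn : N ≤ n) {x : E.space n} (hx : x ∈ genKer (forgetTopology K (E.space n) (f.1 n)) Q)
    (h : E.map n x = 0) : x = 0 := by
  obtain ⟨T, hT, -⟩ := hf.2 n hn
  refine eq_zero_of_mem_genKer hQ hx ?_
  change f.1 n x = 0
  rw [← hT]
  change T (E.map n x) = 0
  rw [h, map_zero]

theorem FactorsFrom.exists_map_eq (hf : E.FactorsFrom f N) (hQ : Q.coeff 0 ≠ 0) {n : ℕ}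
    (hn : N ≤ n) {x : E.space (n + 1)}
    (hx : x ∈ genKer (forgetTopology K (E.space (n + 1)) (f.1 (n + 1))) Q) :
    ∃ y ∈ genKer (forgetTopology K (E.space n) (f.1 n)) Q, E.map n y = x := by
  obtain ⟨T, hT, hT'⟩ := hf.2 n hn
  obtain ⟨z, hz, hzx⟩ := exists_apply_eq_of_mem_genKer hQ hx
  refine ⟨T z, map_mem_genKer (f := (T : E.space (n + 1) →ₗ[K] E.space n)) (fun w => ?_) hz, ?_⟩
  · change T (f.1 (n + 1) w) = f.1 n (T w)
    rw [← hT, ← hT']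
    rfl
  · rw [← hzx]
    change _ = f.1 (n + 1) z
    rw [← hT']
    rfl

theorem FactorsFrom.transition_mem_genKer (hf : E.FactorsFrom f N) {n m : ℕ} (hn : N ≤ n)
    (hnm : n ≤ m) {x : E.space n} (hx : x ∈ genKer (forgetTopology K (E.space n) (f.1 n)) Q) :
    E.transition n m hnm x ∈ genKer (forgetTopology K (E.space m) (f.1 m)) Q :=
  map_mem_genKer (fun w => E.compat_transition (fun k hk => E.rank_spec f k (hf.1.trans hk)) n m hn
    hnm w) hx

theorem FactorsFrom.eq_zero_of_toDagger_eq_zero (hf : E.FactorsFrom f N) (hQ : Q.coeff 0 ≠ 0)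
    {n : ℕ} (hn : N ≤ n) {x : E.space n}
    (hx : x ∈ genKer (forgetTopology K (E.space n) (f.1 n)) Q) (h : E.toDagger n x = 0) :
    x = 0 := by
  obtain ⟨m, hm, hxm⟩ := Module.DirectLimit.of.zero_exact h
  induction m, hm using Nat.le_induction with
  | base => rwa [transition_self] at hxm
  | succ m hm ih =>
    rw [E.transition_succ n m hm] at hxm
    exact ih (hf.eq_zero_of_map_eq_zero hQ (hn.trans hm) (hf.transition_mem_genKer hn hm hx) hxm)

theorem FactorsFrom.exists_toDagger_eq (hf : E.FactorsFrom f N) (hQ : Q.coeff 0 ≠ 0)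
    {n m : ℕ} (hn : N ≤ n) (hnm : n ≤ m) {x : E.space m}
    (hx : x ∈ genKer (forgetTopology K (E.space m) (f.1 m)) Q) :
    ∃ y ∈ genKer (forgetTopology K (E.space n) (f.1 n)) Q, E.toDagger n y = E.toDagger m x := by
  induction m, hnm using Nat.le_induction with
  | base => exact ⟨x, hx, rfl⟩
  | succ m hm ih =>
    obtain ⟨y, hy, rfl⟩ := hf.exists_map_eq hQ (hn.trans hm) hx
    obtain ⟨z, hz, hzy⟩ := ih hy
    exact ⟨z, hz, hzy.trans (E.toDagger_map m y).symm⟩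

/-- The generalized eigenspaces in the limit are those of `space n`, for `n` large. -/
theorem FactorsFrom.genKer_action (hf : E.FactorsFrom f N) (hQ : Q.coeff 0 ≠ 0) {n : ℕ}
    (hn : N ≤ n) :
    genKer (E.action (f : E.tailCon.Quotient)) Q =
      (genKer (forgetTopology K (E.space n) (f.1 n)) Q).map (E.toDagger n) := by
  have hint : ∀ m, N ≤ m → ∀ x, E.toDagger m (forgetTopology K (E.space m) (f.1 m) x) =
      E.action (f : E.tailCon.Quotient) (E.toDagger m x) :=
    fun m hm x => (E.action_toDagger f (hf.1.trans hm) x).symm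
  apply le_antisymm
  · intro y hy
    obtain ⟨m₀, x₀, rfl⟩ := Module.DirectLimit.exists_of y
    obtain ⟨m, hm, hnm⟩ : ∃ m, m₀ ≤ m ∧ n ≤ m := ⟨max m₀ n, le_max_left _ _, le_max_right _ _⟩
    obtain ⟨x, hx⟩ : ∃ x, E.toDagger m x = Module.DirectLimit.of K ℕ E.space E.transition m₀ x₀ :=
      ⟨E.transition m₀ m hm x₀, Module.DirectLimit.of_f⟩
    rw [← hx] at hy ⊢
    obtain ⟨k, hk⟩ := hy
    rw [← map_pow, ← aeval_apply_of_intertwining (hint m (hn.trans hnm))] at hk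
    obtain ⟨p, hmp, hp⟩ := Module.DirectLimit.of.zero_exact hk
    rw [aeval_apply_of_intertwining (u := forgetTopology K (E.space m) (f.1 m))
      (u' := forgetTopology K (E.space p) (f.1 p)) (fun w =>
      E.compat_transition (fun k hk => E.rank_spec f k (hf.1.trans hk)) m p (hn.trans hnm)
        hmp w), map_pow] at hp
    obtain ⟨y, hy, hyx⟩ := hf.exists_toDagger_eq hQ hn (hnm.trans hmp)
      (x := E.transition m p hmp x) ⟨k, hp⟩
    exact ⟨y, hy, hyx.trans Module.DirectLimit.of_f⟩
  · rintro _ ⟨x, hx, rfl⟩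
    exact map_mem_genKer (hint n hn) hx

variable (E) in
theorem fredholmSeries_eq {F : E.compatSeq} {W : E.Endo} (hF : E.Represents F W)
    {P : PowerSeries K} (hP : ∀ᶠ n in atTop, charSeries (E.basis n) (F.1 n) = P) :
    E.fredholmSeries W = P := by
  have h : ∃ P, E.IsCharSeries W P := ⟨P, F, hF, hP⟩
  rw [fredholmSeries, dif_pos h]
  obtain ⟨F', hF', hP'⟩ := h.choose_spec
  have h1 : ∀ᶠ n in atTop, F.1 n = F'.1 n := (RingCon.eq _).1 (hF.trans hF'.symm)
  obtain ⟨n, h2, h3, h4⟩ := (h1.and (hP.and hP')).exists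
  rw [← h4, ← h2, h3]

theorem FactorsFrom.isCompletelyContinuous (hf : E.FactorsFrom f N) {n : ℕ} (hn : N ≤ n) :
    IsCompletelyContinuous (f.1 n) := by
  obtain ⟨T, hT, -⟩ := hf.2 n hn
  rw [← hT]
  exact (E.map_compact n).comp_left T

variable [IsUltrametricDist K] [CompleteSpace K]

theorem FactorsFrom.charSeries_eq (hf : E.FactorsFrom f N) {g : ∀ n, E.space n →L[K] E.space n}
    (hg : ∀ n, N ≤ n → (E.map n).comp (g n) = (g (n + 1)).comp (E.map n))
    (hgf : ∀ n, N ≤ n → Commute (g n) (f.1 n)) {n : ℕ} (hn : N ≤ n) :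
    charSeries (E.basis n) (g n * f.1 n) = charSeries (E.basis N) (g N * f.1 N) := by
  induction n, hn using Nat.le_induction with
  | base => rfl
  | succ n hn ih =>
    obtain ⟨T, hT, hT'⟩ := hf.2 n hn
    have h1 := (E.basis n).charSeries_comm (E.basis (n + 1))
      ((E.map_compact n).comp_left (g (n + 1))) T
    have h2 : ((g (n + 1)).comp (E.map n)).comp T = g (n + 1) * f.1 (n + 1) := by
      rw [ContinuousLinearMap.comp_assoc, hT']
      rfl
    have h3 : T.comp ((g (n + 1)).comp (E.map n)) = g n * f.1 n := by
      rw [← hg n hn, ← ContinuousLinearMap.comp_assoc, hT]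
      exact (hgf n hn).eq.symm
    rw [← ih, ← h2, h1, h3]

theorem FactorsFrom.fredholmSeries_eq (hf : E.FactorsFrom f N) {g : E.compatSeq}
    (hg : E.rank g ≤ N) (hgf : ∀ n, N ≤ n → Commute (g.1 n) (f.1 n)) (a c : K) :
    E.fredholmSeries ((a • 1 + c • (g : E.tailCon.Quotient)) * (f : E.tailCon.Quotient)) =
      charSeries (E.basis N) ((a • 1 + c • g.1 N) * f.1 N) := by
  refine E.fredholmSeries_eq (F := (a • 1 + c • g) * f) rfl ?_
  filter_upwards [eventually_ge_atTop N] with n hn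
  refine hf.charSeries_eq (g := fun n => a • 1 + c • g.1 n) (fun n hn => ?_) (fun n hn => ?_) hn
  · rw [ContinuousLinearMap.comp_add, ContinuousLinearMap.add_comp,
      ContinuousLinearMap.comp_smul, ContinuousLinearMap.comp_smul, ContinuousLinearMap.smul_comp,
      ContinuousLinearMap.smul_comp, E.rank_spec g n (hg.trans hn)]
    rfl
  · exact Commute.add_left ((Commute.one_left _).smul_left a) ((hgf n hn).smul_left c)

variable (E) in
theorem exists_factorsFrom {U : E.Endo} (hU : E.IsCompact U) :
    ∃ (f : E.compatSeq) (N : ℕ), (f : E.tailCon.Quotient) = U ∧ E.FactorsFrom f N := by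
  obtain ⟨f, hf, h⟩ := hU
  obtain ⟨N, hN⟩ := eventually_atTop.1 h
  exact ⟨f, max N (E.rank f), hf, le_max_right _ _,
    fun n hn => hN n ((le_max_left _ _).trans hn)⟩

theorem FactorsFrom.mono (hf : E.FactorsFrom f N) {N' : ℕ} (h : N ≤ N') : E.FactorsFrom f N' :=
  ⟨hf.1.trans h, fun n hn => hf.2 n (h.trans hn)⟩

theorem FactorsFrom.exists_commute (hf : E.FactorsFrom f N) {W : E.Endo}
    (hW : Commute W (f : E.tailCon.Quotient)) :
    ∃ (g : E.compatSeq) (N : ℕ), (g : E.tailCon.Quotient) = W ∧ E.FactorsFrom f N ∧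
      E.rank g ≤ N ∧ ∀ n, N ≤ n → Commute (g.1 n) (f.1 n) := by
  obtain ⟨g, rfl⟩ := E.tailCon.mk'_surjective W
  have h1 : ∀ᶠ n in atTop, (g * f).1 n = (f * g).1 n := (RingCon.eq _).1 hW.eq
  obtain ⟨N', hN'⟩ := eventually_atTop.1 h1
  exact ⟨g, max N (max (E.rank g) N'), rfl, hf.mono (le_max_left _ _),
    (le_max_left _ _).trans (le_max_right _ _),
    fun n hn => hN' n (((le_max_right _ _).trans (le_max_right _ _)).trans hn)⟩

theorem FactorsFrom.finiteDimensional_genKer_action (hf : E.FactorsFrom f N)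
    (hQ : Q.coeff 0 ≠ 0) : FiniteDimensional K (genKer (E.action (f : E.tailCon.Quotient)) Q) := by
  rw [hf.genKer_action hQ le_rfl]
  have := finiteDimensional_genKer (E.basis N) (hf.isCompletelyContinuous le_rfl) hQ
  infer_instance

theorem FactorsFrom.finrank_map_genKer_action (hf : E.FactorsFrom f N) (hQ : Q.coeff 0 ≠ 0)
    {g : E.compatSeq} (hg : E.rank g ≤ N) (hgf : Commute (g.1 N) (f.1 N)) :
    Module.finrank K ((genKer (E.action (f : E.tailCon.Quotient)) Q).map
        (E.action (g : E.tailCon.Quotient))) =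
      Module.finrank K ((genKer (forgetTopology K (E.space N) (f.1 N)) Q).map
        (forgetTopology K (E.space N) (g.1 N))) := by
  have hst := fun x hx => genKer_stable (forgetTopology K (E.space N) (f.1 N)) _
    (hgf.map (forgetTopology K (E.space N))) Q x hx
  have h1 : (genKer (E.action (f : E.tailCon.Quotient)) Q).map
      (E.action (g : E.tailCon.Quotient)) =
        ((genKer (forgetTopology K (E.space N) (f.1 N)) Q).map
          (forgetTopology K (E.space N) (g.1 N))).map (E.toDagger N) := by
    rw [hf.genKer_action hQ le_rfl, ← Submodule.map_comp, ← Submodule.map_comp]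
    congr 1
    ext x
    exact E.action_toDagger g hg x
  rw [h1]
  refine finrank_map_eq_of_injOn ?_
  rintro _ ⟨x, hx, rfl⟩
  exact hf.eq_zero_of_toDagger_eq_zero hQ le_rfl (hst x hx)

theorem FactorsFrom.apply_apply_eq (hf : E.FactorsFrom f N) (hQ : Q.coeff 0 ≠ 0)
    {g : E.compatSeq} (hg : E.rank g ≤ N) (hgf : Commute (g.1 N) (f.1 N))
    (hi : ∀ y ∈ genKer (E.action (f : E.tailCon.Quotient)) Q,
      E.action (g : E.tailCon.Quotient) (E.action (g : E.tailCon.Quotient) y) =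
        E.action (g : E.tailCon.Quotient) y) (x : E.space N)
    (hx : x ∈ genKer (forgetTopology K (E.space N) (f.1 N)) Q) :
    g.1 N (g.1 N x) = g.1 N x := by
  have hst : ∀ x ∈ genKer (forgetTopology K (E.space N) (f.1 N)) Q,
      g.1 N x ∈ genKer (forgetTopology K (E.space N) (f.1 N)) Q :=
    fun x hx => genKer_map_mem _ Q hgf hx
  have h1 := hi (E.toDagger N x) (by
    rw [hf.genKer_action hQ le_rfl]
    exact ⟨x, hx, rfl⟩)
  rw [E.action_toDagger g hg, E.action_toDagger g hg] at h1
  rw [← sub_eq_zero]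
  refine hf.eq_zero_of_toDagger_eq_zero hQ le_rfl
    (Submodule.sub_mem _ (hst _ (hst x hx)) (hst x hx)) ?_
  rw [map_sub, h1, sub_self]

theorem multiplicity_eq {H : Type*} [Ring H] [Algebra K H] (E₁ : BanachSystem K)
    (E₂ : BanachSystem K) (ρ₁ : H →ₐ[K] E₁.Endo) (ρ₂ : H →ₐ[K] E₂.Endo) {U₁ : E₁.Endo}
    {U₂ : E₂.Endo} (hc₁ : E₁.IsCompact U₁) (hc₂ : E₂.IsCompact U₂)
    (hU₁ : ∀ h, Commute (ρ₁ h) U₁) (hU₂ : ∀ h, Commute (ρ₂ h) U₂)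
    (h : ∀ h, E₁.fredholmSeries (ρ₁ h * U₁) = E₂.fredholmSeries (ρ₂ h * U₂))
    (S : Type*) [AddCommGroup S] [Module H S] [IsSimpleModule H S] :
    E₁.multiplicity ρ₁ U₁ hU₁ S = E₂.multiplicity ρ₂ U₂ hU₂ S := by
  obtain ⟨f₁, N₁, rfl, hf₁⟩ := E₁.exists_factorsFrom hc₁
  obtain ⟨f₂, N₂, rfl, hf₂⟩ := E₂.exists_factorsFrom hc₂
  refine finiteSlopeMultiplicity_eq _ _ _ _ _ _
    (fun Q => hf₁.finiteDimensional_genKer_action Q.coeff_zero_ne_zero)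
    (fun Q => hf₂.finiteDimensional_genKer_action Q.coeff_zero_ne_zero) (fun Q a h₁ h₂ => ?_) S
  have hQ := Q.coeff_zero_ne_zero
  obtain ⟨g₁, n₁, hg₁, hf₁', hr₁, hgf₁⟩ := hf₁.exists_commute (hU₁ a)
  obtain ⟨g₂, n₂, hg₂, hf₂', hr₂, hgf₂⟩ := hf₂.exists_commute (hU₂ a)
  simp only [AlgHom.comp_apply, ← hg₁, ← hg₂] at h₁ h₂
  have hc₁ := hgf₁ n₁ le_rfl
  have hc₂ := hgf₂ n₂ le_rfl
  have e₁ := hf₁'.finrank_map_genKer_action hQ hr₁ hc₁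
  have e₂ := hf₂'.finrank_map_genKer_action hQ hr₂ hc₂
  rw [hg₁] at e₁
  rw [hg₂] at e₂
  refine e₁.trans (Eq.trans ?_ e₂.symm)
  refine finrank_map_genKer_eq (E₁.basis n₁) (E₂.basis n₂) (hf₁'.isCompletelyContinuous le_rfl)
    (hf₂'.isCompletelyContinuous le_rfl) hc₁ hc₂ Q (hf₁'.apply_apply_eq hQ hr₁ hc₁ h₁)
    (hf₂'.apply_apply_eq hQ hr₂ hc₂ h₂) fun r c => ?_
  have h3 := h (r • 1 + c • a)
  rw [map_add, map_smul, map_smul, map_one, map_add, map_smul, map_smul, map_one, ← hg₁, ← hg₂,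
    hf₁'.fredholmSeries_eq hr₁ hgf₁, hf₂'.fredholmSeries_eq hr₂ hgf₂] at h3
  exact h3

end BanachSystem

end PadicSpectral

theorem mainTheorem7 (K : Type*) [NontriviallyNormedField K] [IsUltrametricDist K]
    [CompleteSpace K] (H : Type*) [Ring H] [Algebra K H] :
    (∀ (V₁ : Type*) [NormedAddCommGroup V₁] [NormedSpace K V₁] [CompleteSpace V₁]
      (V₂ : Type*) [NormedAddCommGroup V₂] [NormedSpace K V₂] [CompleteSpace V₂]
      (ι₁ : Type*) (b₁ : PadicSpectral.ONBasis K V₁ ι₁)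
      (ι₂ : Type*) (b₂ : PadicSpectral.ONBasis K V₂ ι₂)
      (ρ₁ : H →ₐ[K] (V₁ →L[K] V₁)) (ρ₂ : H →ₐ[K] (V₂ →L[K] V₂))
      (U₁ : V₁ →L[K] V₁) (U₂ : V₂ →L[K] V₂)
      (_ : PadicSpectral.IsCompletelyContinuous U₁) (_ : PadicSpectral.IsCompletelyContinuous U₂)
      (hU₁ : ∀ h, Commute (ρ₁ h) U₁) (hU₂ : ∀ h, Commute (ρ₂ h) U₂)
      (_ : ∀ h, PadicSpectral.charSeries b₁ (ρ₁ h * U₁) = PadicSpectral.charSeries b₂ (ρ₂ h * U₂))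
      (S : Type*) [AddCommGroup S] [Module H S] [IsSimpleModule H S],
      PadicSpectral.banachMultiplicity ρ₁ U₁ hU₁ S =
        PadicSpectral.banachMultiplicity ρ₂ U₂ hU₂ S) ∧
    (∀ (E₁ : PadicSpectral.BanachSystem K) (E₂ : PadicSpectral.BanachSystem K)
      (ρ₁ : H →ₐ[K] E₁.Endo) (ρ₂ : H →ₐ[K] E₂.Endo) (U₁ : E₁.Endo) (U₂ : E₂.Endo)
      (_ : E₁.IsCompact U₁) (_ : E₂.IsCompact U₂)
      (hU₁ : ∀ h, Commute (ρ₁ h) U₁) (hU₂ : ∀ h, Commute (ρ₂ h) U₂)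
      (_ : ∀ h, E₁.fredholmSeries (ρ₁ h * U₁) = E₂.fredholmSeries (ρ₂ h * U₂))
      (S : Type*) [AddCommGroup S] [Module H S] [IsSimpleModule H S],
      E₁.multiplicity ρ₁ U₁ hU₁ S = E₂.multiplicity ρ₂ U₂ hU₂ S) := by
  refine ⟨?_, ?_⟩
  · intro V₁ _ _ _ V₂ _ _ _ ι₁ b₁ ι₂ b₂ ρ₁ ρ₂ U₁ U₂ hc₁ hc₂ hU₁ hU₂ h S _ _ _
    exact PadicSpectral.banachMultiplicity_eq b₁ b₂ ρ₁ ρ₂ hc₁ hc₂ hU₁ hU₂ h S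
  · intro E₁ E₂ ρ₁ ρ₂ U₁ U₂ hc₁ hc₂ hU₁ hU₂ h S _ _ _
    exact PadicSpectral.BanachSystem.multiplicity_eq E₁ E₂ ρ₁ ρ₂ hc₁ hc₂ hU₁ hU₂ h S
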